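/- Let the atoms be a structure $(\mathbb A, r)$ isomorphic to the equality atoms $(\mathbb N,=)$ or to the ordered atoms $(\mathbb Q,<)$, and let $\mathbb F$ be a field. Sets with atoms are acted on by atom automorphisms. An object is finitely supported if it is fixed by all automorphisms that fix some suitable finite set of atoms. A set with atoms is a finitely supported set all of whose elements are finitely supported. It is orbit-finite if, for some finite set $S$ of atoms, it is a finite union of orbits under the automorphisms that fix $S$ pointwise. Elements of $\mathbb F$ are fixed by all automorphisms. Let $\Sigma$ be an orbit-finite set and let $L:\Sigma^*\to\mathbb F$ be a function. Then the following conditions are equivalent: 1. $L$ is recognized by an orbit-finitely spanned monoid. That is, there are an orbit-finitely spanned vector space $M$ (a vector space over $\mathbb F$ whose underlying set is a set with atoms, whose addition and scalar multiplication are finitely supported, and which is spanned by an orbit-finite subset), a finitely supported bilinear operation that makes $M$ a monoid, a finitely supported monoid homomorphism $h:\Sigma^*\to M$, and a finitely supported linear map $f:M\to\mathbb F$, such that $L=f\circ h$. 2. $L$ is recognized by a weighted orbit-finite automaton. That is, there are an orbit-finite set $Q$ and finitely supported functions $I:Q\to\mathbb F$, $\delta:Q\times\Sigma\times Q\to\mathbb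 F$, $F:Q\to\mathbb F$, such that $I$ is nonzero on only finitely many states, for all $q\in Q$ and $a\in\Sigma$ only finitely many $p\in Q$ satisfy $\delta(q,a,p)\neq 0$, and $$L(a_1\cdots a_n)=\sum_{q_0,\ldots,q_n\in Q} I(q_0)\Bigl(\prod_{i=1}^n\delta(q_{i-1},a_i,q_i)\Bigr)F(q_n)$$ for every word $a_1\cdots a_n\in\Sigma^*$. 3. $L$ is recognized by an orbit-finitely spanned automaton. That is, there are an orbit-finitely spanned vector space $V$, a finitely supported function $\delta:V\times\Sigma\to V$ that is linear in its first argument, a vector $v_0\in V$, and a finitely supported linear map $F:V\to\mathbb F$, such that $L(a_1\cdots a_n)=F(\delta(\cdots\delta(\delta(v_0,a_1),a_2)\cdots,a_n))$ for every word $a_1\cdots a_n\in\Sigma^*$. -/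

import Mathlib

/-! Sets with atoms, over atoms `(A, r)`: a set `A` equipped with one binary relation `r`
(for instance `(ℕ, =)` or `(ℚ, <)`).  An atom automorphism is an element of the group `r ≃r r`. -/

namespace Atoms

universe u v

variable {A : Type} {r : A → A → Prop}

/-- `π` is an `S`-automorphism: it fixes every atom of the finite set `S`. -/
def Fixes (π : r ≃r r) (S : Finset A) : Prop :=
  ∀ a ∈ S, π a = a

/-- `x` is finitely supported: it is fixed by every automorphism that fixes
some suitable finite set of atoms. -/
def FinSupp (r : A → A → Prop) {X : Type*} [MulAction (r ≃r r) X] (x : X) : Prop :=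
  ∃ S : Finset A, ∀ π : r ≃r r, Fixes π S → π • x = x

/-- `Y` is finitely supported as a set: `π(Y) = Y` for all automorphisms `π` fixing
some suitable finite set of atoms. -/
def FinSuppSet (r : A → A → Prop) {X : Type*} [MulAction (r ≃r r) X] (Y : Set X) : Prop :=
  ∃ S : Finset A, ∀ π : r ≃r r, Fixes π S → (fun x => π • x) '' Y = Y

/-- `Y` is orbit-finite: for some finite set `S` of atoms it is a finite union of `S`-orbits. -/
def OrbitFinite (r : A → A → Prop) {X : Type*} [MulAction (r ≃r r) X] (Y : Set X) : Prop :=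
  ∃ (S : Finset A) (T : Set X), T.Finite ∧
    Y = ⋃ t ∈ T, {y | ∃ π : r ≃r r, Fixes π S ∧ y = π • t}

/-- A set with atoms: a finitely supported set all of whose elements are finitely supported.
Its elements are taken from an arbitrary universe `Ambient` on which all atom automorphisms act. -/
structure AtomSet (r : A → A → Prop) : Type (u + 1) where
  Ambient : Type u
  [action : MulAction (r ≃r r) Ambient]
  carrier : Set Ambient
  finSupp_carrier : FinSuppSet r carrier
  finSupp_mem : ∀ x ∈ carrier, FinSupp r x

attribute [instance] AtomSet.action

instance : CoeSort (AtomSet.{u} r) (Type u) := ⟨fun Q => Q.carrier⟩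

/-- The set with atoms `Q` is orbit-finite. -/
def AtomSet.IsOrbitFinite (Q : AtomSet.{u} r) : Prop :=
  OrbitFinite r Q.carrier

/-- `Q.Moves π x y` says that `y = π(x)`, for elements `x`, `y` of `Q`.
(If `π` does not preserve `Q`, then `π(x)` need not be in `Q`.)

A function `f : Q → P` between sets with atoms is finitely supported if and only if for some finite
set `S` of atoms, every automorphism `π` that fixes `S` satisfies `f (π(x)) = π(f x)`, that is
`Q.Moves π x x' → P.Moves π (f x) (f x')`; automorphisms act componentwise on tuples and letterwise
on words, and trivially on the elements of the field. -/
def AtomSet.Moves (Q : AtomSet.{u} r) (π : r ≃r r) (x y : Q) : Prop :=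
  (y : Q.Ambient) = π • (x : Q.Ambient)

/-- A finitely supported function from a set with atoms to the field. -/
def FinSuppScalar {F : Type*} (Q : AtomSet.{u} r) (f : Q → F) : Prop :=
  ∃ S : Finset A, ∀ π : r ≃r r, Fixes π S →
    ∀ x x' : Q, Q.Moves π x x' → f x' = f x

/-! ### Weighted orbit-finite automata -/

/-- A weighted orbit-finite automaton with input alphabet `Al`. -/
structure WeightedAutomaton (F : Type u) [Field F] (Al : AtomSet.{v} r) where
  Q : AtomSet.{u} r
  orbitFinite : Q.IsOrbitFinite
  init : Q → F
  trans : Q → Al → Q → F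
  final : Q → F
  init_finSupp : FinSuppScalar Q init
  trans_finSupp : ∃ S : Finset A, ∀ π : r ≃r r, Fixes π S →
    ∀ (p p' : Q) (a a' : Al) (q q' : Q), Q.Moves π p p' → Al.Moves π a a' → Q.Moves π q q' →
      trans p' a' q' = trans p a q
  final_finSupp : FinSuppScalar Q final
  /-- Non-guessing: finitely many states have nonzero initial weight. -/
  init_finite : {q | init q ≠ 0}.Finite
  /-- Non-guessing: every state and letter have finitely many outgoing transitions. -/
  trans_finite : ∀ (q : Q) (a : Al), {p | trans q a p ≠ 0}.Finite

/-- The weight of the run `ρ 0, …, ρ n` over the word `w` of length `n`. -/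
def WeightedAutomaton.runWeight {F : Type u} [Field F] {Al : AtomSet.{v} r}
    (M : WeightedAutomaton F Al) (w : List Al) (ρ : Fin (w.length + 1) → M.Q) : F :=
  M.init (ρ 0) * (∏ i : Fin w.length, M.trans (ρ i.castSucc) (w.get i) (ρ i.succ)) *
    M.final (ρ (Fin.last w.length))

/-- The weight of a word: the sum of the weights of all runs over it (only finitely many of them
are nonzero, by the non-guessing condition). -/
noncomputable def WeightedAutomaton.weight {F : Type u} [Field F] {Al : AtomSet.{v} r}
    (M : WeightedAutomaton F Al) (w : List Al) : F :=
  ∑ᶠ ρ : Fin (w.length + 1) → M.Q, M.runWeight w ρ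

/-! ### Orbit-finitely spanned vector spaces and automata -/

/-- An orbit-finitely spanned vector space: a vector space whose underlying set is a set with atoms,
whose operations are finitely supported, and which is spanned by an orbit-finite subset. -/
structure OFSSpace (r : A → A → Prop) (F : Type u) [Field F] where
  V : AtomSet.{u} r
  [addCommGroup : AddCommGroup V]
  [module : Module F V]
  add_finSupp : ∃ S : Finset A, ∀ π : r ≃r r, Fixes π S →
    ∀ x x' y y' : V, V.Moves π x x' → V.Moves π y y' → V.Moves π (x + y) (x' + y')
  smul_finSupp : ∃ S : Finset A, ∀ π : r ≃r r, Fixes π S →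
    ∀ (c : F) (x x' : V), V.Moves π x x' → V.Moves π (c • x) (c • x')
  spanned : ∃ B : Set V, OrbitFinite r ((fun x : V => (x : V.Ambient)) '' B) ∧
    Submodule.span F B = ⊤

attribute [instance] OFSSpace.addCommGroup OFSSpace.module

/-- An orbit-finitely spanned automaton with input alphabet `Al`. -/
structure OFSAutomaton (F : Type u) [Field F] (Al : AtomSet.{v} r) extends OFSSpace r F where
  trans : Al → V →ₗ[F] V
  trans_finSupp : ∃ S : Finset A, ∀ π : r ≃r r, Fixes π S →
    ∀ (x x' : V) (a a' : Al), V.Moves π x x' → Al.Moves π a a' →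
      V.Moves π (trans a x) (trans a' x')
  init : V
  final : V →ₗ[F] F
  final_finSupp : FinSuppScalar V final

/-- The output of the automaton on `w`: start in the initial vector, apply the transition
functions of the letters from left to right, and then the final function. -/
def OFSAutomaton.output {F : Type u} [Field F] {Al : AtomSet.{v} r}
    (M : OFSAutomaton F Al) (w : List Al) : F :=
  M.final (w.foldl (fun x a => M.trans a x) M.init)

/-! ### Orbit-finitely spanned monoids -/

/-- An orbit-finitely spanned monoid: an orbit-finitely spanned vector space with a (finitely
supported) monoid operation that is linear in each of the two coordinates. -/
structure OFSMonoid (r : A → A → Prop) (F : Type u) [Field F] extends OFSSpace r F where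
  [monoid : Monoid V]
  mul_finSupp : ∃ S : Finset A, ∀ π : r ≃r r, Fixes π S →
    ∀ x x' y y' : V, V.Moves π x x' → V.Moves π y y' → V.Moves π (x * y) (x' * y')
  add_mul : ∀ x y z : V, (x + y) * z = x * z + y * z
  mul_add : ∀ x y z : V, x * (y + z) = x * y + x * z
  smul_mul : ∀ (c : F) (x y : V), (c • x) * y = c • (x * y)
  mul_smul : ∀ (c : F) (x y : V), x * (c • y) = c • (x * y)

attribute [instance] OFSMonoid.monoid

/-- `L` is the composition of a finitely supported monoid homomorphism `h` from the words to `M`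
with a finitely supported linear map from `M` to the field. -/
def OFSMonoid.Recognizes {F : Type u} [Field F] {Al : AtomSet.{v} r}
    (M : OFSMonoid r F) (L : List Al → F) : Prop :=
  ∃ (h : FreeMonoid Al →* M.V) (f : M.V →ₗ[F] F),
    (∃ S : Finset A, ∀ π : r ≃r r, Fixes π S →
      ∀ w w' : FreeMonoid Al, List.Forall₂ (Al.Moves π) w.toList w'.toList →
        M.V.Moves π (h w) (h w')) ∧
    FinSuppScalar M.V f ∧
    ∀ w : List Al, L w = f (h (FreeMonoid.ofList w))

end Atoms

/-! The three conditions are joined in a cycle. A monoid acts on itself by right multiplication,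
which gives a spanned automaton. The other two implications rest on one device: cutting arbitrary
finite supports down to bounded size, linearly and equivariantly, over any field.

All constants are collected in a finite set `S`, and `G` is the stabilizer of `S`. For finite `J`,
the quotient by `aug G F V J` is the space of coinvariants of `Fix G J`; functionals on it are the
functionals on `V` invariant under `Fix G J`. For equality atoms (discretely ordered), `Indep S J E
E'` says that `E` and `E'` meet only inside `J ∪ S`. For ordered atoms it says that a point of `E`
outside `J ∪ S` lies to the left of all points of `E'` in its interval cut out by `J ∪ S`. This
one-sided rule makes generic position unique: two generic translates differ by an element of `Fix G
(J ∪ E')` (`Homogeneous.stationary`). So moving a vector by `Fix G J` into generic position relative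
to `T` is a well-defined linear map `generic` into the coinvariants over `T`.

The key lemma is `exists_reduction`. If `T` is large and a vector has a small support, then some
atom of `O T` can be dropped from `T` without changing the generic translate. Hence the alternating
sum over subsets of `O T` cancels in pairs; solving for the term of `T` and iterating leaves only
subsets of bounded size.

In `exists_weighted` a state is a set `J` with a class modulo `aug G F V J`, and stands for a
generic translate of that class over `J`. Reading a letter adds its support to `J`, applies the
transition, reduces to sets of bounded size, and expands the result in finitely many orbits of
classes (`exists_equivariant_lift`). `Tame.indep_trans` shows that successive generic choices amount
to a single one.

For `suppEnd_spanned`, an endomorphism of the space with basis `Q` is viewed as a functional on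
pairs of states. The same reduction splits it into endomorphisms with bounded supports; those
supported by a fixed `J` form a finite-dimensional space, and such `J` fall into finitely many
orbits. The weighted automaton is then evaluated in this algebra. -/

namespace TameAction

open scoped Pointwise Classical

/-! ### Supports and equivariant choice. -/

section Basic

variable {G A X Y : Type*} [Group G] [MulAction G A] [MulAction G X] [MulAction G Y]

/-- The pointwise stabilizer of a finite set of atoms. -/
def Fix (G : Type*) {A : Type*} [Group G] [MulAction G A] (J : Finset A) : Subgroup G :=
  fixingSubgroup G (J : Set A)

theorem mem_Fix {J : Finset A} {g : G} : g ∈ Fix G J ↔ ∀ a ∈ J, g • a = a := by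
  simp [Fix, mem_fixingSubgroup_iff]

theorem Fix_anti {J K : Finset A} (h : J ⊆ K) : Fix G K ≤ Fix G J := fun _ hg =>
  mem_Fix.2 fun a ha => mem_Fix.1 hg a (h ha)

theorem conj_mem_Fix {J : Finset A} {g h : G} (hh : h ∈ Fix G J) :
    g * h * g⁻¹ ∈ Fix G (g • J) := by
  refine mem_Fix.2 fun a ha => ?_
  obtain ⟨b, hb, rfl⟩ := Finset.mem_smul_finset.1 ha
  simp [mul_smul, mem_Fix.1 hh b hb]

theorem mem_Fix_smul {J : Finset A} {g h : G} : h ∈ Fix G (g • J) ↔ g⁻¹ * h * g ∈ Fix G J := by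
  constructor
  · intro hh
    have := conj_mem_Fix (g := g⁻¹) hh
    simpa using this
  · intro hh
    have := conj_mem_Fix (g := g) hh
    simpa [mul_assoc] using this

theorem smul_eq_self_of_mem_Fix {J : Finset A} {g : G} (h : g ∈ Fix G J) : g • J = J := by
  ext a
  rw [Finset.mem_smul_finset]
  constructor
  · rintro ⟨b, hb, rfl⟩
    rwa [mem_Fix.1 h b hb]
  · exact fun ha => ⟨a, ha, mem_Fix.1 h a ha⟩

/-- `E` supports `x`: every group element fixing `E` pointwise fixes `x`. -/
def Supports (G : Type*) {A X : Type*} [Group G] [MulAction G A] [MulAction G X]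
    (E : Finset A) (x : X) : Prop :=
  ∀ g ∈ Fix G E, g • x = x

theorem Supports.mono {E E' : Finset A} {x : X} (h : Supports G E x) (hE : E ⊆ E') :
    Supports G E' x := fun g hg => h g (Fix_anti hE hg)

theorem Supports.smul {E : Finset A} {x : X} (h : Supports G E x) (g : G) :
    Supports G (g • E) (g • x) := fun k hk => by
  have := h _ (mem_Fix_smul.1 hk)
  rw [mul_smul, mul_smul] at this
  exact inv_smul_eq_iff.1 this

theorem Supports.smul_eq_smul {E : Finset A} {x : X} (h : Supports G E x) {g g' : G}
    (hg : ∀ e ∈ E, g • e = g' • e) : g • x = g' • x := by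
  have : (g'⁻¹ * g) • x = x := h _ (mem_Fix.2 fun e he => by rw [mul_smul, hg e he]; simp)
  rw [mul_smul, inv_smul_eq_iff] at this
  exact this

/-- An equivariant choice function exists as soon as every point has an admissible value that is
fixed by its stabilizer. -/
theorem exists_equivariant_choice (P : X → Y → Prop)
    (hP : ∀ (g : G) x y, P x y → P (g • x) (g • y))
    (h : ∀ x, ∃ y, P x y ∧ MulAction.stabilizer G x ≤ MulAction.stabilizer G y) :
    ∃ f : X → Y, (∀ (g : G) x, f (g • x) = g • f x) ∧ ∀ x, P x (f x) := by
  choose c hc hstab using h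
  let rep : X → X := fun x => (Quotient.mk (MulAction.orbitRel G X) x).out
  have hrep : ∀ x, ∃ g : G, g • rep x = x := fun x => by
    have : (MulAction.orbitRel G X) x (rep x) :=
      Setoid.symm' _ (Quotient.mk_out (s := MulAction.orbitRel G X) x)
    exact MulAction.orbitRel_apply.1 this
  have hrep' : ∀ (g : G) x, rep (g • x) = rep x := fun g x => by
    have : Quotient.mk (MulAction.orbitRel G X) (g • x) = Quotient.mk (MulAction.orbitRel G X) x :=
      Quotient.sound (MulAction.orbitRel_apply.2 ⟨g, rfl⟩)
    simp only [rep, this]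
  choose k hk using hrep
  -- Two elements carrying the representative to `x` differ by an element of its stabilizer, which
  -- also fixes the chosen value.
  have key : ∀ x (g : G), g • rep x = x → g • c (rep x) = k x • c (rep x) := fun x g hg => by
    have : (k x)⁻¹ * g ∈ MulAction.stabilizer G (rep x) := by
      rw [MulAction.mem_stabilizer_iff, mul_smul, hg, inv_smul_eq_iff, hk]
    have := hstab _ this
    rw [MulAction.mem_stabilizer_iff, mul_smul, inv_smul_eq_iff] at this
    exact this
  refine ⟨fun x => k x • c (rep x), fun g x => ?_, fun x => ?_⟩
  · have := key (g • x) (g * k x) (by rw [hrep', mul_smul, hk])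
    rw [hrep', mul_smul] at this
    simp only [hrep', this]
  · have := hP (k x) _ _ (hc (rep x))
    rwa [hk] at this

end Basic

/-! ### Tame actions, independence and least supports. -/

section Order

variable {G A X Y : Type*} [Group G] [MulAction G A] [MulAction G X] [MulAction G Y]
  [PartialOrder A]

/-- `Indep S J E E'` expresses that the atoms of `E` are in generic position with respect to those
of `E'`, relatively to `J ∪ S`. -/
def Indep (S J E E' : Finset A) : Prop :=
  ∀ e ∈ E, ∀ e' ∈ E', e' ≤ e → ∃ j ∈ J ∪ S, e' ≤ j ∧ j ≤ e

variable {S J E E' : Finset A}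

theorem Indep.mono {K F F' : Finset A} (h : Indep S J E E') (hJ : J ⊆ K) (hE : F ⊆ E)
    (hE' : F' ⊆ E') : Indep S K F F' := fun e he e' he' hle => by
  obtain ⟨j, hj, h1⟩ := h e (hE he) e' (hE' he') hle
  exact ⟨j, Finset.union_subset_union_left hJ hj, h1⟩

theorem indep_self_right (J E : Finset A) : Indep S J E J := fun _ _ e' he' hle =>
  ⟨e', Finset.mem_union_left _ he', le_rfl, hle⟩

variable (G S) in
/-- The properties of the automorphism group of a homogeneous structure of atoms that make the
theory of orbit-finitely spanned vector spaces work; the atoms of `S` are constants. -/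
structure Tame : Prop where
  smul_le_smul : ∀ (g : G) (a b : A), g • a ≤ g • b ↔ a ≤ b
  smul_const : ∀ g : G, ∀ s ∈ S, g • s = s
  finite_orbits : ∀ (J : Finset A) (n : ℕ), ∃ t : Set (Fin n → A), t.Finite ∧
    ∀ x, ∃ y ∈ t, ∃ g ∈ Fix G J, x = g • y
  exists_indep : ∀ J E E' : Finset A, ∃ g ∈ Fix G J, Indep S J (g • E) E'
  -- Uniqueness of generic position, the source of every well-definedness argument below.
  stationary : ∀ (J E E' : Finset A) (g g' : G), g ∈ Fix G J → g' ∈ Fix G J →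
    Indep S J (g • E) E' → Indep S J (g' • E) E' → ∃ h ∈ Fix G (J ∪ E'), ∀ e ∈ E, h • g • e = g' • e
  -- `O T` is a large set of removable atoms. `π R` restores genericity after `R` is removed from
  -- `T`, and a small `y` cannot notice the removal of every single atom: for some `t` the moves for
  -- `R` and `insert t R` agree on `y`. This produces the cancelling pairs in `exists_reduction`.
  reduce : ∃ O : Finset A → Finset A, (∀ (g : G) T, O (g • T) = g • O T) ∧ (∀ T, O T ⊆ T) ∧
    (∀ k, ∃ D, ∀ T, D < T.card → k < (O T).card) ∧
    ∀ T E E', Indep S T E E' → ∃ π : Finset A → G,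
      (∀ R ⊆ O T, π R ∈ Fix G (T \ R) ∧ Indep S (T \ R) (π R • E) E') ∧
      ∀ y ⊆ E, y.card < (O T).card → ∃ t ∈ O T, ∀ R ⊆ (O T).erase t, ∀ x ∈ y,
        π (insert t R) • x = π R • x

namespace Tame

variable (tm : Tame G S)
include tm

theorem indep_smul (h : Indep S J E E') (g : G) : Indep S (g • J) (g • E) (g • E') := by
  intro e he e' he' hle
  obtain ⟨a, ha, rfl⟩ := Finset.mem_smul_finset.1 he
  obtain ⟨b, hb, rfl⟩ := Finset.mem_smul_finset.1 he'
  obtain ⟨j, hj, h1, h2⟩ := h a ha b hb ((tm.smul_le_smul g b a).1 hle)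
  refine ⟨g • j, ?_, (tm.smul_le_smul _ _ _).2 h1, (tm.smul_le_smul _ _ _).2 h2⟩
  rcases Finset.mem_union.1 hj with h3 | h3
  · exact Finset.mem_union_left _ (Finset.smul_mem_smul_finset h3)
  · rw [tm.smul_const g j h3]
    exact Finset.mem_union_right _ h3

/-- A separating point over `J ∪ F` that lies in `F` is itself separated by a point of `J ∪ S`,
because `g'` fixes `F` and preserves the first independence. -/
theorem indep_trans {F : Finset A} {g g' : G} (h : Indep S J (g • E) F)
    (hg' : g' ∈ Fix G (J ∪ F)) (h' : Indep S (J ∪ F) (g' • g • E) E') :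
    Indep S J ((g' * g) • E) (F ∪ E') := by
  have key : ∀ x ∈ g' • g • E, ∀ f ∈ F, f ≤ x → ∃ j ∈ J ∪ S, f ≤ j ∧ j ≤ x := by
    intro x hx f hf hle
    obtain ⟨y, hy, rfl⟩ := Finset.mem_smul_finset.1 hx
    have hfix : ∀ j ∈ J ∪ S, g' • j = j := fun j hj => by
      rcases Finset.mem_union.1 hj with h1 | h1
      · exact mem_Fix.1 hg' j (Finset.mem_union_left _ h1)
      · exact tm.smul_const g' j h1
    have hle' : f ≤ y := by
      rw [← mem_Fix.1 hg' f (Finset.mem_union_right _ hf)] at hle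
      exact (tm.smul_le_smul _ _ _).1 hle
    obtain ⟨j, hj, h1, h2⟩ := h y hy f hf hle'
    refine ⟨j, hj, h1, ?_⟩
    rw [← hfix j hj]
    exact (tm.smul_le_smul _ _ _).2 h2
  rw [mul_smul]
  intro x hx e' he' hle
  rcases Finset.mem_union.1 he' with h1 | h1
  · exact key x hx e' h1 hle
  · obtain ⟨j, hj, h2, h3⟩ := h' x hx e' h1 hle
    by_cases hJ : j ∈ J ∪ S
    · exact ⟨j, hJ, h2, h3⟩
    · have hjF : j ∈ F := by
        simp only [Finset.mem_union] at hj hJ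
        tauto
      obtain ⟨i, hi, h4, h5⟩ := key x hx j hjF h3
      exact ⟨i, hi, h2.trans h4, h5⟩

/-- By stationarity every generic move over `J` acts on `E` as some element of `Fix G (J ∪ E')`, so
it fixes `x`. An arbitrary `g` is a quotient of two generic moves, `i * g` and `i`. -/
theorem supports_of_indep {x : X} (h1 : Supports G E x) (h2 : Supports G E' x)
    (h : Indep S J E E') : Supports G J x := by
  intro g hg
  obtain ⟨i, hi, hind⟩ := tm.exists_indep J (E ∪ g • E) E'
  have key : ∀ k ∈ Fix G J, Indep S J (k • E) E' → k • x = x := fun k hk hkind => by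
    obtain ⟨l, hl, hle⟩ := tm.stationary J E E' 1 k (one_mem _) hk (by simpa using h) hkind
    rw [← h1.smul_eq_smul (g := l) (g' := k) (by simpa using hle)]
    exact h2 l (Fix_anti Finset.subset_union_right hl)
  have hi1 : i • x = x := key i hi (hind.mono subset_rfl
    (Finset.smul_finset_subset_smul_finset Finset.subset_union_left) subset_rfl)
  have hi2 : (i * g) • x = x := key (i * g) (mul_mem hi hg) (hind.mono subset_rfl
    (by rw [mul_smul]; exact Finset.smul_finset_subset_smul_finset Finset.subset_union_right)
    subset_rfl)
  rw [mul_smul] at hi2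
  exact (smul_left_cancel i (hi2.trans hi1.symm))

/-- Of two distinct atoms one is not below the other, so one of the two enlarged sets is independent
of the other over `E`. -/
theorem supports_of_insert {x : X} {s t : A} (hst : s ≠ t) (h1 : Supports G (insert s E) x)
    (h2 : Supports G (insert t E) x) : Supports G E x := by
  have key : ∀ {s t : A}, ¬ t ≤ s → Indep S E (insert s E) (insert t E) := by
    intro s t hts e he e' he' hle
    rcases Finset.mem_insert.1 he with rfl | h3
    · rcases Finset.mem_insert.1 he' with rfl | h4
      · exact absurd hle hts
      · exact ⟨e', Finset.mem_union_left _ h4, le_rfl, hle⟩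
    · exact ⟨e, Finset.mem_union_left _ h3, hle, le_rfl⟩
  by_cases hts : t ≤ s
  · exact tm.supports_of_indep h2 h1 (key fun h => hst (le_antisymm h hts))
  · exact tm.supports_of_indep h1 h2 (key hts)

theorem supports_inter {x : X} (h1 : Supports G E x) (h2 : Supports G E' x) :
    Supports G (E ∩ E') x := by
  -- The symmetric difference is deleted gradually. If `Z` misses `E` or `E'`, a given support
  -- survives; otherwise `Z` contains atoms from both sides, and putting either one back gives a
  -- smaller deletion.
  have key : ∀ n, ∀ Z ⊆ (E \ E') ∪ (E' \ E), Z.card = n → Supports G ((E ∪ E') \ Z) x := by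
    intro n
    induction n using Nat.strong_induction_on with
    | _ n ih =>
      intro Z hZ hn
      by_cases ha : Z ⊆ E \ E'
      · refine h2.mono fun a haE => ?_
        simp only [Finset.mem_sdiff, Finset.mem_union]
        exact ⟨Or.inr haE, fun haZ => (Finset.mem_sdiff.1 (ha haZ)).2 haE⟩
      by_cases hb : Z ⊆ E' \ E
      · refine h1.mono fun a haE => ?_
        simp only [Finset.mem_sdiff, Finset.mem_union]
        exact ⟨Or.inl haE, fun haZ => (Finset.mem_sdiff.1 (hb haZ)).2 haE⟩
      obtain ⟨s, hsZ, hs⟩ := Finset.not_subset.1 ha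
      obtain ⟨t, htZ, ht⟩ := Finset.not_subset.1 hb
      have hsE : s ∈ E' \ E := (Finset.mem_union.1 (hZ hsZ)).resolve_left hs
      have htE : t ∈ E \ E' := (Finset.mem_union.1 (hZ htZ)).resolve_right ht
      have hst : s ≠ t := by
        rintro rfl
        exact hs htE
      have hd : ∀ u ∈ Z, Supports G (insert u ((E ∪ E') \ Z)) x := fun u hu => by
        refine (ih (Z.erase u).card (by rw [← hn]; exact Finset.card_erase_lt_of_mem hu)
          (Z.erase u) ((Finset.erase_subset _ _).trans hZ) rfl).mono fun a ha => ?_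
        simp only [Finset.mem_sdiff, Finset.mem_erase, Finset.mem_insert] at ha ⊢
        tauto
      exact tm.supports_of_insert hst (hd s hsZ) (hd t htZ)
  have := key _ _ subset_rfl rfl
  refine this.mono fun a ha => ?_
  simp only [Finset.mem_sdiff, Finset.mem_union, Finset.mem_inter] at ha ⊢
  tauto

theorem exists_least_support {x : X} (h : ∃ E : Finset A, Supports G E x) :
    ∃ E : Finset A, Supports G E x ∧ ∀ E', Supports G E' x → E ⊆ E' := by
  let P : ℕ → Prop := fun n => ∃ E : Finset A, Supports G E x ∧ E.card = n
  have hP : ∃ n, P n := by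
    obtain ⟨E, hE⟩ := h
    exact ⟨_, E, hE, rfl⟩
  obtain ⟨E, hE, hcard⟩ := Nat.find_spec hP
  refine ⟨E, hE, fun E' hE' => ?_⟩
  have h1 : Nat.find hP ≤ (E ∩ E').card := Nat.find_min' hP ⟨_, tm.supports_inter hE hE', rfl⟩
  rw [← hcard] at h1
  rw [← Finset.eq_of_subset_of_card_le Finset.inter_subset_left h1]
  exact Finset.inter_subset_right

theorem exists_equivariant_support (h : ∀ x : X, ∃ E : Finset A, Supports G E x) :
    ∃ σ : X → Finset A, (∀ x, Supports G (σ x) x) ∧ ∀ (g : G) x, σ (g • x) = g • σ x := by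
  choose σ hσ hmin using fun x => tm.exists_least_support (h x)
  refine ⟨σ, hσ, fun g x => ?_⟩
  refine Finset.Subset.antisymm (hmin _ _ ((hσ x).smul g)) ?_
  have := hmin x (g⁻¹ • σ (g • x)) (by simpa using (hσ (g • x)).smul g⁻¹)
  simpa using Finset.smul_finset_subset_smul_finset (a := g) this

/-- An element with a finite orbit under `Fix G J` is fixed by it. -/
theorem supports_of_finite_orbit {x : X} (hx : ∃ E : Finset A, Supports G E x)
    (hsupp : ∀ y : X, ∃ E : Finset A, Supports G E y)
    (hfin : {y | ∃ g ∈ Fix G J, y = g • x}.Finite) : Supports G J x := by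
  choose σ hσ using hsupp
  -- `E'` supports the whole finite orbit, in particular the translate of `x` whose own support is
  -- moved independently of `E'`.
  let E' : Finset A := hfin.toFinset.biUnion σ
  obtain ⟨E, hE⟩ := hx
  obtain ⟨i, hi, hind⟩ := tm.exists_indep J E E'
  have h2 : Supports G E' (i • x) := (hσ (i • x)).mono
    (Finset.subset_biUnion_of_mem σ (hfin.mem_toFinset.2 ⟨i, hi, rfl⟩))
  have h3 := tm.supports_of_indep (hE.smul i) h2 hind
  have h4 := h3.smul i⁻¹
  rwa [inv_smul_smul, smul_eq_self_of_mem_Fix (inv_mem hi)] at h4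

omit tm [PartialOrder A] in
-- A translate of `x` depends only on where the supporting tuple `e` goes, so orbits of tuples bound
-- orbits of translates. The value 1 of `c` is for tuples that are not translates of `e`.
theorem exists_finite_reps_aux {n : ℕ} {J : Finset A} {t : Set (Fin n → A)} (ht : t.Finite)
    (hcov : ∀ x, ∃ y ∈ t, ∃ g ∈ Fix G J, x = g • y) {x : X} (e : Fin n → A)
    (he : Supports G (Finset.univ.image e) x) :
    ∃ r : Set X, r.Finite ∧ ∀ g : G, ∃ y ∈ r, ∃ h ∈ Fix G J, g • x = h • y := by
  let c : (Fin n → A) → G := fun y => if h : ∃ g : G, y = g • e then h.choose else 1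
  refine ⟨(fun y => c y • x) '' t, ht.image _, fun g => ?_⟩
  obtain ⟨y, hy, h, hh, hgy⟩ := hcov (g • e)
  have hex : ∃ g : G, y = g • e := ⟨h⁻¹ * g, by rw [mul_smul, hgy, inv_smul_smul]⟩
  have hc : y = c y • e := by
    simp only [c, dif_pos hex]
    exact hex.choose_spec
  refine ⟨_, ⟨y, hy, rfl⟩, h, hh, ?_⟩
  rw [← mul_smul]
  refine he.smul_eq_smul fun a ha => ?_
  obtain ⟨i, -, rfl⟩ := Finset.mem_image.1 ha
  have := congrFun hgy i
  rw [hc] at this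
  simpa [mul_smul] using this

/-- The orbit of a finitely supported element is a finite union of `Fix G J`-orbits. -/
theorem exists_finite_reps (J : Finset A) {x : X} (hE : Supports G E x) :
    ∃ r : Set X, r.Finite ∧ ∀ g : G, ∃ y ∈ r, ∃ h ∈ Fix G J, g • x = h • y := by
  obtain ⟨t, ht, hcov⟩ := tm.finite_orbits J E.card
  refine exists_finite_reps_aux ht hcov (fun i => ((E.equivFin.symm i : E) : A)) ?_
  refine hE.mono fun a ha => Finset.mem_image.2 ⟨E.equivFin ⟨a, ha⟩, Finset.mem_univ _, by simp⟩

/-- A set covered by finitely many orbits is covered by finitely many `Fix G J`-orbits. -/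
theorem exists_finite_reps_of_finite (J : Finset A) {t : Set X} (ht : t.Finite)
    (hsupp : ∀ x ∈ t, ∃ E : Finset A, Supports G E x) :
    ∃ r : Set X, r.Finite ∧ ∀ x ∈ t, ∀ g : G, ∃ y ∈ r, ∃ h ∈ Fix G J, g • x = h • y := by
  choose E hE using hsupp
  choose r hr hcov using fun x : t => tm.exists_finite_reps J (hE x x.2)
  have := ht.to_subtype
  refine ⟨⋃ x : t, r x, Set.finite_iUnion hr, fun x hx g => ?_⟩
  obtain ⟨y, hy, h, hh, he⟩ := hcov ⟨x, hx⟩ g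
  exact ⟨y, Set.mem_iUnion.2 ⟨_, hy⟩, h, hh, he⟩

/-- There are finitely many orbits of sets of at most `D` atoms. -/
theorem finite_orbits_finset (D : ℕ) : ∃ t : Set (Finset A), t.Finite ∧
    ∀ J : Finset A, J.card ≤ D → ∃ K ∈ t, ∃ g : G, J = g • K := by
  choose t ht hcov using fun n => tm.finite_orbits ∅ n
  refine ⟨⋃ n ∈ Finset.range (D + 1), (fun x : Fin n → A => Finset.univ.image x) '' t n,
    Set.Finite.biUnion (Finset.finite_toSet _) fun n _ => (ht n).image _, fun J hJ => ?_⟩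
  obtain ⟨y, hy, g, -, hg⟩ := hcov J.card (fun i => ((J.equivFin.symm i : J) : A))
  refine ⟨Finset.univ.image y, ?_, g, ?_⟩
  · simp only [Set.mem_iUnion]
    exact ⟨J.card, by simpa using Nat.lt_succ_of_le hJ, y, hy, rfl⟩
  · ext a
    have h1 : a ∈ J ↔ ∃ i, ((J.equivFin.symm i : J) : A) = a := by
      constructor
      · exact fun ha => ⟨J.equivFin ⟨a, ha⟩, by simp⟩
      · rintro ⟨i, rfl⟩
        exact Subtype.coe_prop _
    rw [h1]
    simp only [Finset.mem_smul_finset, Finset.mem_image, Finset.mem_univ, true_and,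
      exists_exists_eq_and]
    exact exists_congr fun i => by rw [show ((J.equivFin.symm i : J) : A) = g • y i from congrFun hg i]

end Tame

end Order

end TameAction
namespace TameAction

open scoped Pointwise Classical

/-! ### Tameness from homogeneity. -/

section Homogeneous

variable {H A : Type*} [Group H] [MulAction H A]

/-- Every finite partial automorphism of the order extends to an element of the group. -/
structure Homogeneous (H A : Type*) [Group H] [MulAction H A] [PartialOrder A] : Prop where
  smul_le_smul : ∀ (g : H) (a b : A), g • a ≤ g • b ↔ a ≤ b
  extend : ∀ (E : Finset A) (f : A → A), (∀ a ∈ E, ∀ b ∈ E, f a ≤ f b ↔ a ≤ b) →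
    ∃ g : H, ∀ a ∈ E, g • a = f a

theorem mem_Fix_subgroup {S J : Finset A} {g : Fix H S} :
    g ∈ Fix (Fix H S) J ↔ (g : H) ∈ Fix H (J ∪ S) := by
  have hg := mem_Fix.1 g.2
  simp only [mem_Fix, Finset.mem_union]
  constructor
  · rintro h a (ha | ha)
    · exact h a ha
    · exact hg a ha
  · exact fun h a ha => h a (Or.inl ha)

theorem exists_mem_Fix_subgroup {S J : Finset A} {g : H} (hg : g ∈ Fix H (J ∪ S)) :
    ∃ k : Fix H S, k ∈ Fix (Fix H S) J ∧ (k : H) = g :=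
  ⟨⟨g, Fix_anti Finset.subset_union_right hg⟩, mem_Fix_subgroup.2 hg, rfl⟩

variable [PartialOrder A]

namespace Homogeneous

variable (hom : Homogeneous H A) {S : Finset A}
include hom

/-- By homogeneity the orbit of a tuple is determined by its order relations with itself and with
`J`, and there are finitely many such patterns. -/
theorem finite_orbits (J : Finset A) (n : ℕ) : ∃ t : Set (Fin n → A), t.Finite ∧
    ∀ x, ∃ y ∈ t, ∃ g ∈ Fix H J, x = g • y := by
  let τ : (Fin n → A) → (Fin n → Fin n → Prop) × (Fin n → J → Prop) × (Fin n → J → Prop) :=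
    fun x => (fun i j => x i ≤ x j, fun i j => x i ≤ j, fun i j => (j : A) ≤ x i)
  have key : ∀ x y, τ y = τ x → ∃ g ∈ Fix H J, x = g • y := by
    intro x y h
    have h1 : ∀ i j, y i ≤ y j ↔ x i ≤ x j := fun i j => by
      simpa using congrFun (congrFun (congrArg (fun z => z.1) h) i) j
    have h2 : ∀ i, ∀ j ∈ J, y i ≤ j ↔ x i ≤ j := fun i j hj => by
      simpa using congrFun (congrFun (congrArg (fun z => z.2.1) h) i) ⟨j, hj⟩
    have h3 : ∀ i, ∀ j ∈ J, j ≤ y i ↔ j ≤ x i := fun i j hj => by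
      simpa using congrFun (congrFun (congrArg (fun z => z.2.2) h) i) ⟨j, hj⟩
    let f : A → A := fun a => if ha : ∃ i, y i = a then x ha.choose else a
    have hf1 : ∀ i, f (y i) = x i := fun i => by
      have ha : ∃ j, y j = y i := ⟨i, rfl⟩
      simp only [f, dif_pos ha]
      have := ha.choose_spec
      exact le_antisymm ((h1 _ _).1 this.le) ((h1 _ _).1 this.ge)
    have hf2 : ∀ j ∈ J, f j = j := fun j hj => by
      by_cases ha : ∃ i, y i = j
      · obtain ⟨i, rfl⟩ := ha
        rw [hf1]
        exact le_antisymm ((h2 i _ hj).1 le_rfl) ((h3 i _ hj).1 le_rfl)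
      · simp only [f, dif_neg ha]
    obtain ⟨g, hg⟩ := hom.extend (Finset.univ.image y ∪ J) f (by
      intro a ha b hb
      simp only [Finset.mem_union, Finset.mem_image, Finset.mem_univ, true_and] at ha hb
      rcases ha with ⟨i, rfl⟩ | ha <;> rcases hb with ⟨j, rfl⟩ | hb
      · rw [hf1, hf1, h1]
      · rw [hf1, hf2 b hb, h2 i b hb]
      · rw [hf1, hf2 a ha, h3 j a ha]
      · rw [hf2 a ha, hf2 b hb])
    refine ⟨g, mem_Fix.2 fun a ha => ?_, funext fun i => ?_⟩
    · rw [hg a (Finset.mem_union_right _ ha), hf2 a ha]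
    · rw [Pi.smul_apply, hg _ (Finset.mem_union_left _ (Finset.mem_image_of_mem _ (Finset.mem_univ i))),
        hf1]
  refine ⟨(fun x : Set.range τ => x.2.choose) '' Set.univ, (Set.toFinite _).image _, fun x => ?_⟩
  exact ⟨_, ⟨⟨τ x, x, rfl⟩, trivial, rfl⟩, key _ _ (Exists.choose_spec (⟨x, rfl⟩ : τ x ∈ Set.range τ))⟩

/-- It suffices that `g • e` and `g' • e` have the same order relations with `J ∪ E' ∪ S`. A
relation from below passes through a point of `J ∪ S`, which both elements fix. -/
theorem stationary (hord : (∀ a b : A, a ≤ b → a = b) ∨ ∀ a b : A, a ≤ b ∨ b ≤ a)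
    (J E E' : Finset A) (g g' : H) (hg : g ∈ Fix H (J ∪ S)) (hg' : g' ∈ Fix H (J ∪ S))
    (h : Indep S J (g • E) E') (h' : Indep S J (g' • E) E') :
    ∃ k ∈ Fix H ((J ∪ E') ∪ S), ∀ e ∈ E, k • g • e = g' • e := by
  have key : ∀ g g' : H, g ∈ Fix H (J ∪ S) → g' ∈ Fix H (J ∪ S) → Indep S J (g • E) E' →
      ∀ e ∈ E, ∀ b ∈ (J ∪ E') ∪ S, b ≤ g • e → b ≤ g' • e := by
    intro g g' hg hg' h e he b hb hle
    have : ∃ j ∈ J ∪ S, b ≤ j ∧ j ≤ g • e := by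
      by_cases hbE : b ∈ E'
      · exact h _ (Finset.smul_mem_smul_finset he) b hbE hle
      · refine ⟨b, ?_, le_rfl, hle⟩
        simp only [Finset.mem_union] at hb ⊢
        tauto
    obtain ⟨j, hj, h1, h2⟩ := this
    refine h1.trans ?_
    rw [← mem_Fix.1 hg j hj, hom.smul_le_smul] at h2
    rw [← mem_Fix.1 hg' j hj, hom.smul_le_smul]
    exact h2
  have hlow : ∀ e ∈ E, ∀ b ∈ (J ∪ E') ∪ S, b ≤ g • e ↔ b ≤ g' • e := fun e he b hb =>
    ⟨key g g' hg hg' h e he b hb, key g' g hg' hg h' e he b hb⟩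
  have hback : ∀ g g' : H, g ∈ Fix H (J ∪ S) → g' ∈ Fix H (J ∪ S) → Indep S J (g • E) E' →
      ∀ e ∈ E, ∀ b ∈ (J ∪ E') ∪ S, g • e = b → g' • e = b := by
    rintro g g' hg hg' h e he b hb rfl
    by_cases hbE : g • e ∈ E'
    · obtain ⟨j, hj, h1, h2⟩ := h _ (Finset.smul_mem_smul_finset he) _ hbE le_rfl
      have h3 : g • e = g • j := by rw [mem_Fix.1 hg j hj]; exact le_antisymm h1 h2
      rw [smul_left_cancel g h3, mem_Fix.1 hg j hj, mem_Fix.1 hg' j hj]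
    · have h4 : g • e ∈ J ∪ S := by
        simp only [Finset.mem_union] at hb ⊢
        tauto
      have h3 : g • e = g • g • e := by rw [mem_Fix.1 hg _ h4]
      have h5 := smul_left_cancel g h3
      rw [← h5]
      rw [← h5] at h4
      exact mem_Fix.1 hg' _ h4
  -- Independence controls only points below; relations from above are recovered from equality in
  -- the discrete case and from the lower cuts in the linear case.
  have hupp' : ∀ g g' : H, g ∈ Fix H (J ∪ S) → g' ∈ Fix H (J ∪ S) → Indep S J (g • E) E' →
      (∀ e ∈ E, ∀ b ∈ (J ∪ E') ∪ S, b ≤ g • e ↔ b ≤ g' • e) →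
      ∀ e ∈ E, ∀ b ∈ (J ∪ E') ∪ S, g • e ≤ b → g' • e ≤ b := by
    intro g g' hg hg' h hlow e he b hb hle
    rcases hord with hd | hl
    · exact (hback g g' hg hg' h e he b hb (hd _ _ hle)).le
    · rcases hl (g' • e) b with h1 | h1
      · exact h1
      · exact (hback g g' hg hg' h e he b hb (le_antisymm hle ((hlow e he b hb).2 h1))).le
  have hupp : ∀ e ∈ E, ∀ b ∈ (J ∪ E') ∪ S, g • e ≤ b ↔ g' • e ≤ b := fun e he b hb =>
    ⟨hupp' g g' hg hg' h hlow e he b hb,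
      hupp' g' g hg' hg h' (fun e he b hb => (hlow e he b hb).symm) e he b hb⟩
  let f : A → A := fun a => if a ∈ g • E then g' • g⁻¹ • a else a
  have hf1 : ∀ e ∈ E, f (g • e) = g' • e := fun e he => by
    simp only [f, if_pos (Finset.smul_mem_smul_finset he), inv_smul_smul]
  have hf2 : ∀ b ∈ (J ∪ E') ∪ S, f b = b := fun b hb => by
    by_cases hbE : b ∈ g • E
    · obtain ⟨e, he, rfl⟩ := Finset.mem_smul_finset.1 hbE
      rw [hf1 e he]
      exact le_antisymm ((hupp e he _ hb).1 le_rfl) ((hlow e he _ hb).1 le_rfl)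
    · simp only [f, if_neg hbE]
  obtain ⟨k, hk⟩ := hom.extend (g • E ∪ ((J ∪ E') ∪ S)) f (by
    intro a ha b hb
    rcases Finset.mem_union.1 ha with ha | ha <;> rcases Finset.mem_union.1 hb with hb | hb
    · obtain ⟨e, he, rfl⟩ := Finset.mem_smul_finset.1 ha
      obtain ⟨e', he', rfl⟩ := Finset.mem_smul_finset.1 hb
      rw [hf1 e he, hf1 e' he', hom.smul_le_smul, hom.smul_le_smul]
    · obtain ⟨e, he, rfl⟩ := Finset.mem_smul_finset.1 ha
      rw [hf1 e he, hf2 b hb, hupp e he b hb]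
    · obtain ⟨e, he, rfl⟩ := Finset.mem_smul_finset.1 hb
      rw [hf1 e he, hf2 a ha, hlow e he a ha]
    · rw [hf2 a ha, hf2 b hb])
  refine ⟨k, mem_Fix.2 fun a ha => ?_, fun e he => ?_⟩
  · rw [hk a (Finset.mem_union_right _ ha), hf2 a ha]
  · rw [hk _ (Finset.mem_union_left _ (Finset.smul_mem_smul_finset he)), hf1 e he]

/-- Tameness of the stabilizer of `S`, from the existence of generic translates and the existence of
reductions. -/
theorem tame (hord : (∀ a b : A, a ≤ b → a = b) ∨ ∀ a b : A, a ≤ b ∨ b ≤ a)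
    (hindep : ∀ J E E' : Finset A, ∃ f : A → A, (∀ a b, f a ≤ f b ↔ a ≤ b) ∧
      (∀ j ∈ J, f j = j) ∧ ∀ e ∈ E, ∀ e' ∈ E', e' ≤ f e → ∃ j ∈ J, e' ≤ j ∧ j ≤ f e)
    (O : Finset A → Finset A) (hO : ∀ g ∈ Fix H S, ∀ T, O (g • T) = g • O T)
    (hOT : ∀ T, O T ⊆ T)
    (hcard : ∀ k, ∃ D, ∀ T : Finset A, D < T.card → k < (O T).card)
    (hred : ∀ T E E', Indep S T E E' → ∃ f : Finset A → A → A,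
      (∀ R ⊆ O T, (∀ a ∈ E ∪ (T ∪ S), ∀ b ∈ E ∪ (T ∪ S), f R a ≤ f R b ↔ a ≤ b) ∧ (∀ a ∈ (T \ R) ∪ S, f R a = a) ∧
        Indep S (T \ R) (E.image (f R)) E') ∧
      ∀ y ⊆ E, y.card < (O T).card → ∃ t ∈ O T, ∀ R ⊆ (O T).erase t, ∀ x ∈ y,
        f (insert t R) x = f R x) : Tame (Fix H S) S where
  smul_le_smul g a b := hom.smul_le_smul g a b
  smul_const g s hs := mem_Fix.1 g.2 s hs
  finite_orbits J n := by
    obtain ⟨t, ht, hcov⟩ := hom.finite_orbits (J ∪ S) n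
    refine ⟨t, ht, fun x => ?_⟩
    obtain ⟨y, hy, g, hg, he⟩ := hcov x
    obtain ⟨k, hk, rfl⟩ := exists_mem_Fix_subgroup hg
    exact ⟨y, hy, k, hk, he⟩
  exists_indep J E E' := by
    obtain ⟨f, hf, hfJ, hfE⟩ := hindep (J ∪ S) E E'
    obtain ⟨g, hg⟩ := hom.extend (E ∪ (J ∪ S)) f fun a _ b _ => hf a b
    have hgJ : g ∈ Fix H (J ∪ S) := mem_Fix.2 fun a ha => by
      rw [hg a (Finset.mem_union_right _ ha), hfJ a ha]
    obtain ⟨k, hk, rfl⟩ := exists_mem_Fix_subgroup hgJ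
    refine ⟨k, hk, fun e he e' he' hle => ?_⟩
    obtain ⟨a, ha, rfl⟩ := Finset.mem_smul_finset.1 he
    have : k • a = f a := hg a (Finset.mem_union_left _ ha)
    rw [this] at hle ⊢
    exact hfE a ha e' he' hle
  stationary J E E' g g' hg hg' h h' := by
    obtain ⟨k, hk, hke⟩ := hom.stationary hord J E E' g g' (mem_Fix_subgroup.1 hg)
      (mem_Fix_subgroup.1 hg') h h'
    obtain ⟨l, hl, rfl⟩ := exists_mem_Fix_subgroup hk
    exact ⟨l, hl, hke⟩
  reduce := by
    refine ⟨O, fun g T => hO g g.2 T, hOT, hcard, fun T E E' hind => ?_⟩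
    obtain ⟨f, hf, hfy⟩ := hred T E E' hind
    have : ∀ R, ∃ g : Fix H S, R ⊆ O T →
        g ∈ Fix (Fix H S) (T \ R) ∧ ∀ a ∈ E, g • a = f R a := by
      intro R
      by_cases hR : R ⊆ O T
      · obtain ⟨h1, h2, -⟩ := hf R hR
        have hsub : E ∪ ((T \ R) ∪ S) ⊆ E ∪ (T ∪ S) := Finset.union_subset_union_right
          (Finset.union_subset_union_left Finset.sdiff_subset)
        obtain ⟨g, hg⟩ := hom.extend (E ∪ ((T \ R) ∪ S)) (f R) fun a ha b hb =>
          h1 a (hsub ha) b (hsub hb)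
        have hgJ : g ∈ Fix H ((T \ R) ∪ S) := mem_Fix.2 fun a ha => by
          rw [hg a (Finset.mem_union_right _ ha), h2 a ha]
        obtain ⟨k, hk, rfl⟩ := exists_mem_Fix_subgroup hgJ
        exact ⟨k, fun _ => ⟨hk, fun a ha => hg a (Finset.mem_union_left _ ha)⟩⟩
      · exact ⟨1, fun h => absurd h hR⟩
    choose π hπ using this
    refine ⟨π, fun R hR => ⟨(hπ R hR).1, ?_⟩, fun y hy hcard => ?_⟩
    · have : π R • E = E.image (f R) := by
        ext a
        simp only [Finset.mem_smul_finset, Finset.mem_image]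
        exact exists_congr fun b => and_congr_right fun hb => by rw [(hπ R hR).2 b hb]
      rw [this]
      exact (hf R hR).2.2
    · obtain ⟨t, ht, h⟩ := hfy y hy hcard
      refine ⟨t, ht, fun R hR x hx => ?_⟩
      have hR' : R ⊆ O T := hR.trans (Finset.erase_subset _ _)
      rw [(hπ R hR').2 x (hy hx), (hπ _ (Finset.insert_subset ht hR')).2 x (hy hx), h R hR x hx]

end Homogeneous

end Homogeneous

end TameAction
namespace TameAction

open scoped Pointwise Classical

/-! ### The equality atoms. -/

section Equality

variable {A : Type*}

/-- Inside the finite set `E ∪ f(E)` the complements of `E` and `f(E)` have equal size, so the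
injection extends there; elsewhere the permutation is the identity. -/
theorem exists_perm_extending (E : Finset A) (f : A → A) (hf : Set.InjOn f E) :
    ∃ σ : Equiv.Perm A, ∀ a ∈ E, σ a = f a := by
  let U : Finset A := E ∪ E.image f
  have hU : (U.filter (· ∈ E)).card = (U.filter (· ∈ E.image f)).card := by
    have h1 : U.filter (· ∈ E) = E := by ext a; simp [U]
    have h2 : U.filter (· ∈ E.image f) = E.image f := by
      ext a; simp only [U, Finset.mem_filter, Finset.mem_union]; tauto
    rw [h1, h2, Finset.card_image_of_injOn hf]
  let e : { x : U // (x : A) ∈ E } ≃ { x : U // (x : A) ∈ E.image f } :=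
    Equiv.ofBijective (fun x => ⟨⟨f x, Finset.mem_union_right _ (Finset.mem_image_of_mem f x.2)⟩,
      Finset.mem_image_of_mem f x.2⟩) (by
      constructor
      · intro x y h
        have : f x = f y := congrArg (fun z : { x : U // (x : A) ∈ E.image f } => ((z : U) : A)) h
        exact Subtype.ext (Subtype.ext (hf x.2 y.2 this))
      · rintro ⟨⟨y, hyU⟩, hy⟩
        obtain ⟨x, hx, rfl⟩ := Finset.mem_image.1 hy
        exact ⟨⟨⟨x, Finset.mem_union_left _ hx⟩, hx⟩, rfl⟩)
  refine ⟨Equiv.Perm.ofSubtype e.extendSubtype, fun a ha => ?_⟩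
  have haU : a ∈ U := Finset.mem_union_left _ ha
  rw [Equiv.Perm.ofSubtype_apply_of_mem _ haU]
  exact congrArg Subtype.val (e.extendSubtype_apply_of_mem ⟨a, haU⟩ ha)

/-- A permutation that is the identity on `J` and moves the other elements of `E` outside `W`. -/
theorem exists_perm_avoiding [Infinite A] (J E W : Finset A) :
    ∃ σ : Equiv.Perm A, (∀ j ∈ J, σ j = j) ∧ ∀ e ∈ E, e ∉ J → σ e ∉ W := by
  have hinf : ((W ∪ J : Finset A) : Set A)ᶜ.Infinite := (Finset.finite_toSet _).infinite_compl
  obtain ⟨t, ht, hcard⟩ := hinf.exists_subset_card_eq (E \ J).card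
  let e : (E \ J : Finset A) ≃ t := Finset.equivOfCardEq hcard.symm
  let f : A → A := fun a => if ha : a ∈ E \ J then e ⟨a, ha⟩ else a
  have hfe : ∀ a ∈ E \ J, f a ∉ W ∪ J := fun a ha => by
    simp only [f, dif_pos ha]
    exact ht (e ⟨a, ha⟩).2
  have hfJ : ∀ a ∈ J, f a = a := fun a ha => by
    have : a ∉ E \ J := by simp [ha]
    simp only [f, dif_neg this]
  obtain ⟨σ, hσ⟩ := exists_perm_extending (E ∪ J) f (by
    have hcases : ∀ a ∈ E ∪ J, a ∈ J ∨ a ∈ E \ J := fun a ha => by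
      simp only [Finset.mem_union, Finset.mem_sdiff] at *; tauto
    intro a ha b hb hab
    rcases hcases a ha with h1 | h1 <;> rcases hcases b hb with h2 | h2
    · rwa [hfJ a h1, hfJ b h2] at hab
    · rw [hfJ a h1] at hab
      exact absurd (Finset.mem_union_right _ (hab ▸ h1)) (hfe b h2)
    · rw [hfJ b h2] at hab
      exact absurd (Finset.mem_union_right _ (hab ▸ h2)) (hfe a h1)
    · simp only [f, dif_pos h1, dif_pos h2] at hab
      exact congrArg Subtype.val (e.injective (Subtype.ext hab)))
  refine ⟨σ, fun j hj => ?_, fun a ha haJ haW => ?_⟩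
  · rw [hσ j (Finset.mem_union_right _ hj), hfJ j hj]
  · rw [hσ a (Finset.mem_union_left _ ha)] at haW
    exact hfe a (Finset.mem_sdiff.2 ⟨ha, haJ⟩) (Finset.mem_union_left _ haW)

theorem tame_of_eq [PartialOrder A] [Infinite A] {r : A → A → Prop} (hr : ∀ a b, r a b ↔ a = b)
    (hle : ∀ a b : A, a ≤ b → a = b) (S : Finset A) : Tame (Fix (r ≃r r) S) S := by
  have hle' : ∀ a b : A, a ≤ b ↔ a = b := fun a b => ⟨hle a b, le_of_eq⟩
  have hom : Homogeneous (r ≃r r) A :=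
    { smul_le_smul := fun g a b => by
        rw [hle', hle']
        exact (MulAction.injective g).eq_iff
      extend := fun E f hf => by
        obtain ⟨σ, hσ⟩ := exists_perm_extending E f fun a ha b hb hab => by
          rw [← hle', ← hf a ha b hb, hab]
        exact ⟨⟨σ, fun {a b} => by rw [hr, hr]; exact σ.injective.eq_iff⟩, hσ⟩ }
  refine hom.tame (Or.inl hle) (fun J E E' => ?_) (fun T => T \ S) ?_ (fun T => Finset.sdiff_subset)
    (fun k => ⟨k + S.card, fun T hT => ?_⟩) ?_
  · obtain ⟨σ, hσJ, hσ⟩ := exists_perm_avoiding J E E'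
    refine ⟨σ, fun a b => by rw [hle', hle', σ.injective.eq_iff], hσJ, fun e he e' he' h => ?_⟩
    obtain rfl := hle _ _ h
    by_cases heJ : e ∈ J
    · exact ⟨e, heJ, by rw [hσJ e heJ], by rw [hσJ e heJ]⟩
    · exact absurd he' (hσ e he heJ)
  · intro g hg T
    rw [Finset.smul_finset_sdiff, smul_eq_self_of_mem_Fix hg]
  · have := Finset.le_card_sdiff S T
    omega
  · intro T E E' hind
    -- A removed atom may no longer be shared by `E` and `E'`, so `f R` replaces exactly the atoms
    -- of `R` by fresh ones.
    obtain ⟨σ, -, hσ⟩ := exists_perm_avoiding ∅ T (E ∪ E' ∪ T ∪ S)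
    let f : Finset A → A → A := fun R a => if a ∈ R then σ a else a
    have hf1 : ∀ R, ∀ a ∈ R, f R a = σ a := fun R a ha => if_pos ha
    have hf2 : ∀ R, ∀ a ∉ R, f R a = a := fun R a ha => if_neg ha
    have hnot : ∀ R ⊆ T \ S, ∀ a ∈ R, σ a ∉ E ∪ E' ∪ T ∪ S := fun R hR a ha =>
      hσ a (Finset.mem_sdiff.1 (hR ha)).1 (Finset.notMem_empty a)
    refine ⟨f, fun R hR => ⟨fun a ha b hb => ?_, fun a ha => hf2 R a fun haR => ?_, ?_⟩,
      fun y hy hcard => ?_⟩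
    · rw [hle', hle']
      by_cases haR : a ∈ R <;> by_cases hbR : b ∈ R
      · rw [hf1 R a haR, hf1 R b hbR, σ.injective.eq_iff]
      · rw [hf1 R a haR, hf2 R b hbR]
        have := hnot R hR a haR
        refine ⟨fun h => absurd ?_ this, fun h => absurd (h ▸ haR) hbR⟩
        rw [h]
        simp only [Finset.mem_union] at hb ⊢
        tauto
      · rw [hf1 R b hbR, hf2 R a haR]
        have := hnot R hR b hbR
        refine ⟨fun h => absurd ?_ this, fun h => absurd (h ▸ hbR) haR⟩
        rw [← h]
        simp only [Finset.mem_union] at ha ⊢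
        tauto
      · rw [hf2 R a haR, hf2 R b hbR]
    · have := hR haR
      simp only [Finset.mem_union, Finset.mem_sdiff] at ha this
      tauto
    · intro x hx e' he' h
      obtain ⟨e, he, rfl⟩ := Finset.mem_image.1 hx
      obtain rfl := hle _ _ h
      by_cases heR : e ∈ R
      · rw [hf1 R e heR] at he'
        refine absurd ?_ (hnot R hR e heR)
        simp only [Finset.mem_union]
        tauto
      · rw [hf2 R e heR] at he' ⊢
        obtain ⟨j, hj, h1, h2⟩ := hind e he e he' le_rfl
        obtain rfl := hle _ _ h1
        refine ⟨e, ?_, le_rfl, le_rfl⟩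
        simp only [Finset.mem_union, Finset.mem_sdiff] at hj ⊢
        tauto
    -- Replacing an atom `t` outside `y` does not affect `y`.
    · obtain ⟨t, ht, hty⟩ := Finset.exists_mem_notMem_of_card_lt_card hcard
      refine ⟨t, ht, fun R hR x hx => ?_⟩
      have hxt : x ≠ t := fun h => hty (h ▸ hx)
      simp only [f, Finset.mem_insert, hxt, false_or]

end Equality

end TameAction
namespace TameAction

open scoped Pointwise Classical

/-! ### The ordered atoms. -/

section Dense

attribute [-instance] LinearOrder.toDecidableEq

variable {A : Type*} [LinearOrder A] [Countable A] [DenselyOrdered A] [NoMinOrder A] [NoMaxOrder A]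
  [Nonempty A]

open Order Order.PartialIso in
-- Cantor's back-and-forth, with the given finite partial isomorphism as initial condition.
theorem exists_orderIso_extending (E : Finset A) (f : A → A)
    (hf : ∀ a ∈ E, ∀ b ∈ E, f a ≤ f b ↔ a ≤ b) : ∃ σ : A ≃o A, ∀ a ∈ E, σ a = f a := by
  cases nonempty_encodable A
  let p : PartialIso A A := ⟨E.image fun a => (a, f a), by
    intro x hx y hy
    obtain ⟨a, ha, rfl⟩ := Finset.mem_image.1 hx
    obtain ⟨b, hb, rfl⟩ := Finset.mem_image.1 hy
    have h1 := hf a ha b hb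
    have h2 := hf b hb a ha
    rcases lt_trichotomy a b with h | h | h
    · rw [(cmp_eq_lt_iff _ _).2 h, Eq.comm, cmp_eq_lt_iff, ← not_le, h2]
      exact not_le.2 h
    · subst h
      simp
    · rw [(cmp_eq_gt_iff _ _).2 h, Eq.comm, cmp_eq_gt_iff, ← not_le, h1]
      exact not_le.2 h⟩
  let to_cofinal : A ⊕ A → Cofinal (PartialIso A A) := fun p =>
    Sum.recOn p (definedAtLeft A) (definedAtRight A)
  let I : Ideal (PartialIso A A) := idealOfCofinals p to_cofinal
  let F a := funOfIdeal a I (cofinal_meets_idealOfCofinals _ to_cofinal (Sum.inl a))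
  let K b := invOfIdeal b I (cofinal_meets_idealOfCofinals _ to_cofinal (Sum.inr b))
  refine ⟨OrderIso.ofCmpEqCmp (fun a => (F a).val) (fun b => (K b).val) fun a b => ?_,
    fun a ha => ?_⟩
  · rcases (F a).prop with ⟨f, hf, ha⟩
    rcases (K b).prop with ⟨g, hg, hb⟩
    rcases I.directed _ hf _ hg with ⟨m, _, fm, gm⟩
    exact m.prop (a, _) (fm ha) (_, b) (gm hb)
  · rcases (F a).prop with ⟨f', hf', ha'⟩
    rcases I.directed _ hf' _ (mem_idealOfCofinals p to_cofinal) with ⟨m, _, fm, gm⟩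
    have := m.prop (a, _) (fm ha') (a, f a) (gm (Finset.mem_image_of_mem _ ha))
    rw [cmp_self_eq_eq, Eq.comm, cmp_eq_eq_iff] at this
    exact this

/-- Monotone maps squeezing the whole order just above a given point (or to the far left), without
reaching the next element of `C`. -/
theorem exists_squeeze (C : Finset A) (p : WithBot A) : ∃ φ : A → A, StrictMono φ ∧
    ∀ x, p < φ x ∧ ∀ c ∈ C, p < c → φ x < c := by
  obtain ⟨u, hu1, hu2⟩ : ∃ u : A, p < u ∧ ∀ c ∈ C, p < c → u ≤ c := by
    by_cases hne : (C.filter fun c : A => p < (c : WithBot A)).Nonempty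
    · exact ⟨_, (Finset.mem_filter.1 (Finset.min'_mem _ hne)).2, fun c hc hpc =>
        Finset.min'_le _ _ (Finset.mem_filter.2 ⟨hc, hpc⟩)⟩
    · obtain ⟨u, hu⟩ : ∃ u : A, p < u := by
        induction p with
        | bot => exact ⟨Classical.arbitrary A, WithBot.bot_lt_coe _⟩
        | coe a =>
          obtain ⟨b, hb⟩ := exists_gt a
          exact ⟨b, WithBot.coe_lt_coe.2 hb⟩
      exact ⟨u, hu, fun c hc hpc => absurd ⟨c, Finset.mem_filter.2 ⟨hc, hpc⟩⟩ hne⟩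
  obtain ⟨q, hq1, hqu⟩ : ∃ q : A, p ≤ q ∧ q < u := by
    induction p with
    | bot =>
      obtain ⟨b, hb⟩ := exists_lt u
      exact ⟨b, bot_le, hb⟩
    | coe a => exact ⟨a, le_rfl, WithBot.coe_lt_coe.1 hu1⟩
  have : Nontrivial (Set.Ioo q u) := by
    obtain ⟨b, hb1, hb2⟩ := exists_between hqu
    obtain ⟨c, hc1, hc2⟩ := exists_between hb1
    exact ⟨⟨b, hb1, hb2⟩, ⟨c, hc1, hc2.trans hb2⟩, fun h => hc2.ne' (congrArg Subtype.val h)⟩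
  obtain ⟨ψ⟩ := Order.embedding_from_countable_to_dense A (Set.Ioo q u)
  refine ⟨fun x => ψ x, fun x y h => ψ.strictMono h, fun x => ⟨hq1.trans_lt ?_, fun c hc hpc => ?_⟩⟩
  · exact WithBot.coe_lt_coe.2 (ψ x).2.1
  · exact (ψ x).2.2.trans_le (hu2 c hc hpc)

/-- The elements of `T`, not in `S`, of odd rank in `T ∪ S`. -/
noncomputable def oddPart {A : Type*} [LinearOrder A] (S T : Finset A) : Finset A :=
  T.filter fun t => t ∉ S ∧ Odd ((T ∪ S).filter (· < t)).card

omit [Countable A] [DenselyOrdered A] [NoMinOrder A] [NoMaxOrder A] [Nonempty A] in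
-- Neighbours in `T ∪ S` have ranks of opposite parity. This keeps the intervals created by removing
-- odd-rank points disjoint.
theorem exists_between_oddPart {S T : Finset A} {s t : A} (hs : s ∈ oddPart S T)
    (ht : t ∈ oddPart S T) (hst : s < t) : ∃ c ∈ T ∪ S, s < c ∧ c < t := by
  by_contra! hcon
  obtain ⟨hsT, hsS, hso⟩ := Finset.mem_filter.1 hs
  obtain ⟨htT, htS, hto⟩ := Finset.mem_filter.1 ht
  have : (T ∪ S).filter (· < t) = insert s ((T ∪ S).filter (· < s)) := by
    ext a
    simp only [Finset.mem_filter, Finset.mem_insert]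
    constructor
    · rintro ⟨h1, h2⟩
      rcases lt_trichotomy a s with h | h | h
      · exact Or.inr ⟨h1, h⟩
      · exact Or.inl h
      · exact absurd h2 (not_lt.2 (hcon a h1 h))
    · rintro (rfl | ⟨h1, h2⟩)
      · exact ⟨Finset.mem_union_left _ hsT, hst⟩
      · exact ⟨h1, h2.trans hst⟩
  rw [this, Finset.card_insert_of_notMem (by simp)] at hto
  exact (Nat.not_odd_iff_even.2 (hso.add_odd odd_one)) hto

omit [Countable A] [DenselyOrdered A] [NoMinOrder A] [NoMaxOrder A] [Nonempty A] in
theorem card_filter_odd_rank (U : Finset A) :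
    (U.filter fun t => Odd (U.filter (· < t)).card).card = U.card / 2 := by
  induction U using Finset.induction_on_max with
  | empty => simp
  | insert m U hm ih =>
    have hmU : m ∉ U := fun h => lt_irrefl _ (hm m h)
    have h1 : (insert m U).filter (· < m) = U := by
      ext a
      simp only [Finset.mem_filter, Finset.mem_insert]
      constructor
      · rintro ⟨rfl | h, h2⟩
        · exact absurd h2 (lt_irrefl _)
        · exact h
      · exact fun h => ⟨Or.inr h, hm a h⟩
    have h2 : ∀ t ∈ U, (insert m U).filter (· < t) = U.filter (· < t) := fun t ht => by
      rw [Finset.filter_insert, if_neg (not_lt.2 (hm t ht).le)]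
    rw [Finset.filter_insert, h1, Finset.filter_congr fun t ht => by rw [h2 t ht],
      Finset.card_insert_of_notMem hmU]
    split_ifs with hodd
    · rw [Finset.card_insert_of_notMem (by simp [hmU]), ih]
      obtain ⟨k, hk⟩ := hodd
      omega
    · rw [ih]
      obtain ⟨k, hk⟩ := Nat.not_odd_iff_even.1 hodd
      omega

omit [Countable A] [DenselyOrdered A] [NoMinOrder A] [NoMaxOrder A] [Nonempty A] in
theorem le_card_oddPart (S T : Finset A) : T.card / 2 ≤ (oddPart S T).card + S.card := by
  have h1 : ((T ∪ S).filter fun t => Odd ((T ∪ S).filter (· < t)).card) ⊆ oddPart S T ∪ S := by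
    intro t ht
    simp only [oddPart, Finset.mem_filter, Finset.mem_union] at ht ⊢
    tauto
  have h2 := (Finset.card_le_card h1).trans (Finset.card_union_le _ _)
  rw [card_filter_odd_rank] at h2
  have h3 : T.card ≤ (T ∪ S).card := Finset.card_le_card Finset.subset_union_left
  omega

/-- Both generic moves and reductions come from squeezing an interval into an initial part of itself
lying to the left of all points to be avoided. -/
theorem tame_of_lt {r : A → A → Prop} (hr : ∀ a b, r a b ↔ a < b) (S : Finset A) :
    Tame (Fix (r ≃r r) S) S := by
  have hlt : ∀ (g : r ≃r r) (a b : A), g • a < g • b ↔ a < b := fun g a b => by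
    rw [← hr, ← hr]
    exact g.map_rel_iff
  have hle : ∀ (g : r ≃r r) (a b : A), g • a ≤ g • b ↔ a ≤ b := fun g a b => by
    rw [← not_lt, ← not_lt, hlt]
  have hom : Homogeneous (r ≃r r) A :=
    { smul_le_smul := hle
      extend := fun E f hf => by
        obtain ⟨σ, hσ⟩ := exists_orderIso_extending E f hf
        exact ⟨⟨σ.toEquiv, fun {a b} => by rw [hr, hr]; exact σ.lt_iff_lt⟩, hσ⟩ }
  choose φ hφmono hφ using fun C : Finset A => exists_squeeze C
  refine hom.tame (Or.inr le_total) (fun J E E' => ?_) (oddPart S) ?_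
    (fun T => Finset.filter_subset _ _) (fun k => ⟨2 * (k + S.card + 1), fun T hT => ?_⟩) ?_
  -- The left endpoint of the cell of `x`, with `⊥` for the leftmost cell; each cell is squeezed
  -- just above it.
  · let p : A → WithBot A := fun x => (J.filter (· < x)).max
    have hp : ∀ x, p x < x := fun x => by
      cases h : p x with
      | bot => exact WithBot.bot_lt_coe x
      | coe c => exact WithBot.coe_lt_coe.2 (Finset.mem_filter.1 (Finset.mem_of_max h)).2
    have hp' : ∀ x, ∀ j ∈ J, j < x → (j : WithBot A) ≤ p x := fun x j hj hjx =>
      Finset.le_max (Finset.mem_filter.2 ⟨hj, hjx⟩)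
    have hpJ : ∀ x (a : A), p x = a → a ∈ J := fun x a h =>
      (Finset.mem_filter.1 (Finset.mem_of_max h)).1
    let f : A → A := fun x => if x ∈ J then x else φ (J ∪ E') (p x) x
    have hf1 : ∀ x ∈ J, f x = x := fun x hx => if_pos hx
    have hf2 : ∀ x ∉ J, p x < f x ∧ ∀ c ∈ J ∪ E', p x < c → f x < c := fun x hx => by
      simp only [f, if_neg hx]
      exact hφ (J ∪ E') (p x) x
    have hmono : StrictMono f := by
      intro x y hxy
      by_cases hx : x ∈ J <;> by_cases hy : y ∈ J
      · rwa [hf1 x hx, hf1 y hy]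
      · rw [hf1 x hx]
        exact WithBot.coe_lt_coe.1 ((hp' y x hx hxy).trans_lt (hf2 y hy).1)
      · rw [hf1 y hy]
        exact (hf2 x hx).2 y (Finset.mem_union_left _ hy)
          ((hp x).trans (WithBot.coe_lt_coe.2 hxy))
      · have hle : p x ≤ p y := Finset.max_mono fun a ha => by
          simp only [Finset.mem_filter] at ha ⊢
          exact ⟨ha.1, ha.2.trans hxy⟩
        rcases hle.eq_or_lt with h | h
        · simp only [f, if_neg hx, if_neg hy, h]
          exact hφmono _ _ hxy
        · have hlt := (hf2 y hy).1
          obtain ⟨c, hc⟩ : ∃ c : A, p y = c := by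
            cases hpy : p y with
            | bot => rw [hpy] at h; exact absurd h not_lt_bot
            | coe c => exact ⟨c, rfl⟩
          rw [hc] at h hlt
          exact ((hf2 x hx).2 c (Finset.mem_union_left _ (hpJ y c hc)) h).trans
            (WithBot.coe_lt_coe.1 hlt)
    refine ⟨f, fun a b => hmono.le_iff_le, hf1, fun e _ e' he' h => ?_⟩
    by_cases heJ : e ∈ J
    · exact ⟨e, heJ, by rwa [hf1 e heJ] at h, by rw [hf1 e heJ]⟩
    · have h1 : ¬ p e < e' := fun h2 =>
        absurd h (not_le.2 ((hf2 e heJ).2 e' (Finset.mem_union_right _ he') h2))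
      rw [not_lt] at h1
      have hlt := (hf2 e heJ).1
      obtain ⟨c, hc⟩ : ∃ c : A, p e = c := by
        cases hpy : p e with
        | bot => rw [hpy] at h1; exact absurd h1 (not_le.2 (WithBot.bot_lt_coe _))
        | coe c => exact ⟨c, rfl⟩
      rw [hc] at h1 hlt
      exact ⟨c, hpJ e c hc, WithBot.coe_le_coe.1 h1, (WithBot.coe_lt_coe.1 hlt).le⟩
  · intro g hg T
    ext t
    rw [Finset.mem_smul_finset]
    have hgS := smul_eq_self_of_mem_Fix hg
    have hcard : ∀ a : A, ((g • T ∪ S).filter (· < g • a)).card =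
        ((T ∪ S).filter (· < a)).card := fun a => by
      have h1 : g • T ∪ S = g • (T ∪ S) := by rw [Finset.smul_finset_union, hgS]
      have h2 : (g • T ∪ S).filter (· < g • a) = g • (T ∪ S).filter (· < a) := by
        ext b
        rw [h1]
        simp only [Finset.mem_filter, Finset.mem_smul_finset]
        constructor
        · rintro ⟨⟨c, hc, rfl⟩, h⟩
          exact ⟨c, ⟨hc, (hlt g _ _).1 h⟩, rfl⟩
        · rintro ⟨c, ⟨hc, h⟩, rfl⟩
          exact ⟨⟨c, hc, rfl⟩, (hlt g _ _).2 h⟩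
      rw [h2, Finset.card_smul_finset]
    have hS : ∀ a : A, g • a ∈ S ↔ a ∈ S := fun a => by
      nth_rewrite 1 [← hgS]
      exact Finset.smul_mem_smul_finset_iff g
    constructor
    · intro ht
      obtain ⟨h1, h2, h3⟩ := Finset.mem_filter.1 ht
      obtain ⟨a, ha, rfl⟩ := Finset.mem_smul_finset.1 h1
      rw [hS] at h2
      rw [hcard] at h3
      exact ⟨a, Finset.mem_filter.2 ⟨ha, h2, h3⟩, rfl⟩
    · rintro ⟨a, ha, rfl⟩
      obtain ⟨h1, h2, h3⟩ := Finset.mem_filter.1 ha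
      refine Finset.mem_filter.2 ⟨Finset.smul_mem_smul_finset h1, ?_, ?_⟩
      · rwa [hS]
      · rwa [hcard]
  -- About half of the ranks are odd, and at most `S.card` of these points are lost to the
  -- constants.
  · have := le_card_oddPart S T
    omega
  · intro T E E' hind
    let p : A → WithBot A := fun x => ((T ∪ S).filter (· < x)).max
    have hp : ∀ x, p x < x := fun x => by
      cases h : p x with
      | bot => exact WithBot.bot_lt_coe x
      | coe c => exact WithBot.coe_lt_coe.2 (Finset.mem_filter.1 (Finset.mem_of_max h)).2
    have hp' : ∀ x, ∀ j ∈ T ∪ S, j < x → (j : WithBot A) ≤ p x := fun x j hj hjx =>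
      Finset.le_max (Finset.mem_filter.2 ⟨hj, hjx⟩)
    have hpT : ∀ x (a : A), p x = a → a ∈ T ∪ S ∧ a < x := fun x a h =>
      Finset.mem_filter.1 (Finset.mem_of_max h)
    -- The cell formed when `t` is removed: it joins the two cells adjacent to `t`, and contains
    -- `t`. Blocks of different odd-rank points are disjoint.
    let block : A → A → Prop := fun t x => p t < x ∧ ∀ c ∈ T ∪ S, t < c → x < c
    have hsep : ∀ s ∈ oddPart S T, ∀ t ∈ oddPart S T, s < t → ∀ x, block s x → (x : WithBot A) < p t := by
      intro s hs t ht hst x hx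
      obtain ⟨c, hc, h1, h2⟩ := exists_between_oddPart hs ht hst
      exact (WithBot.coe_lt_coe.2 (hx.2 c hc h1)).trans_le (hp' t c hc h2)
    have huniq : ∀ s ∈ oddPart S T, ∀ t ∈ oddPart S T, ∀ x, block s x → block t x → s = t := by
      intro s hs t ht x hsx htx
      rcases lt_trichotomy s t with h | h | h
      · exact absurd ((hsep s hs t ht h x hsx).trans htx.1) (lt_irrefl _)
      · exact h
      · exact absurd ((hsep t ht s hs h x htx).trans hsx.1) (lt_irrefl _)
    -- Points in a merged cell are pushed to its left end, below every point of `E'` there; all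
    -- others stay fixed.
    let f : Finset A → A → A := fun R x =>
      if h : ∃ t ∈ R, block t x then φ (E' ∪ (T ∪ S)) (p h.choose) x else x
    have hf1 : ∀ R ⊆ oddPart S T, ∀ t ∈ R, ∀ x, block t x →
        f R x = φ (E' ∪ (T ∪ S)) (p t) x := by
      intro R hR t ht x hx
      have h : ∃ t ∈ R, block t x := ⟨t, ht, hx⟩
      simp only [f, dif_pos h]
      rw [huniq _ (hR h.choose_spec.1) t (hR ht) x h.choose_spec.2 hx]
    have hf2 : ∀ R x, (¬ ∃ t ∈ R, block t x) → f R x = x := fun R x h => dif_neg h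
    have hf3 : ∀ R ⊆ oddPart S T, ∀ t ∈ R, ∀ x, block t x →
        p t < f R x ∧ ∀ c ∈ E' ∪ (T ∪ S), p t < c → f R x < c := by
      intro R hR t ht x hx
      rw [hf1 R hR t ht x hx]
      exact hφ _ _ x
    have hblock : ∀ R ⊆ oddPart S T, ∀ t ∈ R, ∀ x, block t x → block t (f R x) := by
      intro R hR t ht x hx
      obtain ⟨h1, h2⟩ := hf3 R hR t ht x hx
      exact ⟨h1, fun c hc htc => h2 c (Finset.mem_union_right _ hc)
        ((hp t).trans (WithBot.coe_lt_coe.2 htc))⟩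
    have hmono : ∀ R ⊆ oddPart S T, StrictMono (f R) := by
      intro R hR x y hxy
      by_cases hx : ∃ t ∈ R, block t x <;> by_cases hy : ∃ t ∈ R, block t y
      · obtain ⟨s, hs, hsx⟩ := hx
        obtain ⟨t, ht, hty⟩ := hy
        rcases lt_trichotomy s t with h | rfl | h
        · exact WithBot.coe_lt_coe.1 ((hsep s (hR hs) t (hR ht) h _ (hblock R hR s hs x hsx)).trans
            (hblock R hR t ht y hty).1)
        · rw [hf1 R hR s hs x hsx, hf1 R hR s hs y hty]
          exact hφmono _ _ hxy
        · exact absurd hxy (WithBot.coe_lt_coe.1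
            ((hsep t (hR ht) s (hR hs) h y hty).trans hsx.1)).not_gt
      · obtain ⟨s, hs, hsx⟩ := hx
        rw [hf2 R y hy]
        have : ¬ block s y := fun h => hy ⟨s, hs, h⟩
        have h2 : ∃ c ∈ T ∪ S, s < c ∧ c ≤ y := by
          by_contra! h3
          exact this ⟨hsx.1.trans (WithBot.coe_lt_coe.2 hxy), h3⟩
        obtain ⟨c, hc, hsc, hcy⟩ := h2
        exact ((hblock R hR s hs x hsx).2 c hc hsc).trans_le hcy
      · obtain ⟨t, ht, hty⟩ := hy
        rw [hf2 R x hx]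
        have : ¬ p t < x := fun h => hx ⟨t, ht, h, fun c hc htc => hxy.trans (hty.2 c hc htc)⟩
        exact WithBot.coe_lt_coe.1 ((not_lt.1 this).trans_lt (hblock R hR t ht y hty).1)
      · rwa [hf2 R x hx, hf2 R y hy]
    refine ⟨f, fun R hR => ⟨fun a _ b _ => (hmono R hR).le_iff_le, fun a ha => ?_, ?_⟩,
      fun y hy hcard => ?_⟩
    · refine hf2 R a ?_
      rintro ⟨t, ht, h1, h2⟩
      have htO := Finset.mem_filter.1 (hR ht)
      have haU : a ∈ T ∪ S := Finset.union_subset_union_left Finset.sdiff_subset ha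
      rcases lt_trichotomy a t with h | rfl | h
      · exact absurd h1 (not_lt.2 (hp' t a haU h))
      · simp only [Finset.mem_union, Finset.mem_sdiff] at ha
        tauto
      · exact lt_irrefl _ (h2 a haU h)
    · have hnotR : ∀ c ∈ T ∪ S, c ∉ R → c ∈ (T \ R) ∪ S := fun c hc hcR => by
        simp only [Finset.mem_union, Finset.mem_sdiff] at hc ⊢
        tauto
      intro x hx e' he' h
      obtain ⟨e, he, rfl⟩ := Finset.mem_image.1 hx
      by_cases hb : ∃ t ∈ R, block t e
      · obtain ⟨t, ht, hte⟩ := hb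
        obtain ⟨h1, h2⟩ := hf3 R hR t ht e hte
        have h3 : ¬ p t < e' := fun h3 =>
          absurd h (not_le.2 (h2 e' (Finset.mem_union_left _ he') h3))
        rw [not_lt] at h3
        obtain ⟨c, hc⟩ : ∃ c : A, p t = c := by
          cases hpy : p t with
          | bot => rw [hpy] at h3; exact absurd h3 (not_le.2 (WithBot.bot_lt_coe _))
          | coe c => exact ⟨c, rfl⟩
        obtain ⟨hcU, hct⟩ := hpT t c hc
        refine ⟨c, hnotR c hcU fun hcR => ?_, ?_, ?_⟩
        · obtain ⟨d, hd, hcd, hdt⟩ := exists_between_oddPart (hR hcR) (hR ht) hct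
          have := hp' t d hd hdt
          rw [hc] at this
          exact absurd hcd (not_lt.2 (WithBot.coe_le_coe.1 this))
        · rw [hc] at h3
          exact WithBot.coe_le_coe.1 h3
        · rw [hc] at h1
          exact (WithBot.coe_lt_coe.1 h1).le
      · rw [hf2 R e hb] at h ⊢
        obtain ⟨j, hj, h1, h2⟩ := hind e he e' he' h
        by_cases hjR : j ∈ R
        · have h3 : ∃ c ∈ T ∪ S, j < c ∧ c ≤ e := by
            by_contra! h3
            exact hb ⟨j, hjR, (hp j).trans_le (WithBot.coe_le_coe.2 h2), h3⟩
          -- The separating point `j` has been removed, but `e` lies beyond its block. The next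
          -- point of `T ∪ S` replaces it, and survives since neighbours are not both of odd rank.
          let V := (T ∪ S).filter fun c => j < c ∧ c ≤ e
          have hV : V.Nonempty := by
            obtain ⟨c, hc, hjc, hce⟩ := h3
            exact ⟨c, Finset.mem_filter.2 ⟨hc, hjc, hce⟩⟩
          obtain ⟨hm, hjm, hme⟩ := Finset.mem_filter.1 (V.min'_mem hV)
          refine ⟨V.min' hV, hnotR _ hm fun hmR => ?_, h1.trans hjm.le, hme⟩
          obtain ⟨d, hd, hjd, hdm⟩ := exists_between_oddPart (hR hjR) (hR hmR) hjm
          exact absurd hdm (not_lt.2 (V.min'_le d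
            (Finset.mem_filter.2 ⟨hd, hjd, hdm.le.trans hme⟩)))
        · exact ⟨j, hnotR j hj hjR, h1, h2⟩
    -- Pigeonhole: there are more disjoint blocks than points of `y`, so some block misses `y`.
    · have : ∃ t ∈ oddPart S T, ∀ x ∈ y, ¬ block t x := by
        by_contra! hcon
        choose! x hxy hx using hcon
        refine absurd (Finset.card_le_card_of_injOn x hxy fun s hs t ht hst => ?_) (not_le.2 hcard)
        have := hx t ht
        rw [← hst] at this
        exact huniq s hs t ht _ (hx s hs) this
      obtain ⟨t, ht, hty⟩ := this
      refine ⟨t, ht, fun R hR x hx => ?_⟩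
      have hR' : R ⊆ oddPart S T := hR.trans (Finset.erase_subset _ _)
      by_cases hb : ∃ s ∈ R, block s x
      · obtain ⟨s, hs, hsx⟩ := hb
        rw [hf1 R hR' s hs x hsx, hf1 _ (Finset.insert_subset ht hR') s
          (Finset.mem_insert_of_mem hs) x hsx]
      · rw [hf2 R x hb, hf2]
        rintro ⟨s, hs, hsx⟩
        rcases Finset.mem_insert.1 hs with rfl | h
        · exact hty x hx hsx
        · exact hb ⟨s, h, hsx⟩

end Dense

/-- The equality atoms and the ordered atoms are tame, with any finite set of constants. -/
theorem exists_tame {A : Type*} (r : A → A → Prop)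
    (hA : Nonempty (r ≃r (fun a b : ℕ => a = b)) ∨ Nonempty (r ≃r (fun a b : ℚ => a < b))) :
    ∃ _ : PartialOrder A, ∀ S : Finset A, Tame (Fix (r ≃r r) S) S := by
  rcases hA with ⟨⟨e⟩⟩ | ⟨⟨e⟩⟩
  · let P : PartialOrder A :=
      { le := fun a b => a = b
        le_refl := fun a => rfl
        le_trans := fun a b c => Eq.trans
        le_antisymm := fun a b h _ => h }
    have : Infinite A := Infinite.of_injective e.symm e.symm.injective
    refine ⟨P, fun S => tame_of_eq (fun a b => ?_) (fun a b h => h) S⟩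
    rw [← e.map_rel_iff]
    exact e.injective.eq_iff
  · let P : LinearOrder A := LinearOrder.lift' e e.injective
    let i : A ≃o ℚ := ⟨e.toEquiv, fun {a b} => Iff.rfl⟩
    have : Countable A := i.toEquiv.countable_iff.2 inferInstance
    have : DenselyOrdered A := (denselyOrdered_iff_of_orderIsoClass i).2 inferInstance
    have : NoMinOrder A := ⟨fun a => ⟨i.symm (i a - 1), by rw [OrderIso.symm_apply_lt]; linarith⟩⟩
    have : NoMaxOrder A := ⟨fun a => ⟨i.symm (i a + 1), by rw [OrderIso.lt_symm_apply]; linarith⟩⟩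
    have : Nonempty A := ⟨i.symm 0⟩
    refine ⟨P.toPartialOrder, fun S => tame_of_lt (fun a b => ?_) S⟩
    rw [← e.map_rel_iff]
    rfl

end TameAction
namespace TameAction

open scoped Pointwise Classical

/-! ### Coinvariants, generic translates and reduction to bounded supports. -/

section Extension

variable {G A F V : Type*} [Group G] [MulAction G A] [PartialOrder A] [Field F]
  [AddCommGroup V] [Module F V] [DistribMulAction G V] [SMulCommClass G F V]
  {S J E E' T : Finset A}

omit [PartialOrder A] [Module F V] [SMulCommClass G F V] in
theorem Supports.add {v w : V} (hv : Supports G E v) (hw : Supports G E w) :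
    Supports G E (v + w) := fun g hg => by rw [smul_add, hv g hg, hw g hg]

omit [PartialOrder A] [DistribMulAction G V] [SMulCommClass G F V] in
theorem Supports.smul_right [DistribMulAction G V] [SMulCommClass G F V] {v : V}
    (hv : Supports G E v) (c : F) : Supports G E (c • v) := fun g hg => by
  rw [smul_comm, hv g hg]

variable (G F V) in
/-- The subspace that one divides out to obtain the coinvariants of `Fix G J`. -/
def aug (J : Finset A) : Submodule F V :=
  Submodule.span F {w | ∃ g ∈ Fix G J, ∃ v : V, w = g • v - v}

omit [PartialOrder A] [SMulCommClass G F V] in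
theorem sub_mem_aug {g : G} (hg : g ∈ Fix G J) (v : V) : g • v - v ∈ aug G F V J :=
  Submodule.subset_span ⟨g, hg, v, rfl⟩

omit [PartialOrder A] [SMulCommClass G F V] in
theorem aug_anti (h : J ⊆ T) : aug G F V T ≤ aug G F V J :=
  Submodule.span_mono fun _ ⟨g, hg, v, e⟩ => ⟨g, Fix_anti h hg, v, e⟩

omit [PartialOrder A] in
theorem smul_mem_aug (g : G) {w : V} (hw : w ∈ aug G F V J) : g • w ∈ aug G F V (g • J) := by
  induction hw using Submodule.span_induction with
  | mem x hx =>
    obtain ⟨h, hh, v, rfl⟩ := hx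
    have := sub_mem_aug (F := F) (conj_mem_Fix (g := g) hh) (g • v)
    rw [smul_sub]
    simpa [mul_smul] using this
  | zero => simp
  | add x y _ _ hx hy => rw [smul_add]; exact add_mem hx hy
  | smul c x _ hx => rw [smul_comm]; exact Submodule.smul_mem _ _ hx

omit [PartialOrder A] in
theorem smul_mem_aug_iff (g : G) {w : V} : g • w ∈ aug G F V (g • J) ↔ w ∈ aug G F V J :=
  ⟨fun h => by simpa using smul_mem_aug g⁻¹ h, smul_mem_aug g⟩

omit [PartialOrder A] [SMulCommClass G F V] in
theorem mk_aug_smul {g : G} (hg : g ∈ Fix G J) (v : V) :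
    (aug G F V J).mkQ (g • v) = (aug G F V J).mkQ v :=
  (Submodule.Quotient.eq _).2 (sub_mem_aug hg v)

variable (tm : Tame G S) (hsupp : ∀ v : V, ∃ E : Finset A, Supports G E v)
include tm hsupp

/-- Stationarity identifies any two generic translates modulo `aug G F V T`; different supports are
compared through a translate generic for their union. Such a common translate also gives additivity.
-/
theorem exists_generic_linearMap (J T : Finset A) : ∃ e : V →ₗ[F] V ⧸ aug G F V T,
    ∀ (E : Finset A) (v : V) (i : G), Supports G E v → i ∈ Fix G J → Indep S J (i • E) T →
      e v = (aug G F V T).mkQ (i • v) := by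
  choose σ hσ using hsupp
  choose i hi hind using fun v => tm.exists_indep J (σ v) T
  have key : ∀ (E₁ E₂ : Finset A) (v : V) (i₁ i₂ : G), Supports G E₁ v → Supports G E₂ v →
      i₁ ∈ Fix G J → i₂ ∈ Fix G J → Indep S J (i₁ • E₁) T → Indep S J (i₂ • E₂) T →
      (aug G F V T).mkQ (i₁ • v) = (aug G F V T).mkQ (i₂ • v) := by
    intro E₁ E₂ v i₁ i₂ h1 h2 hi1 hi2 hd1 hd2
    obtain ⟨l, hl, hld⟩ := tm.exists_indep J (E₁ ∪ E₂) T
    have aux : ∀ (E : Finset A) (k : G), E ⊆ E₁ ∪ E₂ → Supports G E v → k ∈ Fix G J →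
        Indep S J (k • E) T → (aug G F V T).mkQ (k • v) = (aug G F V T).mkQ (l • v) := by
      intro E k hE hv hk hkd
      obtain ⟨h, hh, he⟩ := tm.stationary J E T k l hk hl hkd
        (hld.mono subset_rfl (Finset.smul_finset_subset_smul_finset hE) subset_rfl)
      rw [← hv.smul_eq_smul (g := h * k) (g' := l) (by simpa [mul_smul] using he), mul_smul,
        mk_aug_smul (Fix_anti Finset.subset_union_right hh)]
    rw [aux E₁ i₁ Finset.subset_union_left h1 hi1 hd1,
      aux E₂ i₂ Finset.subset_union_right h2 hi2 hd2]
  have key' : ∀ (E : Finset A) (v : V) (j : G), Supports G E v → j ∈ Fix G J →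
      Indep S J (j • E) T → (aug G F V T).mkQ (i v • v) = (aug G F V T).mkQ (j • v) :=
    fun E v j h1 h2 h3 => key _ _ v _ _ (hσ v) h1 (hi v) h2 (hind v) h3
  refine ⟨⟨⟨fun v => (aug G F V T).mkQ (i v • v), fun v w => ?_⟩, fun c v => ?_⟩, key'⟩
  · obtain ⟨l, hl, hld⟩ := tm.exists_indep J (σ v ∪ σ w) T
    have h1 := (hσ v).mono (Finset.subset_union_left (s₂ := σ w))
    have h2 := (hσ w).mono (Finset.subset_union_right (s₁ := σ v))
    rw [key' _ _ l h1 hl hld, key' _ _ l h2 hl hld, key' _ _ l (h1.add h2) hl hld, smul_add,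
      map_add]
  · simp only [RingHom.id_apply]
    rw [key' _ _ (i v) ((hσ v).smul_right c) (hi v) (hind v), smul_comm, map_smul]

/-- The class modulo `aug G F V T` of a generic translate of `v` by `Fix G J`. -/
noncomputable def generic (J T : Finset A) : V →ₗ[F] V ⧸ aug G F V T :=
  (exists_generic_linearMap (F := F) tm hsupp J T).choose

theorem generic_eq {v : V} {i : G} (hv : Supports G E v) (hi : i ∈ Fix G J)
    (hind : Indep S J (i • E) T) :
    generic (F := F) tm hsupp J T v = (aug G F V T).mkQ (i • v) :=
  (exists_generic_linearMap tm hsupp J T).choose_spec E v i hv hi hind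

theorem generic_self (J : Finset A) (v : V) :
    generic (F := F) tm hsupp J J v = (aug G F V J).mkQ v := by
  obtain ⟨E, hE⟩ := hsupp v
  rw [generic_eq tm hsupp hE (one_mem _) (indep_self_right _ _), one_smul]

/-- If `l` is generic for the supports of `u` and `g • u`, then `l * g` is a generic move for `u`,
so both vectors have the same value. Hence `generic` descends to coinvariants over `J`. -/
theorem generic_eq_zero {v : V} (hv : v ∈ aug G F V J) :
    generic (F := F) tm hsupp J T v = 0 := by
  have : aug G F V J ≤ LinearMap.ker (generic (F := F) tm hsupp J T) := by
    refine Submodule.span_le.2 ?_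
    rintro _ ⟨g, hg, u, rfl⟩
    obtain ⟨E, hE⟩ := hsupp u
    obtain ⟨l, hl, hld⟩ := tm.exists_indep J (E ∪ g • E) T
    rw [SetLike.mem_coe, LinearMap.mem_ker, map_sub, sub_eq_zero,
      generic_eq tm hsupp (hE.smul g) hl (hld.mono subset_rfl
        (Finset.smul_finset_subset_smul_finset Finset.subset_union_right) subset_rfl),
      generic_eq tm hsupp hE (mul_mem hl hg) (hld.mono subset_rfl
        (by rw [mul_smul]; exact Finset.smul_finset_subset_smul_finset Finset.subset_union_right)
        subset_rfl), mul_smul]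
  exact LinearMap.mem_ker.1 (this hv)

theorem generic_smul (g : G) (v w : V)
    (h : generic (F := F) tm hsupp J T v = (aug G F V T).mkQ w) :
    generic (F := F) tm hsupp (g • J) (g • T) (g • v) = (aug G F V (g • T)).mkQ (g • w) := by
  obtain ⟨E, hE⟩ := hsupp v
  obtain ⟨i, hi, hid⟩ := tm.exists_indep J E T
  rw [generic_eq tm hsupp hE hi hid] at h
  have h1 : i • v - w ∈ aug G F V T := (Submodule.Quotient.eq _).1 h
  have hind : Indep S (g • J) ((g * i * g⁻¹) • g • E) (g • T) := by
    have := tm.indep_smul hid g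
    rwa [← mul_smul, inv_mul_cancel_right, mul_smul]
  rw [generic_eq tm hsupp (hE.smul g) (conj_mem_Fix hi) hind, ← mul_smul, inv_mul_cancel_right,
    mul_smul]
  refine (Submodule.Quotient.eq _).2 ?_
  rw [← smul_sub]
  exact smul_mem_aug g h1

attribute [local instance] Finsupp.comapDistribMulAction

/-- Generic translates over a large set of atoms are linear combinations of generic translates over
subsets of bounded size, with equivariant coefficients. -/
theorem exists_reduction {k : ℕ}
    (hspan : Submodule.span F {v : V | ∃ y : Finset A, y.card ≤ k ∧ Supports G y v} = ⊤) :
    ∃ (D : ℕ) (c : Finset A → Finset A →₀ F), (∀ (g : G) T, c (g • T) = g • c T) ∧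
      (∀ T, ∀ J ∈ (c T).support, J ⊆ T ∧ J.card ≤ D) ∧
      ∀ T T' v, generic (F := F) tm hsupp T T' v =
        (c T).sum fun J a => a • generic (F := F) tm hsupp J T' v := by
  obtain ⟨O, hO, hOT, hcard, hred⟩ := tm.reduce
  obtain ⟨D, hD⟩ := hcard k
  -- The sum is linear in `v`, so only vectors supported by at most `k` atoms matter.
  have red : ∀ (T T' : Finset A) (v : V), D < T.card →
      ∑ R ∈ (O T).powerset, (-1 : F) ^ R.card • generic (F := F) tm hsupp (T \ R) T' v = 0 := by
    intro T T' v hT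
    have hv : v ∈ Submodule.span F {v : V | ∃ y : Finset A, y.card ≤ k ∧ Supports G y v} := by
      rw [hspan]; trivial
    induction hv using Submodule.span_induction with
    | mem x hx =>
      obtain ⟨y, hy, hyx⟩ := hx
      obtain ⟨i, hi, hid⟩ := tm.exists_indep T y T'
      obtain ⟨π, hπ, hπ'⟩ := hred T (i • y) T' hid
      obtain ⟨t, ht, htπ⟩ := hπ' (i • y) subset_rfl
        (by rw [Finset.card_smul_finset]; exact hy.trans_lt (hD T hT))
      have hgen : ∀ R ⊆ O T, generic (F := F) tm hsupp (T \ R) T' x =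
          (aug G F V T').mkQ (π R • i • x) := fun R hR => by
        rw [generic_eq tm hsupp (i := π R * i) hyx
          (mul_mem (hπ R hR).1 (Fix_anti Finset.sdiff_subset hi))
          (by rw [mul_smul]; exact (hπ R hR).2), mul_smul]
      -- The subsets `R` and `insert t R` give the same translate with opposite signs.
      rw [← Finset.insert_erase ht, Finset.sum_powerset_insert (Finset.notMem_erase _ _),
        ← Finset.sum_add_distrib]
      refine Finset.sum_eq_zero fun R hR => ?_
      have hR' := Finset.mem_powerset.1 hR
      have hR'' : R ⊆ O T := hR'.trans (Finset.erase_subset _ _)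
      have htR : t ∉ R := fun h => Finset.notMem_erase t _ (hR' h)
      rw [hgen R hR'', hgen _ (Finset.insert_subset ht hR''), Finset.card_insert_of_notMem htR,
        (hyx.smul i).smul_eq_smul (htπ R hR'), pow_succ]
      simp
    | zero => simp
    | add x y _ _ hx hy => simp only [map_add, smul_add, Finset.sum_add_distrib, hx, hy, add_zero]
    | smul c x _ hx =>
      simp only [map_smul, smul_comm _ c, ← Finset.smul_sum, hx, smul_zero]
  -- The alternating identity is solved for the term `R = ∅`. Each nonempty `R` makes `T` smaller,
  -- so `T.card` rounds reach sets of size at most `D`; the resulting identity holds after any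
  -- number of rounds.
  let c : ℕ → Finset A → Finset A →₀ F := fun n => Nat.rec (fun T => Finsupp.single T 1)
    (fun _ c T => if T.card ≤ D then Finsupp.single T 1 else
      -∑ R ∈ (O T).powerset.erase ∅, (-1 : F) ^ R.card • c (T \ R)) n
  have hc0 : ∀ T, c 0 T = Finsupp.single T 1 := fun T => rfl
  have hc1 : ∀ n T, T.card ≤ D → c (n + 1) T = Finsupp.single T 1 := fun n T h => if_pos h
  have hc2 : ∀ n T, ¬ T.card ≤ D → c (n + 1) T =
      -∑ R ∈ (O T).powerset.erase ∅, (-1 : F) ^ R.card • c n (T \ R) := fun n T h => if_neg h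
  have hsingle : ∀ (g : G) (T : Finset A), Finsupp.single (g • T) (1 : F) = g • Finsupp.single T (1 : F) :=
    fun g T => (Finsupp.comapSMul_single g T (1 : F)).symm
  have hfs : ∀ (g : G) (a : F) (x : Finset A →₀ F), g • a • x = a • g • x := fun g a x =>
    Finsupp.mapDomain_smul a x
  refine ⟨D, fun T => c T.card T, fun g T => ?_, fun T => ?_, fun T T' v => ?_⟩
  · dsimp only
    rw [Finset.card_smul_finset]
    generalize T.card = n
    induction n generalizing T with
    | zero => exact hsingle g T
    | succ n ih =>
      by_cases h : T.card ≤ D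
      · rw [hc1 n T h, hc1 n _ (by rwa [Finset.card_smul_finset]), hsingle]
      · rw [hc2 n T h, hc2 n _ (by rwa [Finset.card_smul_finset]), smul_neg, Finset.smul_sum, hO]
        congr 1
        symm
        refine Finset.sum_bij (fun R _ => g • R) (fun R hR => ?_) (fun R _ R' _ h => ?_)
          (fun R hR => ?_) (fun R hR => ?_)
        · rw [Finset.mem_erase, Finset.mem_powerset] at hR ⊢
          exact ⟨by simpa using hR.1, Finset.smul_finset_subset_smul_finset hR.2⟩
        · exact smul_left_cancel g h
        · rw [Finset.mem_erase, Finset.mem_powerset] at hR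
          refine ⟨g⁻¹ • R, ?_, smul_inv_smul g R⟩
          rw [Finset.mem_erase, Finset.mem_powerset]
          refine ⟨by simpa using hR.1, ?_⟩
          simpa using Finset.smul_finset_subset_smul_finset (a := g⁻¹) hR.2
        · rw [hfs, ← ih, Finset.card_smul_finset, Finset.smul_finset_sdiff]
  · have : ∀ n, ∀ T : Finset A, T.card ≤ n → ∀ J ∈ (c n T).support, J ⊆ T ∧ J.card ≤ D := by
      intro n
      induction n with
      | zero =>
        intro T hT J hJ
        rw [hc0] at hJ
        have := Finset.mem_singleton.1 (Finsupp.support_single_subset hJ)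
        subst this
        exact ⟨subset_rfl, by omega⟩
      | succ n ih =>
        intro T hT J hJ
        by_cases h : T.card ≤ D
        · rw [hc1 n T h] at hJ
          have := Finset.mem_singleton.1 (Finsupp.support_single_subset hJ)
          subst this
          exact ⟨subset_rfl, h⟩
        · rw [hc2 n T h, Finsupp.support_neg] at hJ
          obtain ⟨R, hR, hJR⟩ := Finset.mem_biUnion.1 (Finsupp.support_finsetSum hJ)
          rw [Finset.mem_erase, Finset.mem_powerset] at hR
          have hlt : (T \ R).card < T.card := by
            refine Finset.card_lt_card (Finset.sdiff_ssubset (hR.2.trans (hOT T)) ?_)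
            exact Finset.nonempty_iff_ne_empty.2 hR.1
          obtain ⟨h1, h2⟩ := ih (T \ R) (by omega) J (Finsupp.support_smul hJR)
          exact ⟨h1.trans Finset.sdiff_subset, h2⟩
    exact this _ T le_rfl
  · dsimp only
    generalize T.card = n
    induction n generalizing T with
    | zero => rw [hc0, Finsupp.sum_single_index (by simp), one_smul]
    | succ n ih =>
      by_cases h : T.card ≤ D
      · rw [hc1 n T h, Finsupp.sum_single_index (by simp), one_smul]
      · have h1 := red T T' v (not_le.1 h)
        rw [← Finset.add_sum_erase _ _ (Finset.empty_mem_powerset _)] at h1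
        simp only [Finset.card_empty, pow_zero, one_smul, Finset.sdiff_empty] at h1
        rw [eq_neg_of_add_eq_zero_left h1, hc2 n T h]
        let ψ : (Finset A →₀ F) →ₗ[F] V ⧸ aug G F V T' :=
          Finsupp.linearCombination F fun J => generic (F := F) tm hsupp J T' v
        change _ = ψ _
        have hψ : ∀ R, generic (F := F) tm hsupp (T \ R) T' v = ψ (c n (T \ R)) := fun R => ih _
        simp only [hψ, map_neg, map_sum, map_smul]

end Extension

end TameAction
namespace TameAction

open scoped Pointwise Classical

attribute [local instance] Finsupp.comapDistribMulAction

/-! ### Equivariant coordinates in coinvariants. -/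

section Lift

variable {G A F V : Type*} [Group G] [MulAction G A] [PartialOrder A] [Field F]
  [AddCommGroup V] [Module F V] [DistribMulAction G V] [SMulCommClass G F V]
  {S J E E' T : Finset A}

variable (G F) in
/-- The class of a vector modulo `aug G F V J`, together with `J`. -/
def cls (J : Finset A) (v : V) : Finset A × Set V := (J, {u | u - v ∈ aug G F V J})

variable (V) in
/-- A representative of a class. -/
noncomputable def rep (q : Finset A × Set V) : V := if h : q.2.Nonempty then h.some else 0

omit [PartialOrder A] [SMulCommClass G F V] in
theorem cls_eq_iff {v w : V} : cls G F J v = cls G F J w ↔ v - w ∈ aug G F V J := by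
  constructor
  · intro h
    have h1 : v ∈ (cls G F J v).2 := by simp [cls]
    rw [h] at h1
    exact h1
  · intro h
    refine Prod.ext rfl (Set.ext fun u => ?_)
    change u - v ∈ aug G F V J ↔ u - w ∈ aug G F V J
    rw [← sub_add_sub_cancel u v w]
    exact ((aug G F V J).add_mem_iff_left h).symm

omit [PartialOrder A] [SMulCommClass G F V] in
theorem rep_cls (v : V) : rep V (cls G F J v) - v ∈ aug G F V J := by
  have h : (cls G F J v).2.Nonempty := ⟨v, by simp [cls]⟩
  rw [rep, dif_pos h]
  exact h.some_mem

omit [PartialOrder A] [SMulCommClass G F V] in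
theorem mkQ_rep_cls (v : V) :
    (aug G F V J).mkQ (rep V (cls G F J v)) = (aug G F V J).mkQ v :=
  (Submodule.Quotient.eq _).2 (rep_cls v)

omit [PartialOrder A] in
theorem smul_cls (g : G) (v : V) : g • cls G F J v = cls G F (g • J) (g • v) := by
  refine Prod.ext rfl (Set.ext fun u => ?_)
  change u ∈ g • (cls G F J v).2 ↔ u - g • v ∈ aug G F V (g • J)
  rw [Set.mem_smul_set_iff_inv_smul_mem, ← smul_mem_aug_iff (J := g • J) g⁻¹, smul_sub,
    inv_smul_smul, inv_smul_smul]
  rfl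

omit [PartialOrder A] in
theorem supports_cls {v : V} (hv : Supports G E v) : Supports G (J ∪ E) (cls G F J v) :=
  fun g hg => by
    rw [smul_cls, smul_eq_self_of_mem_Fix (Fix_anti Finset.subset_union_left hg),
      hv g (Fix_anti Finset.subset_union_right hg)]

variable (tm : Tame G S) (hsupp : ∀ v : V, ∃ E : Finset A, Supports G E v)
include tm hsupp

omit [SMulCommClass G F V] in
-- The spanning orbits split into finitely many `Fix G J`-orbits, each of which becomes one vector
-- in the quotient.
theorem finite_quotient_aug {B : Set V} (hB : B.Finite)
    (hspan : Submodule.span F {v | ∃ g : G, ∃ b ∈ B, v = g • b} = ⊤) (J : Finset A) :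
    Module.Finite F (V ⧸ aug G F V J) := by
  obtain ⟨r, hr, hcov⟩ := tm.exists_finite_reps_of_finite J hB fun x _ => hsupp x
  refine Module.Finite.of_fg_top (Submodule.fg_def.2 ⟨(aug G F V J).mkQ '' r, hr.image _, ?_⟩)
  rw [eq_top_iff, ← Submodule.range_mkQ (aug G F V J), LinearMap.range_eq_map, ← hspan,
    Submodule.map_span, Submodule.span_le]
  rintro _ ⟨_, ⟨g, b, hb, rfl⟩, rfl⟩
  obtain ⟨y, hy, h, hh, he⟩ := hcov b hb g
  rw [he, mk_aug_smul hh]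
  exact Submodule.subset_span ⟨y, hy, rfl⟩

omit [SMulCommClass G F V] in
theorem exists_finite_generators {B : Set V} (hB : B.Finite)
    (hspan : Submodule.span F {v | ∃ g : G, ∃ b ∈ B, v = g • b} = ⊤) (J : Finset A)
    (W : Submodule F V) : ∃ R : Set V, R.Finite ∧ R ⊆ W ∧
      ∀ v ∈ W, (aug G F V J).mkQ v ∈ Submodule.span F ((aug G F V J).mkQ '' R) := by
  have := finite_quotient_aug tm hsupp hB hspan J
  obtain ⟨s, hs⟩ := IsNoetherian.noetherian (W.map (aug G F V J).mkQ)
  have h1 : ∀ x ∈ s, ∃ w ∈ W, (aug G F V J).mkQ w = x := fun x hx => by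
    have : x ∈ W.map (aug G F V J).mkQ := by
      rw [← hs]
      exact Submodule.subset_span hx
    exact this
  choose! f hf hfx using h1
  refine ⟨f '' s, (Finset.finite_toSet s).image f, ?_, fun v hv => ?_⟩
  · rintro _ ⟨x, hx, rfl⟩
    exact hf x hx
  · have h2 : (aug G F V J).mkQ '' (f '' s) = s := by
      rw [← Set.image_comp]
      refine (Set.image_congr fun x hx => ?_).trans (Set.image_id _)
      exact hfx x hx
    rw [h2, hs]
    exact Submodule.mem_map_of_mem hv

/-- Every class can be expressed, equivariantly, as a linear combination of classes from finitely
many orbits. -/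
theorem exists_equivariant_lift {B : Set V} (hB : B.Finite)
    (hspan : Submodule.span F {v | ∃ g : G, ∃ b ∈ B, v = g • b} = ⊤) (D : ℕ) :
    ∃ (R : Set (Finset A × Set V)) (s : Finset A × Set V → Finset A × Set V →₀ F), R.Finite ∧
      (∀ x ∈ R, ∃ J u, x = cls G F J u) ∧ (∀ (g : G) x, s (g • x) = g • s x) ∧
      ∀ J v, J.card ≤ D →
        (∀ q ∈ (s (cls G F J v)).support, (∃ g : G, ∃ x ∈ R, q = g • x) ∧ ∃ u, q = cls G F J u) ∧
        (aug G F V J).mkQ v = (s (cls G F J v)).sum fun q a => a • (aug G F V J).mkQ (rep V q) := by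
  obtain ⟨t, ht, htD⟩ := tm.finite_orbits_finset D
  let res : (J : Finset A) → G → J → A := fun J g j => g • (j : A)
  -- Vectors whose class is fixed by every symmetry of `J` acting on `J` through `Θ`. Generators
  -- chosen inside this subspace avoid averaging over a finite group, so the characteristic plays no
  -- role; there are only finitely many `Θ`.
  let W : (J : Finset A) → Set (J → A) → Submodule F V := fun J Θ =>
    { carrier := {u | ∀ g : G, g • J = J → res J g ∈ Θ → g • u - u ∈ aug G F V J}
      add_mem' := fun {a b} ha hb g h1 h2 => by
        rw [smul_add, add_sub_add_comm]
        exact add_mem (ha g h1 h2) (hb g h1 h2)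
      zero_mem' := fun g _ _ => by simp
      smul_mem' := fun c a ha g h1 h2 => by
        rw [smul_comm, ← smul_sub]
        exact Submodule.smul_mem _ _ (ha g h1 h2) }
  choose R hR hRW hRspan using fun J Θ => exists_finite_generators tm hsupp hB hspan J (W J Θ)
  let Rs : Set (Finset A × Set V) := ⋃ J ∈ t, ⋃ Θ ∈ 𝒫 {f : J → A | ∀ j, f j ∈ J},
    cls G F J '' R J Θ
  have hRs : Rs.Finite := by
    refine Set.Finite.biUnion ht fun J _ => Set.Finite.biUnion ?_ fun Θ _ => (hR J Θ).image _
    refine Set.Finite.powerset ?_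
    refine (Set.Finite.pi' (t := fun _ : J => (J : Set A)) fun _ => J.finite_toSet).subset ?_
    exact fun f hf => hf
  let P : Finset A × Set V → (Finset A × Set V →₀ F) → Prop := fun x y =>
    ∀ J v, J.card ≤ D → x = cls G F J v →
      (∀ q ∈ y.support, (∃ g : G, ∃ x ∈ Rs, q = g • x) ∧ ∃ u, q = cls G F J u) ∧
        (aug G F V J).mkQ v = y.sum fun q a => a • (aug G F V J).mkQ (rep V q)
  have hP : ∀ (g : G) x y, P x y → P (g • x) (g • y) := by
    intro g x y hxy J v hJ hx
    have hx' : x = cls G F (g⁻¹ • J) (g⁻¹ • v) := by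
      rw [← smul_cls, ← hx, inv_smul_smul]
    obtain ⟨h1, h2⟩ := hxy _ _ (by rwa [Finset.card_smul_finset]) hx'
    have hs : (g • y).support = g • y.support := by
      ext q
      rw [← Finset.inv_smul_mem_iff, Finsupp.mem_support_iff, Finsupp.comapSMul_apply,
        Finsupp.mem_support_iff]
    refine ⟨fun q hq => ?_, ?_⟩
    · rw [hs, ← Finset.inv_smul_mem_iff] at hq
      obtain ⟨⟨k, x, hx, e⟩, u, hu⟩ := h1 _ hq
      refine ⟨⟨g * k, x, hx, by rw [mul_smul, ← e, smul_inv_smul]⟩, g • u, ?_⟩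
      rw [← smul_inv_smul g q, hu, smul_cls, smul_inv_smul]
    · have h3 : ∀ (z : V) (w : Finset A × Set V → V), (aug G F V (g⁻¹ • J)).mkQ (g⁻¹ • z) =
          (y.sum fun q a => a • (aug G F V (g⁻¹ • J)).mkQ (w q)) →
          (aug G F V J).mkQ z = y.sum fun q a => a • (aug G F V J).mkQ (g • w q) := by
        intro z w h
        simp only [Finsupp.sum, ← map_smul, ← map_sum] at h ⊢
        refine (Submodule.Quotient.eq _).2 ?_
        have := smul_mem_aug g ((Submodule.Quotient.eq _).1 h)
        simpa only [smul_sub, smul_inv_smul, Finset.smul_sum, smul_comm g] using this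
      rw [h3 _ _ h2, Finsupp.comapSMul_def,
        Finsupp.sum_mapDomain_index_inj (MulAction.injective g)]
      refine Finsupp.sum_congr fun q hq => ?_
      obtain ⟨-, u, hu⟩ := h1 q hq
      congr 1
      rw [hu, smul_cls, smul_inv_smul, mkQ_rep_cls]
      refine (Submodule.Quotient.eq _).2 ?_
      rw [← smul_sub]
      have := smul_mem_aug g (rep_cls (G := G) (F := F) (J := g⁻¹ • J) u)
      rwa [smul_inv_smul] at this
  have hex : ∀ x, ∃ y, P x y ∧ MulAction.stabilizer G x ≤ MulAction.stabilizer G y := by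
    have base : ∀ J ∈ t, ∀ v, ∃ y, P (cls G F J v) y ∧
        MulAction.stabilizer G (cls G F J v) ≤ MulAction.stabilizer G y := by
      intro J hJ v
      -- With this `Θ` each generator has a class fixed by the stabilizer of the class of `v`, so
      -- the combination of generators is fixed as well, as equivariant choice requires.
      let Θ : Set (J → A) := {f | ∃ g ∈ MulAction.stabilizer G (cls G F J v), f = res J g}
      have hstab : ∀ (g : G) (u : V), g ∈ MulAction.stabilizer G (cls G F J u) ↔
          g • J = J ∧ g • u - u ∈ aug G F V J := fun g u => by
        rw [MulAction.mem_stabilizer_iff, smul_cls]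
        constructor
        · intro h
          have h1 : g • J = J := congrArg Prod.fst h
          rw [h1] at h
          exact ⟨h1, cls_eq_iff.1 h⟩
        · rintro ⟨h1, h2⟩
          rw [h1]
          exact cls_eq_iff.2 h2
      have hΘ : Θ ∈ 𝒫 {f : J → A | ∀ j, f j ∈ J} := by
        rintro _ ⟨g, hg, rfl⟩ j
        have h1 : g • (j : A) ∈ g • J := Finset.smul_mem_smul_finset j.2
        rwa [((hstab g v).1 hg).1] at h1
      have hvW : v ∈ W J Θ := by
        rintro g hgJ ⟨g', hg', hgg'⟩
        obtain ⟨h1, h2⟩ := (hstab g' v).1 hg'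
        have h3 : g'⁻¹ * g ∈ Fix G J := mem_Fix.2 fun a ha => by
          rw [mul_smul, inv_smul_eq_iff]
          exact congrFun hgg' ⟨a, ha⟩
        have h4 := smul_mem_aug g' (sub_mem_aug (F := F) h3 v)
        rw [h1, smul_sub, ← mul_smul, mul_inv_cancel_left] at h4
        simpa using add_mem h4 h2
      obtain ⟨l, hl, hlv⟩ := (Finsupp.mem_span_image_iff_linearCombination F).1
        (hRspan J Θ v hvW)
      have hsup : ∀ q ∈ (l.mapDomain (cls G F J)).support, ∃ u ∈ R J Θ, q = cls G F J u := by
        intro q hq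
        obtain ⟨u, hu, rfl⟩ := Finset.mem_image.1 (Finsupp.mapDomain_support hq)
        exact ⟨u, hl hu, rfl⟩
      refine ⟨l.mapDomain (cls G F J), fun J' v' _ hv' => ?_, fun g hg => ?_⟩
      · obtain rfl : J = J' := congrArg Prod.fst hv'
        refine ⟨fun q hq => ?_, ?_⟩
        · obtain ⟨u, hu, rfl⟩ := hsup q hq
          refine ⟨⟨1, _, ?_, (one_smul _ _).symm⟩, u, rfl⟩
          simp only [Rs, Set.mem_iUnion]
          exact ⟨J, hJ, Θ, hΘ, u, hu, rfl⟩
        · have h5 : (aug G F V J).mkQ v = (aug G F V J).mkQ v' :=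
            (Submodule.Quotient.eq _).2 (cls_eq_iff.1 hv')
          rw [← h5, ← hlv, Finsupp.sum_mapDomain_index (by simp) (by simp [add_smul])]
          simp only [mkQ_rep_cls]
          rfl
      · rw [MulAction.mem_stabilizer_iff, Finsupp.comapSMul_def]
        have : Finsupp.mapDomain (g • ·) (l.mapDomain (cls G F J)) =
            Finsupp.mapDomain id (l.mapDomain (cls G F J)) := by
          refine Finsupp.mapDomain_congr fun q hq => ?_
          obtain ⟨u, hu, rfl⟩ := hsup q hq
          obtain ⟨h1, h2⟩ := (hstab g v).1 hg
          exact (hstab g u).2 ⟨h1, hRW J Θ hu g h1 ⟨g, hg, rfl⟩⟩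
        rw [this, Finsupp.mapDomain_id]
    intro x
    by_cases hx : ∃ J v, J.card ≤ D ∧ x = cls G F J v
    · obtain ⟨J, v, hJ, rfl⟩ := hx
      obtain ⟨K, hK, g, rfl⟩ := htD J hJ
      obtain ⟨y, hy, hst⟩ := base K hK (g⁻¹ • v)
      have hgx : g • cls G F K (g⁻¹ • v) = cls G F (g • K) v := by
        rw [smul_cls, smul_inv_smul]
      refine ⟨g • y, hgx ▸ hP g _ _ hy, fun k hk => ?_⟩
      have h1 : g⁻¹ * k * g ∈ MulAction.stabilizer G (cls G F K (g⁻¹ • v)) := by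
        rw [MulAction.mem_stabilizer_iff, mul_smul, hgx, mul_smul,
          MulAction.mem_stabilizer_iff.1 hk, inv_smul_eq_iff, hgx]
      have h2 := MulAction.mem_stabilizer_iff.1 (hst h1)
      rw [mul_smul, mul_smul, inv_smul_eq_iff] at h2
      exact h2
    -- Pairs that are not classes over a small `J` get the value 0.
    · refine ⟨0, fun J v hJ hxv => absurd ⟨J, v, hJ, hxv⟩ hx, fun g _ => ?_⟩
      rw [MulAction.mem_stabilizer_iff, smul_zero]
  obtain ⟨s, hs, hsP⟩ := exists_equivariant_choice P hP hex
  refine ⟨Rs, s, hRs, fun x hx => ?_, hs, fun J v hJ => hsP _ J v hJ rfl⟩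
  simp only [Rs, Set.mem_iUnion] at hx
  obtain ⟨J, -, Θ, -, u, -, rfl⟩ := hx
  exact ⟨J, u, rfl⟩

end Lift

end TameAction
namespace TameAction

open scoped Pointwise Classical

attribute [local instance] Finsupp.comapDistribMulAction

/-! ### From spanned automata to weighted automata. -/

section Automaton

variable {G A F V Al : Type*} [Group G] [MulAction G A] [PartialOrder A] [Field F]
  [AddCommGroup V] [Module F V] [DistribMulAction G V] [SMulCommClass G F V] [MulAction G Al]
  {S J E E' T : Finset A}

/-- The value of a word, read from the vector `v`. -/
def output (δ : Al → V →ₗ[F] V) (φ : V →ₗ[F] F) (w : List Al) : V →ₗ[F] F :=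
  w.foldr (fun a f => f ∘ₗ δ a) φ

omit [Group G] [MulAction G A] [PartialOrder A] [DistribMulAction G V] [SMulCommClass G F V]
  [MulAction G Al] in
theorem output_eq (δ : Al → V →ₗ[F] V) (φ : V →ₗ[F] F) (w : List Al) (v : V) :
    output δ φ w v = φ (w.foldl (fun x a => δ a x) v) := by
  induction w generalizing v with
  | nil => rfl
  | cons a w ih => exact ih (δ a v)

/-- The atoms supporting the letters of a word. -/
noncomputable def wordSupport (σ : Al → Finset A) (w : List Al) : Finset A :=
  w.foldr (fun a T => σ a ∪ T) ∅

omit [PartialOrder A] [SMulCommClass G F V] in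
theorem output_smul {σ : Al → Finset A} (hσ : ∀ a, Supports G (σ a) a)
    {δ : Al → V →ₗ[F] V} (hδ : ∀ (g : G) a v, δ (g • a) (g • v) = g • δ a v)
    {φ : V →ₗ[F] F} (hφ : ∀ (g : G) v, φ (g • v) = φ v) (w : List Al) {g : G}
    (hg : g ∈ Fix G (wordSupport σ w)) (v : V) : output δ φ w (g • v) = output δ φ w v := by
  induction w generalizing v with
  | nil => exact hφ g v
  | cons a w ih =>
    have h1 : δ a (g • v) = g • δ a v := by
      rw [← hδ, hσ a g (Fix_anti Finset.subset_union_left hg)]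
    change output δ φ w (δ a (g • v)) = output δ φ w (δ a v)
    rw [h1, ih (Fix_anti Finset.subset_union_right hg)]

omit [PartialOrder A] [SMulCommClass G F V] in
theorem aug_le_ker_output {σ : Al → Finset A} (hσ : ∀ a, Supports G (σ a) a)
    {δ : Al → V →ₗ[F] V} (hδ : ∀ (g : G) a v, δ (g • a) (g • v) = g • δ a v)
    {φ : V →ₗ[F] F} (hφ : ∀ (g : G) v, φ (g • v) = φ v) (w : List Al) :
    aug G F V (wordSupport σ w) ≤ LinearMap.ker (output δ φ w) := by
  refine Submodule.span_le.2 ?_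
  rintro _ ⟨g, hg, v, rfl⟩
  rw [SetLike.mem_coe, LinearMap.mem_ker, map_sub, output_smul hσ hδ hφ w hg, sub_self]

omit [PartialOrder A] [SMulCommClass G F V] in
-- `Fix G T` fixes the letter, so its transition commutes with this group and descends to
-- coinvariants.
theorem map_mem_aug {σ : Al → Finset A} (hσ : ∀ a, Supports G (σ a) a)
    {δ : Al → V →ₗ[F] V} (hδ : ∀ (g : G) a v, δ (g • a) (g • v) = g • δ a v) {a : Al}
    (ha : σ a ⊆ T) {v : V} (hv : v ∈ aug G F V T) : δ a v ∈ aug G F V T := by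
  have : aug G F V T ≤ (aug G F V T).comap (δ a) := by
    refine Submodule.span_le.2 ?_
    rintro _ ⟨g, hg, u, rfl⟩
    rw [SetLike.mem_coe, Submodule.mem_comap, map_sub]
    have h1 : δ a (g • u) = g • δ a u := by
      rw [← hδ, hσ a g (Fix_anti ha hg)]
    rw [h1]
    exact sub_mem_aug hg _
  exact this hv

omit [Group G] [MulAction G A] [PartialOrder A] [DistribMulAction G V] [SMulCommClass G F V]
  [MulAction G Al] in
theorem apply_eq_sum {ι : Type*} {U : Submodule F V} {f : V →ₗ[F] F} (hf : U ≤ LinearMap.ker f)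
    {l : ι →₀ F} {v : V} {r : ι → V} (h : U.mkQ v = l.sum fun i a => a • U.mkQ (r i)) :
    f v = l.sum fun i a => a * f (r i) := by
  have h1 : ∀ u, f u = U.liftQ f hf (U.mkQ u) := fun u => (U.liftQ_apply f u).symm
  simp only [h1, h, map_finsuppSum, map_smul, smul_eq_mul]

variable (tm : Tame G S) (hsupp : ∀ v : V, ∃ E : Finset A, Supports G E v)
include tm hsupp

/-- An orbit-finitely spanned automaton is equivalent to a weighted automaton, whose states are
classes of vectors modulo the subspaces `aug G F V J`. -/
theorem exists_weighted {B : Set V} (hB : B.Finite)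
    (hspan : Submodule.span F {v | ∃ g : G, ∃ b ∈ B, v = g • b} = ⊤)
    (hsuppAl : ∀ a : Al, ∃ E : Finset A, Supports G E a)
    {δ : Al → V →ₗ[F] V} (hδ : ∀ (g : G) a v, δ (g • a) (g • v) = g • δ a v)
    {φ : V →ₗ[F] F} (hφ : ∀ (g : G) v, φ (g • v) = φ v) {v₀ : V} (hv₀ : ∀ g : G, g • v₀ = v₀) :
    ∃ (R : Set (Finset A × Set V)) (init : Finset A × Set V →₀ F)
      (tr : Finset A × Set V → Al → Finset A × Set V →₀ F) (fin : Finset A × Set V → F)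
      (ν : List Al → Finset A × Set V → F), R.Finite ∧
      (∀ x ∈ R, ∃ E : Finset A, Supports G E x) ∧
      (∀ p ∈ init.support, ∃ g : G, ∃ x ∈ R, p = g • x) ∧
      (∀ q a, ∀ p ∈ (tr q a).support, ∃ g : G, ∃ x ∈ R, p = g • x) ∧
      (∀ g : G, g • init = init) ∧
      (∀ (k : G), ∀ x ∈ R, ∀ (g : G) a, tr (g • k • x) (g • a) = g • tr (k • x) a) ∧
      (∀ (k : G), ∀ x ∈ R, fin (k • x) = fin x) ∧
      (∀ (k : G), ∀ x ∈ R, ν [] (k • x) = fin (k • x)) ∧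
      (∀ (k : G), ∀ x ∈ R, ∀ a w,
        ν (a :: w) (k • x) = (tr (k • x) a).sum fun p b => b * ν w p) ∧
      ∀ w, output δ φ w v₀ = init.sum fun p b => b * ν w p := by
  obtain ⟨σ, hσ, hσg⟩ := tm.exists_equivariant_support hsuppAl
  obtain ⟨k, hk⟩ : ∃ k : ℕ, ∀ b ∈ B, ∃ y : Finset A, y.card ≤ k ∧ Supports G y b := by
    choose y hy using hsupp
    obtain ⟨k, hk⟩ := (hB.image fun b => (y b).card).bddAbove
    exact ⟨k, fun b hb => ⟨y b, hk ⟨b, hb, rfl⟩, hy b⟩⟩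
  have hspan' : Submodule.span F {v : V | ∃ y : Finset A, y.card ≤ k ∧ Supports G y v} = ⊤ := by
    rw [eq_top_iff, ← hspan]
    refine Submodule.span_mono ?_
    rintro _ ⟨g, b, hb, rfl⟩
    obtain ⟨y, hy, hyb⟩ := hk b hb
    exact ⟨g • y, by rwa [Finset.card_smul_finset], hyb.smul g⟩
  obtain ⟨D, c, hcg, hcD, hcred⟩ := exists_reduction (F := F) tm hsupp hspan'
  obtain ⟨R, s, hR, hRcls, hsg, hs⟩ := exists_equivariant_lift tm hsupp hB hspan D
  let out : ∀ T : Finset A, V ⧸ aug G F V T → V := fun T x => ((aug G F V T).mkQ_surjective x).choose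
  have hout : ∀ T x, (aug G F V T).mkQ (out T x) = x := fun T x =>
    ((aug G F V T).mkQ_surjective x).choose_spec
  -- The stored vector is made generic relative to the letter before the transition is applied; the
  -- result matters only modulo the coinvariant relations over `q.1 ∪ σ a`.
  let next : Finset A × Set V → Al → V := fun q a =>
    δ a (out (q.1 ∪ σ a) (generic tm hsupp q.1 (q.1 ∪ σ a) (rep V q)))
  let tr : Finset A × Set V → Al → Finset A × Set V →₀ F := fun q a =>
    (c (q.1 ∪ σ a)).sum fun J b => b • s (cls G F J (next q a))
  -- The value of a state on `w`: the output on a translate that is generic over `J` relative to the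
  -- atoms of `w`.
  let val : Finset A → List Al → V →ₗ[F] F := fun J w =>
    (aug G F V (wordSupport σ w)).liftQ (output δ φ w) (aug_le_ker_output hσ hδ hφ w) ∘ₗ
      generic tm hsupp J (wordSupport σ w)
  have val_eq : ∀ {J E : Finset A} {w : List Al} {v : V} {i : G}, Supports G E v → i ∈ Fix G J →
      Indep S J (i • E) (wordSupport σ w) → val J w v = output δ φ w (i • v) := by
    intro J E w v i h1 h2 h3
    simp only [val, LinearMap.comp_apply, generic_eq tm hsupp h1 h2 h3]
    exact Submodule.liftQ_apply _ _ _
  have val_aug : ∀ J w, aug G F V J ≤ LinearMap.ker (val J w) := fun J w v hv => by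
    rw [LinearMap.mem_ker]
    simp only [val, LinearMap.comp_apply, generic_eq_zero tm hsupp hv, map_zero]
  have val_congr : ∀ {J w v v'}, v - v' ∈ aug G F V J → val J w v = val J w v' := by
    intro J w v v' h
    have := LinearMap.mem_ker.1 (val_aug J w h)
    rwa [map_sub, sub_eq_zero] at this
  have val_red : ∀ T w v, val T w v = (c T).sum fun J a => a * val J w v := by
    intro T w v
    simp only [val, LinearMap.comp_apply]
    rw [hcred T, map_finsuppSum]
    simp only [map_smul, smul_eq_mul]
  have val_lift : ∀ J w v, J.card ≤ D → val J w v =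
      (s (cls G F J v)).sum fun p b => b * val p.1 w (rep V p) := by
    intro J w v hJ
    obtain ⟨h1, h2⟩ := hs J v hJ
    rw [apply_eq_sum (val_aug J w) h2]
    refine Finsupp.sum_congr fun p hp => ?_
    obtain ⟨-, u, hu⟩ := h1 p hp
    have : p.1 = J := by rw [hu]; rfl
    rw [this]
  -- The move `i` is generic relative to the letter and `j` relative to the remaining word; by
  -- `indep_trans` the product `j * i` is generic relative to the whole word.
  have val_cons : ∀ (q : Finset A × Set V) a w,
      val q.1 (a :: w) (rep V q) = val (q.1 ∪ σ a) w (next q a) := by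
    intro q a w
    obtain ⟨E, hE⟩ := hsupp (rep V q)
    obtain ⟨i, hi, hid⟩ := tm.exists_indep q.1 E (q.1 ∪ σ a)
    obtain ⟨j, hj, hjd⟩ := tm.exists_indep (q.1 ∪ σ a) (i • E ∪ σ a) (wordSupport σ w)
    have hnext : next q a - δ a (i • rep V q) ∈ aug G F V (q.1 ∪ σ a) := by
      simp only [next]
      rw [← map_sub]
      refine map_mem_aug hσ hδ Finset.subset_union_right ?_
      refine (Submodule.Quotient.eq _).1 ?_
      change (aug G F V (q.1 ∪ σ a)).mkQ _ = (aug G F V (q.1 ∪ σ a)).mkQ _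
      rw [hout, generic_eq tm hsupp hE hi hid]
    have hδE : Supports G (i • E ∪ σ a) (δ a (i • rep V q)) := fun g hg => by
      rw [← hδ, hσ a g (Fix_anti Finset.subset_union_right hg),
        hE.smul i g (Fix_anti Finset.subset_union_left hg)]
    rw [val_congr hnext, val_eq hδE hj hjd]
    have h1 : j • δ a (i • rep V q) = δ a ((j * i) • rep V q) := by
      rw [← hδ, hσ a j (Fix_anti Finset.subset_union_right hj), mul_smul]
    rw [h1]
    refine val_eq hE (mul_mem (Fix_anti Finset.subset_union_left hj) hi) ?_
    refine tm.indep_trans (hid.mono subset_rfl subset_rfl Finset.subset_union_right) hj ?_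
    exact hjd.mono subset_rfl
      (Finset.smul_finset_subset_smul_finset Finset.subset_union_left) subset_rfl
  have hrepg : ∀ (k : G), ∀ x ∈ R, ∀ g : G,
      rep V (g • k • x) - g • rep V (k • x) ∈ aug G F V (g • k • x).1 := by
    intro k x hx g
    obtain ⟨J, u, rfl⟩ := hRcls x hx
    rw [← sub_add_sub_cancel _ (g • k • u), ← smul_sub, smul_cls, smul_cls]
    refine add_mem (rep_cls _) ?_
    rw [← neg_mem_iff, ← smul_neg, neg_sub]
    exact smul_mem_aug g (rep_cls _)
  -- The invariance of `v₀` allows starting over the empty set of atoms, where its generic translate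
  -- is itself.
  refine ⟨R, s (cls G F ∅ v₀), tr, fun q => φ (rep V q), fun w q => val q.1 w (rep V q), hR,
    fun x hx => ?_, fun p hp => ((hs ∅ v₀ (by simp)).1 p hp).1, fun q a p hp => ?_, fun g => ?_,
    fun k x hx g a => ?_, fun k x hx => ?_, fun k x hx => ?_, fun k x hx a w => ?_, fun w => ?_⟩
  · obtain ⟨J, u, rfl⟩ := hRcls x hx
    obtain ⟨E, hE⟩ := hsupp u
    exact ⟨_, supports_cls hE⟩
  · obtain ⟨J, hJ, hp'⟩ := Finset.mem_biUnion.1 (Finsupp.support_finsetSum hp)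
    exact ((hs J _ (hcD _ J hJ).2).1 p (Finsupp.support_smul hp')).1
  · rw [← hsg, smul_cls, hv₀, Finset.smul_finset_empty]
  · have hT : (g • k • x).1 ∪ σ (g • a) = g • ((k • x).1 ∪ σ a) := by
      rw [hσg, Finset.smul_finset_union]
      rfl
    have hnext : next (g • k • x) (g • a) - g • next (k • x) a ∈
        aug G F V (g • ((k • x).1 ∪ σ a)) := by
      simp only [next]
      rw [← hδ, ← map_sub]
      refine map_mem_aug hσ hδ (by rw [hσg]; exact
        Finset.smul_finset_subset_smul_finset Finset.subset_union_right) ?_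
      rw [hT]
      refine (Submodule.Quotient.eq _).1 ?_
      change (aug G F V (g • ((k • x).1 ∪ σ a))).mkQ _ =
        (aug G F V (g • ((k • x).1 ∪ σ a))).mkQ _
      rw [hout, ← generic_smul tm hsupp g _ _ (hout _ _).symm]
      have := generic_eq_zero (T := g • ((k • x).1 ∪ σ a)) tm hsupp (hrepg k x hx g)
      rwa [map_sub, sub_eq_zero] at this
    simp only [tr]
    rw [hT, hcg, Finsupp.comapSMul_def, Finsupp.sum_mapDomain_index_inj (MulAction.injective g),
      Finsupp.smul_sum]
    refine Finsupp.sum_congr fun J hJ => ?_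
    rw [show ∀ (b : F) (x : Finset A × Set V →₀ F), g • b • x = b • g • x from
      fun b x => Finsupp.mapDomain_smul b x, ← hsg, smul_cls, cls_eq_iff.2
        (aug_anti (Finset.smul_finset_subset_smul_finset (hcD _ J hJ).1) hnext)]
  · have h1 := LinearMap.mem_ker.1 (aug_le_ker_output hσ hδ hφ []
      (aug_anti (Finset.empty_subset _) (hrepg 1 x hx k)))
    rw [map_sub, sub_eq_zero, one_smul] at h1
    exact h1.trans (hφ k _)
  · obtain ⟨E, hE⟩ := hsupp (rep V (k • x))
    change val _ _ _ = φ _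
    rw [val_eq (w := []) hE (one_mem _)
      (fun _ _ e' he' _ => absurd he' (Finset.notMem_empty e')), one_smul]
    rfl
  · dsimp only
    rw [val_cons, val_red]
    have h1 : ∀ l : Finset A × Set V →₀ F, (l.sum fun p b => b * val p.1 w (rep V p)) =
        Finsupp.linearCombination F (fun p => val p.1 w (rep V p)) l := fun l => rfl
    rw [h1]
    simp only [tr]
    rw [map_finsuppSum]
    refine Finsupp.sum_congr fun J hJ => ?_
    rw [val_lift J w _ (hcD _ J hJ).2, map_smul, h1, smul_eq_mul]
  · rw [← val_lift ∅ w v₀ (by simp)]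
    have h1 : Supports G (∅ : Finset A) v₀ := fun g _ => hv₀ g
    rw [val_eq (i := 1) h1 (one_mem _) (by intro e he; simp at he), one_smul]

end Automaton

end TameAction
namespace TameAction

open scoped Pointwise Classical

/-! ### The algebra of finitely supported endomorphisms is orbit-finitely spanned. -/

section Endomorphisms

variable {G A F Q : Type*} [Group G] [MulAction G A] [Field F] [MulAction G Q]

variable (F Q) in
/-- The action of a group element on endomorphisms of `Q →₀ F`, by conjugation. -/
noncomputable def conjEnd (g : G) : Module.End F (Q →₀ F) ≃ₐ[F] Module.End F (Q →₀ F) :=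
  (Finsupp.domLCongr (M := F) (R := F) (MulAction.toPerm g : Equiv.Perm Q)).conjAlgEquiv F

theorem conjEnd_single (g : G) (φ : Module.End F (Q →₀ F)) (q p : Q) :
    conjEnd F Q g φ (Finsupp.single q 1) p = φ (Finsupp.single (g⁻¹ • q) 1) (g⁻¹ • p) := by
  rw [conjEnd, LinearEquiv.conjAlgEquiv_apply]
  simp only [LinearMap.comp_apply, LinearEquiv.coe_coe]
  rw [Finsupp.domLCongr_symm, Finsupp.domLCongr_single, Finsupp.domLCongr_apply]
  rfl

omit [Group G] [MulAction G Q] in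
theorem end_ext {φ ψ : Module.End F (Q →₀ F)}
    (h : ∀ q p, φ (Finsupp.single q 1) p = ψ (Finsupp.single q 1) p) : φ = ψ :=
  Finsupp.lhom_ext' fun q => LinearMap.ext_ring (Finsupp.ext fun p => h q p)

theorem conjEnd_one (φ : Module.End F (Q →₀ F)) : conjEnd F Q (1 : G) φ = φ :=
  end_ext fun q p => by rw [conjEnd_single]; simp

theorem conjEnd_mul (g h : G) (φ : Module.End F (Q →₀ F)) :
    conjEnd F Q (g * h) φ = conjEnd F Q g (conjEnd F Q h φ) :=
  end_ext fun q p => by simp only [conjEnd_single, mul_inv_rev, mul_smul]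

variable (G A F Q) in
/-- The algebra of finitely supported endomorphisms of `Q →₀ F`; multiplication is composition in
the order of reading. -/
noncomputable def suppEnd : Subalgebra F (Module.End F (Q →₀ F))ᵐᵒᵖ where
  carrier := {φ | ∃ E : Finset A, ∀ g ∈ Fix G E, conjEnd F Q g φ.unop = φ.unop}
  mul_mem' := by
    rintro φ ψ ⟨E, hE⟩ ⟨E', hE'⟩
    refine ⟨E ∪ E', fun g hg => ?_⟩
    rw [MulOpposite.unop_mul, map_mul, hE g (Fix_anti Finset.subset_union_left hg),
      hE' g (Fix_anti Finset.subset_union_right hg)]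
  add_mem' := by
    rintro φ ψ ⟨E, hE⟩ ⟨E', hE'⟩
    refine ⟨E ∪ E', fun g hg => ?_⟩
    rw [MulOpposite.unop_add, map_add, hE g (Fix_anti Finset.subset_union_left hg),
      hE' g (Fix_anti Finset.subset_union_right hg)]
  algebraMap_mem' := fun c => ⟨∅, fun g _ => by
    rw [MulOpposite.algebraMap_apply, MulOpposite.unop_op, AlgEquiv.commutes]⟩

noncomputable instance : AddCommGroup (suppEnd G A F Q) := Module.addCommMonoidToAddCommGroup F

noncomputable instance : MulAction G (suppEnd G A F Q) where
  smul g φ := ⟨MulOpposite.op (conjEnd F Q g φ.1.unop), by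
    obtain ⟨E, hE⟩ := φ.2
    refine ⟨g • E, fun h hh => ?_⟩
    rw [MulOpposite.unop_op, ← conjEnd_mul, show h * g = g * (g⁻¹ * h * g) by group, conjEnd_mul,
      hE _ (mem_Fix_smul.1 hh)]⟩
  one_smul φ := Subtype.ext (MulOpposite.unop_injective (conjEnd_one _))
  mul_smul g h φ := Subtype.ext (MulOpposite.unop_injective (conjEnd_mul g h _))

theorem unop_smul_suppEnd (g : G) (φ : suppEnd G A F Q) :
    (g • φ).1.unop = conjEnd F Q g φ.1.unop := rfl

theorem suppEnd_ext {φ ψ : suppEnd G A F Q} (h : φ.1.unop = ψ.1.unop) : φ = ψ :=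
  Subtype.ext (MulOpposite.unop_injective h)

theorem smul_add_suppEnd (g : G) (φ ψ : suppEnd G A F Q) : g • (φ + ψ) = g • φ + g • ψ :=
  suppEnd_ext (map_add (conjEnd F Q g) _ _)

theorem smul_smul_suppEnd (g : G) (c : F) (φ : suppEnd G A F Q) : g • c • φ = c • g • φ :=
  suppEnd_ext (map_smul (conjEnd F Q g) _ _)

theorem smul_mul_suppEnd (g : G) (φ ψ : suppEnd G A F Q) : g • (φ * ψ) = g • φ * g • ψ :=
  suppEnd_ext (map_mul (conjEnd F Q g) _ _)

theorem smul_one_suppEnd (g : G) : g • (1 : suppEnd G A F Q) = 1 :=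
  suppEnd_ext (map_one (conjEnd F Q g))

theorem exists_supports_suppEnd (φ : suppEnd G A F Q) : ∃ E : Finset A, Supports G E φ := by
  obtain ⟨E, hE⟩ := φ.2
  exact ⟨E, fun g hg => suppEnd_ext (hE g hg)⟩

theorem Supports.apply_smul {T : Finset A} {φ : suppEnd G A F Q} (h : Supports G T φ) {g : G}
    (hg : g ∈ Fix G T) (q p : Q) :
    φ.1.unop (Finsupp.single (g • q) 1) (g • p) = φ.1.unop (Finsupp.single q 1) p := by
  have h1 : conjEnd F Q g φ.1.unop = φ.1.unop := congrArg (fun x => x.1.unop) (h g hg)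
  conv_lhs => rw [← h1, conjEnd_single, inv_smul_smul, inv_smul_smul]

variable (G A F Q) in
/-- The endomorphisms supported by `J`. -/
noncomputable def supportedBy (J : Finset A) : Submodule F (suppEnd G A F Q) where
  carrier := {φ | Supports G J φ}
  add_mem' := fun hφ hψ g hg => by rw [smul_add_suppEnd, hφ g hg, hψ g hg]
  zero_mem' := fun g _ => suppEnd_ext (map_zero (conjEnd F Q g))
  smul_mem' := fun c φ hφ g hg => by rw [smul_smul_suppEnd, hφ g hg]

variable [PartialOrder A] {S : Finset A} (tm : Tame G S) {B : Set Q} (hB : B.Finite)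
  (hcov : ∀ q : Q, ∃ g : G, ∃ b ∈ B, q = g • b)
  (hsupp : ∀ q : Q, ∃ E : Finset A, Supports G E q)
include tm hB hcov hsupp

/-- A state supported by `K` is alone in its `Fix G K`-orbit, and there are finitely many such
orbits. -/
theorem finite_supported (K : Finset A) : {q : Q | Supports G K q}.Finite := by
  obtain ⟨r, hr, h⟩ := tm.exists_finite_reps_of_finite K hB fun q _ => hsupp q
  refine hr.subset fun q hq => ?_
  obtain ⟨g, b, hb, rfl⟩ := hcov q
  obtain ⟨y, hy, k, hk, e⟩ := h b hb g
  have h1 := hq k⁻¹ (inv_mem hk)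
  rw [e, inv_smul_smul] at h1
  rw [e, ← h1]
  exact hy

/-- The pairs form finitely many orbits under `Fix G J`. -/
theorem exists_finite_pairs (J : Finset A) : ∃ r : Set (Q × Q), r.Finite ∧
    ∀ x : Q × Q, ∃ y ∈ r, ∃ h ∈ Fix G J, x = h • y := by
  obtain ⟨r₁, hr₁, h₁⟩ := tm.exists_finite_reps_of_finite J hB fun q _ => hsupp q
  choose E hE using hsupp
  choose r₂ hr₂ h₂ using fun q : Q =>
    tm.exists_finite_reps_of_finite (J ∪ E q) hB fun b _ => ⟨E b, hE b⟩
  refine ⟨⋃ q ∈ r₁, (fun p => (q, p)) '' r₂ q, hr₁.biUnion fun q _ => (hr₂ q).image _, ?_⟩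
  rintro ⟨q, p⟩
  obtain ⟨g, b, hb, rfl⟩ := hcov q
  obtain ⟨y, hy, h, hh, e⟩ := h₁ b hb g
  obtain ⟨g', b', hb', e'⟩ := hcov (h⁻¹ • p)
  obtain ⟨z, hz, k, hk, ek⟩ := h₂ y b' hb' g'
  refine ⟨(y, z), ?_, h * k, mul_mem hh (Fix_anti Finset.subset_union_left hk), ?_⟩
  · simp only [Set.mem_iUnion]
    exact ⟨y, hy, z, hz, rfl⟩
  · have h1 : k • y = y := hE y k (Fix_anti Finset.subset_union_right hk)
    rw [e, Prod.smul_mk, mul_smul, mul_smul, h1, ← ek, ← e', smul_inv_smul]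

/-- Matrix entries are constant on `Fix G J`-orbits of pairs, so finitely many entries determine the
endomorphism. -/
theorem finite_supportedBy (J : Finset A) : Module.Finite F (supportedBy G A F Q J) := by
  obtain ⟨r, hr, h⟩ := exists_finite_pairs tm hB hcov hsupp J
  have := hr.to_subtype
  let ev : supportedBy G A F Q J →ₗ[F] r → F :=
    { toFun := fun φ x => φ.1.1.unop (Finsupp.single x.1.1 1) x.1.2
      map_add' := fun _ _ => rfl
      map_smul' := fun _ _ => rfl }
  refine Module.Finite.of_injective ev fun φ ψ hφψ => Subtype.ext (suppEnd_ext ?_)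
  refine end_ext fun q p => ?_
  obtain ⟨⟨q', p'⟩, hy, g, hg, e⟩ := h (q, p)
  obtain ⟨rfl, rfl⟩ := Prod.ext_iff.1 e
  have h1 : Supports G J φ.1 := φ.2
  have h2 : Supports G J ψ.1 := ψ.2
  have h3 := congrFun hφψ ⟨_, hy⟩
  change φ.1.1.unop (Finsupp.single (g • q') 1) (g • p') =
    ψ.1.1.unop (Finsupp.single (g • q') 1) (g • p')
  rw [h1.apply_smul hg, h2.apply_smul hg]
  exact h3

attribute [local instance] Finsupp.comapDistribMulAction

/-- Every finitely supported endomorphism is a linear combination of endomorphisms with supports of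
bounded size. -/
theorem exists_bounded_supports : ∃ D : ℕ, ∀ φ : suppEnd G A F Q,
    φ ∈ Submodule.span F {ψ | ∃ J : Finset A, J.card ≤ D ∧ Supports G J ψ} := by
  have : SMulCommClass G F (Q × Q →₀ F) := ⟨fun g a x => Finsupp.mapDomain_smul a x⟩
  choose σ hσ using hsupp
  have hsupp2 : ∀ v : Q × Q →₀ F, ∃ E : Finset A, Supports G E v := fun v => by
    refine ⟨v.support.biUnion fun x => σ x.1 ∪ σ x.2, fun g hg => ?_⟩
    rw [Finsupp.comapSMul_def]
    conv_rhs => rw [← Finsupp.mapDomain_id (v := v)]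
    refine Finsupp.mapDomain_congr fun x hx => ?_
    have hg' := Fix_anti (Finset.subset_biUnion_of_mem (fun x : Q × Q => σ x.1 ∪ σ x.2) hx) hg
    exact Prod.ext (hσ _ g (Fix_anti Finset.subset_union_left hg'))
      (hσ _ g (Fix_anti Finset.subset_union_right hg'))
  obtain ⟨k, hk⟩ : ∃ k : ℕ, ∀ q : Q, ∃ y : Finset A, y.card ≤ k ∧ Supports G y q := by
    obtain ⟨k, hk⟩ := (hB.image fun b => (σ b).card).bddAbove
    refine ⟨k, fun q => ?_⟩
    obtain ⟨g, b, hb, rfl⟩ := hcov q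
    exact ⟨g • σ b, by rw [Finset.card_smul_finset]; exact hk ⟨b, hb, rfl⟩, (hσ b).smul g⟩
  have hspan : Submodule.span F
      {v : Q × Q →₀ F | ∃ y : Finset A, y.card ≤ k + k ∧ Supports G y v} = ⊤ := by
    rw [eq_top_iff]
    intro v _
    rw [← Finsupp.sum_single v]
    refine Submodule.sum_mem _ fun x _ => ?_
    rw [← mul_one (v x), ← smul_eq_mul, ← Finsupp.smul_single]
    refine Submodule.smul_mem _ _ (Submodule.subset_span ?_)
    obtain ⟨y, hy, hyx⟩ := hk x.1
    obtain ⟨z, hz, hzx⟩ := hk x.2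
    refine ⟨y ∪ z, (Finset.card_union_le _ _).trans (add_le_add hy hz), fun g hg => ?_⟩
    rw [Finsupp.comapSMul_single]
    congr 1
    exact Prod.ext (hyx g (Fix_anti Finset.subset_union_left hg))
      (hzx g (Fix_anti Finset.subset_union_right hg))
  obtain ⟨D, c, -, hcD, hcred⟩ := exists_reduction (F := F) tm hsupp2 hspan
  refine ⟨D, fun φ => ?_⟩
  obtain ⟨T, hT⟩ := exists_supports_suppEnd φ
  -- The matrix of `φ`, as a functional on the space with basis the pairs of states.
  let f : (Q × Q →₀ F) →ₗ[F] F :=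
    Finsupp.linearCombination F fun x => φ.1.unop (Finsupp.single x.1 1) x.2
  have hf : ∀ q p, f (Finsupp.single (q, p) 1) = φ.1.unop (Finsupp.single q 1) p :=
    fun q p => by simp [f]
  have hfT : aug G F (Q × Q →₀ F) T ≤ LinearMap.ker f := by
    refine Submodule.span_le.2 ?_
    rintro _ ⟨g, hg, v, rfl⟩
    rw [SetLike.mem_coe, LinearMap.mem_ker, map_sub, sub_eq_zero, Finsupp.comapSMul_def]
    simp only [f]
    rw [Finsupp.linearCombination_mapDomain]
    congr 2
    exact funext fun x => hT.apply_smul hg x.1 x.2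
  -- The functional `f` evaluated at generic translates over `J`; it is invariant under `Fix G J`.
  let m : Finset A → (Q × Q →₀ F) →ₗ[F] F := fun J =>
    (aug G F (Q × Q →₀ F) T).liftQ f hfT ∘ₗ generic tm hsupp2 J T
  have m_eq : ∀ {J E : Finset A} {v : Q × Q →₀ F} {i : G}, Supports G E v → i ∈ Fix G J →
      Indep S J (i • E) T → m J v = f (i • v) := by
    intro J E v i h1 h2 h3
    simp only [m, LinearMap.comp_apply, generic_eq tm hsupp2 h1 h2 h3]
    exact Submodule.liftQ_apply _ _ _
  have m_smul : ∀ J, ∀ g ∈ Fix G J, ∀ v, m J (g • v) = m J v := by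
    intro J g hg v
    have h1 : m J (g • v - v) = 0 := by
      simp only [m, LinearMap.comp_apply]
      rw [generic_eq_zero tm hsupp2 (sub_mem_aug hg v), map_zero]
    rwa [map_sub, sub_eq_zero] at h1
  have m_red : ∀ v, f v = (c T).sum fun J a => a * m J v := by
    intro v
    have h1 : f v = m T v := by
      simp only [m, LinearMap.comp_apply, generic_self]
      exact (Submodule.liftQ_apply _ _ _).symm
    rw [h1]
    simp only [m, LinearMap.comp_apply]
    rw [hcred T, map_finsuppSum]
    simp only [map_smul, smul_eq_mul]
  -- This keeps the rows finite, so that `m J` is again a matrix of an endomorphism. A nonzero entry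
  -- puts `i • p` in a finite set invariant under `Fix G (T ∪ i • σ q)`, so that set of atoms
  -- supports it; independence then removes the atoms of `T` that are not in `J`.
  have m_supp : ∀ J q p, m J (Finsupp.single (q, p) 1) ≠ 0 → Supports G (J ∪ σ q) p := by
    intro J q p hne
    obtain ⟨i, hi, hid⟩ := tm.exists_indep J (σ q ∪ σ p) T
    have h1 : Supports G (σ q ∪ σ p) (Finsupp.single (q, p) (1 : F)) := fun g hg => by
      rw [Finsupp.comapSMul_single, Prod.smul_mk, hσ q g (Fix_anti Finset.subset_union_left hg),
        hσ p g (Fix_anti Finset.subset_union_right hg)]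
    rw [m_eq h1 hi hid, Finsupp.comapSMul_single, Prod.smul_mk, hf] at hne
    have h2 : Supports G (T ∪ i • σ q) (i • p) := by
      refine tm.supports_of_finite_orbit ⟨_, (hσ p).smul i⟩ (fun p => ⟨σ p, hσ p⟩) ?_
      refine (Finset.finite_toSet (φ.1.unop (Finsupp.single (i • q) 1)).support).subset ?_
      rintro _ ⟨g, hg, rfl⟩
      rw [Finset.mem_coe, Finsupp.mem_support_iff]
      have h3 := hT.apply_smul (Fix_anti Finset.subset_union_left hg) (i • q) (i • p)
      rw [(hσ q).smul i g (Fix_anti Finset.subset_union_right hg)] at h3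
      rwa [h3]
    have h3 : Indep S (J ∪ i • σ q) (i • σ p) (T ∪ i • σ q) := by
      intro e he e' he' hle
      rcases Finset.mem_union.1 he' with h4 | h4
      · obtain ⟨j, hj, h5⟩ := hid e
          (Finset.smul_finset_subset_smul_finset Finset.subset_union_right he) e' h4 hle
        exact ⟨j, Finset.union_subset_union_left Finset.subset_union_left hj, h5⟩
      · exact ⟨e', Finset.mem_union_left _ (Finset.mem_union_right _ h4), le_rfl, hle⟩
    have h4 := (tm.supports_of_indep ((hσ p).smul i) h2 h3).smul i⁻¹
    rwa [inv_smul_smul, Finset.smul_finset_union, inv_smul_smul,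
      smul_eq_self_of_mem_Fix (inv_mem hi)] at h4
  have m_fin : ∀ J q, {p | m J (Finsupp.single (q, p) 1) ≠ 0}.Finite := fun J q =>
    (finite_supported tm hB hcov (fun q => ⟨σ q, hσ q⟩) (J ∪ σ q)).subset fun p hp =>
      m_supp J q p hp
  let row : Finset A → Q → Q →₀ F := fun J q =>
    Finsupp.ofSupportFinite (fun p => m J (Finsupp.single (q, p) 1)) (m_fin J q)
  let M : Finset A → Module.End F (Q →₀ F) := fun J => Finsupp.linearCombination F (row J)
  have hM : ∀ J q p, M J (Finsupp.single q 1) p = m J (Finsupp.single (q, p) 1) :=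
    fun J q p => by
      simp only [M, Finsupp.linearCombination_single, one_smul]
      rfl
  have hMJ : ∀ J, ∀ g ∈ Fix G J, conjEnd F Q g (M J) = M J := fun J g hg =>
    end_ext fun q p => by
      rw [conjEnd_single, hM, hM, ← m_smul J g hg, Finsupp.comapSMul_single, Prod.smul_mk,
        smul_inv_smul, smul_inv_smul]
  let ψ : Finset A → suppEnd G A F Q := fun J => ⟨MulOpposite.op (M J), J, hMJ J⟩
  have hφ : φ = ∑ J ∈ (c T).support, (c T) J • ψ J := by
    refine suppEnd_ext (end_ext fun q p => ?_)
    let ev : suppEnd G A F Q →ₗ[F] F :=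
      { toFun := fun x => x.1.unop (Finsupp.single q 1) p
        map_add' := fun _ _ => rfl
        map_smul' := fun _ _ => rfl }
    change _ = ev (∑ J ∈ (c T).support, (c T) J • ψ J)
    rw [← hf, m_red, map_sum]
    refine Finset.sum_congr rfl fun J _ => ?_
    rw [map_smul, smul_eq_mul]
    exact congrArg (c T J * ·) (hM J q p).symm
  rw [hφ]
  refine Submodule.sum_mem _ fun J hJ => Submodule.smul_mem _ _ (Submodule.subset_span ?_)
  exact ⟨J, (hcD T J hJ).2, fun g hg => suppEnd_ext (hMJ J g hg)⟩

theorem suppEnd_spanned : ∃ R : Set (suppEnd G A F Q), R.Finite ∧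
    Submodule.span F {φ | ∃ g : G, ∃ x ∈ R, φ = g • x} = ⊤ := by
  obtain ⟨D, hD⟩ := exists_bounded_supports (F := F) tm hB hcov hsupp
  obtain ⟨t, ht, htD⟩ := tm.finite_orbits_finset D
  have hfg : ∀ K : Finset A, ∃ R : Set (suppEnd G A F Q), R.Finite ∧
      Submodule.span F R = supportedBy G A F Q K := fun K => by
    have := finite_supportedBy (F := F) tm hB hcov hsupp K
    exact Submodule.fg_def.1 (Module.Finite.iff_fg.1 this)
  choose R hR hRspan using hfg
  refine ⟨⋃ K ∈ t, R K, ht.biUnion fun K _ => hR K, ?_⟩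
  rw [eq_top_iff]
  intro φ _
  refine Submodule.span_le.2 ?_ (hD φ)
  rintro ψ ⟨J, hJ, hψ⟩
  obtain ⟨K, hK, g, rfl⟩ := htD J hJ
  have h1 : g⁻¹ • ψ ∈ Submodule.span F (R K) := by
    rw [hRspan]
    have := hψ.smul g⁻¹
    rwa [inv_smul_smul] at this
  let L : suppEnd G A F Q →ₗ[F] suppEnd G A F Q :=
    { toFun := fun x => g • x
      map_add' := smul_add_suppEnd g
      map_smul' := smul_smul_suppEnd g }
  have h2 : L (g⁻¹ • ψ) = ψ := smul_inv_smul g ψ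
  rw [SetLike.mem_coe, ← h2]
  have h3 := Submodule.mem_map_of_mem (f := L) h1
  rw [Submodule.map_span] at h3
  refine Submodule.span_mono ?_ h3
  rintro _ ⟨x, hx, rfl⟩
  refine ⟨g, x, ?_, rfl⟩
  simp only [Set.mem_iUnion]
  exact ⟨K, hK, hx⟩

end Endomorphisms

end TameAction
namespace TameAction

/-! ### Weights of words by recursion on the word. -/

section Weight

open Atoms

variable {F Q : Type*} [Field F]

/-- Splitting off the first state of a run. Finiteness is carried along because `finsum` is 0 on
infinite supports. -/
theorem finsum_mul_cons {n : ℕ} {f : Q → F} (hf : {q | f q ≠ 0}.Finite)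
    {K : (Fin (n + 1) → Q) → F}
    (hK : ∀ q, {ρ : Fin n → Q | K (Fin.cons q ρ) ≠ 0}.Finite) :
    {ρ : Fin (n + 1) → Q | f (ρ 0) * K ρ ≠ 0}.Finite ∧
      ∑ᶠ ρ : Fin (n + 1) → Q, f (ρ 0) * K ρ = ∑ᶠ q, f q * ∑ᶠ ρ : Fin n → Q, K (Fin.cons q ρ) := by
  let e : Q × (Fin n → Q) ≃ (Fin (n + 1) → Q) := Fin.consEquiv fun _ => Q
  have he : ∀ x, e x = Fin.cons x.1 x.2 := fun x => rfl
  have hfin : (Function.support fun x : Q × (Fin n → Q) => f (e x 0) * K (e x)).Finite := by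
    refine (hf.biUnion fun q _ => (hK q).image fun ρ => (q, ρ)).subset ?_
    rintro ⟨q, ρ⟩ hx
    simp only [Function.mem_support, he, Fin.cons_zero] at hx
    simp only [Set.mem_iUnion]
    exact ⟨q, left_ne_zero_of_mul hx, ρ, right_ne_zero_of_mul hx, rfl⟩
  constructor
  · refine (hfin.image e).subset fun ρ hρ => ⟨e.symm ρ, ?_, e.apply_symm_apply ρ⟩
    rw [Function.mem_support, Equiv.apply_symm_apply]
    exact hρ
  · rw [← finsum_comp_equiv e, finsum_curry _ hfin]
    refine finsum_congr fun q => ?_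
    rw [mul_finsum]
    simp only [he, Fin.cons_zero]

variable {A : Type} {r : A → A → Prop}

/-- The weight of a word is determined by a function `ν` satisfying the recursion of the weights of
the runs from a given state. -/
theorem weight_eq {F : Type*} [Field F] {Al : AtomSet r} (M : WeightedAutomaton F Al)
    (ν : List Al → M.Q → F) (h0 : ∀ q, ν [] q = M.final q)
    (h1 : ∀ a w q, ν (a :: w) q = ∑ᶠ p, M.trans q a p * ν w p) (w : List Al) :
    M.weight w = ∑ᶠ q, M.init q * ν w q := by
  let P : (w : List Al) → (Fin (w.length + 1) → M.Q) → F := fun w ρ =>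
    (∏ i : Fin w.length, M.trans (ρ i.castSucc) (w.get i) (ρ i.succ)) *
      M.final (ρ (Fin.last w.length))
  have hP : ∀ a w (q : M.Q) (ρ : Fin (w.length + 1) → M.Q),
      P (a :: w) (Fin.cons q ρ) = M.trans q a (ρ 0) * P w ρ := by
    intro a w q ρ
    simp only [P]
    rw [← mul_assoc]
    congr 1
    exact Fin.prod_univ_succ _
  have key : ∀ w q, {ρ : Fin w.length → M.Q | P w (Fin.cons q ρ) ≠ 0}.Finite ∧
      ∑ᶠ ρ : Fin w.length → M.Q, P w (Fin.cons q ρ) = ν w q := by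
    intro w
    induction w with
    | nil =>
      intro q
      have : Finite (Fin ([] : List Al).length → M.Q) := inferInstanceAs (Finite (Fin 0 → M.Q))
      refine ⟨Set.toFinite _, ?_⟩
      rw [h0]
      change ∑ᶠ ρ : Fin 0 → M.Q, P [] (Fin.cons q ρ) = _
      rw [finsum_unique]
      simp [P]
    | cons a w ih =>
      intro q
      have h := finsum_mul_cons (M.trans_finite q a) fun p => (ih p).1
      simp only [hP]
      refine ⟨h.1, h.2.trans ?_⟩
      rw [h1]
      exact finsum_congr fun p => by rw [(ih p).2]
  have h := (finsum_mul_cons M.init_finite fun p => (key w p).1).2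
  rw [finsum_congr fun q => congrArg (M.init q * ·) (key w q).2] at h
  rw [← h]
  exact finsum_congr fun ρ => mul_assoc _ _ _

end Weight

open scoped Pointwise Classical

/-! ### Sets acted on by the stabilizer of `S`, realized as sets with atoms. -/

section Realization

open Atoms

variable {A : Type} {r : A → A → Prop} {S : Finset A}

theorem fixes_iff {π : r ≃r r} : Fixes π S ↔ π ∈ Fix (r ≃r r) S := by
  rw [mem_Fix]
  rfl

theorem mem_Fix_coe {E : Finset A} {g : Fix (r ≃r r) S} :
    g ∈ Fix (Fix (r ≃r r) S) E ↔ Fixes (g : r ≃r r) E := by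
  rw [mem_Fix]
  rfl

/-- The ambient universe of the realization of a set on which only `Fix (r ≃r r) S` acts. -/
def Induced (r : A → A → Prop) (X : Type*) : Type _ := (r ≃r r) × X → Prop

instance {X : Type*} : MulAction (r ≃r r) (Induced r X) where
  smul π p := fun x => p (π⁻¹ * x.1, x.2)
  one_smul p := funext fun x => by
    change p (1⁻¹ * x.1, x.2) = p x
    simp
  mul_smul π π' p := funext fun x => by
    change p ((π * π')⁻¹ * x.1, x.2) = p (π'⁻¹ * (π⁻¹ * x.1), x.2)
    rw [mul_inv_rev, mul_assoc]

variable {X : Type*} [MulAction (Fix (r ≃r r) S) X]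

variable (r S) in
/-- The realization of an element. -/
def realizeElem (x : X) : Induced r X := fun y =>
  ∃ h : Fix (r ≃r r) S, (h : r ≃r r) = y.1 ∧ y.2 = h⁻¹ • x

/-- An element is encoded as the graph of `h ↦ h⁻¹ • x` on the stabilizer of `S`. All automorphisms
act by translating the first coordinate, and on the stabilizer this agrees with the given action. -/
theorem smul_realizeElem (g : Fix (r ≃r r) S) (x : X) :
    (g : r ≃r r) • realizeElem r S x = realizeElem r S (g • x) := by
  funext y
  refine propext ⟨?_, ?_⟩
  · rintro ⟨h, h1, h2⟩
    refine ⟨g * h, ?_, ?_⟩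
    · rw [Subgroup.coe_mul, h1, mul_inv_cancel_left]
    · change y.2 = h⁻¹ • x at h2
      rw [h2, mul_inv_rev, mul_smul, inv_smul_smul]
  · rintro ⟨h, h1, h2⟩
    refine ⟨g⁻¹ * h, ?_, ?_⟩
    · rw [Subgroup.coe_mul, h1, Subgroup.coe_inv]
    · change y.2 = (g⁻¹ * h)⁻¹ • x
      rw [h2, mul_inv_rev, mul_smul, inv_inv]

theorem realizeElem_injective : Function.Injective (realizeElem r S : X → Induced r X) := by
  intro x y h
  have h1 : realizeElem r S x (1, x) := ⟨1, rfl, by simp⟩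
  rw [h] at h1
  obtain ⟨k, hk, e⟩ := h1
  obtain rfl : k = 1 := Subtype.ext hk
  simpa using e

/-- A set with a finitely supported action of `Fix (r ≃r r) S`, as a set with atoms. -/
def realize (hsupp : ∀ x : X, ∃ E : Finset A, Supports (Fix (r ≃r r) S) E x) : AtomSet r where
  Ambient := Induced r X
  carrier := Set.range (realizeElem r S : X → Induced r X)
  finSupp_carrier := ⟨S, fun π hπ => by
    lift π to Fix (r ≃r r) S using fixes_iff.1 hπ
    ext y
    constructor
    · rintro ⟨_, ⟨x, rfl⟩, rfl⟩
      exact ⟨π • x, (smul_realizeElem π x).symm⟩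
    · rintro ⟨x, rfl⟩
      exact ⟨_, ⟨π⁻¹ • x, rfl⟩, by simp only [smul_realizeElem, smul_inv_smul]⟩⟩
  finSupp_mem := by
    rintro _ ⟨x, rfl⟩
    obtain ⟨E, hE⟩ := hsupp x
    refine ⟨S ∪ E, fun π hπ => ?_⟩
    lift π to Fix (r ≃r r) S using fixes_iff.1 fun a ha => hπ a (Finset.mem_union_left _ ha)
    rw [smul_realizeElem, hE π (mem_Fix_coe.2 fun a ha => hπ a (Finset.mem_union_right _ ha))]

variable (hsupp : ∀ x : X, ∃ E : Finset A, Supports (Fix (r ≃r r) S) E x)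

/-- The elements of the realization. -/
noncomputable def realizeEquiv : realize hsupp ≃ X :=
  (Equiv.ofInjective _ realizeElem_injective).symm

theorem coe_realizeEquiv_symm (x : X) :
    ((realizeEquiv hsupp).symm x : (realize hsupp).Ambient) = (realizeElem r S x : Induced r X) := rfl

theorem realize_moves {π : r ≃r r} (hπ : Fixes π S) {x y : realize hsupp} :
    (realize hsupp).Moves π x y ↔
      realizeEquiv hsupp y = (⟨π, fixes_iff.1 hπ⟩ : Fix (r ≃r r) S) • realizeEquiv hsupp x := by
  obtain ⟨x, rfl⟩ := (realizeEquiv hsupp).symm.surjective x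
  obtain ⟨y, rfl⟩ := (realizeEquiv hsupp).symm.surjective y
  rw [Equiv.apply_symm_apply, Equiv.apply_symm_apply]
  change (realizeElem r S y : Induced r X) = π • realizeElem r S x ↔ _
  rw [show π • realizeElem r S x = realizeElem r S ((⟨π, fixes_iff.1 hπ⟩ : Fix (r ≃r r) S) • x) from
    smul_realizeElem ⟨π, fixes_iff.1 hπ⟩ x]
  exact realizeElem_injective.eq_iff

theorem realize_orbitFinite {R : Set X} (hR : R.Finite) :
    OrbitFinite r ((fun x : realize hsupp => (x : (realize hsupp).Ambient)) ''
      {x | ∃ g : Fix (r ≃r r) S, ∃ y ∈ R, realizeEquiv hsupp x = g • y}) := by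
  refine ⟨S, (realizeElem r S : X → Induced r X) '' R, hR.image _, ?_⟩
  ext z
  simp only [Set.mem_iUnion, Set.mem_image]
  constructor
  · rintro ⟨x, ⟨g, y, hy, hx⟩, rfl⟩
    refine ⟨realizeElem r S y, ⟨y, hy, rfl⟩, g, fixes_iff.2 g.2, ?_⟩
    rw [← Equiv.symm_apply_apply (realizeEquiv hsupp) x, hx, coe_realizeEquiv_symm]
    exact (smul_realizeElem g y).symm
  · rintro ⟨_, ⟨y, hy, rfl⟩, π, hπ, rfl⟩
    lift π to Fix (r ≃r r) S using fixes_iff.1 hπ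
    refine ⟨(realizeEquiv hsupp).symm (π • y), ⟨π, y, hy, Equiv.apply_symm_apply _ _⟩, ?_⟩
    rw [coe_realizeEquiv_symm]
    exact (smul_realizeElem π y).symm

end Realization

/-! ### Sets with atoms as sets acted on by the stabilizer of a support. -/

section Restriction

open Atoms

variable {A : Type} {r : A → A → Prop} {S : Finset A}

/-- The set `S` of atoms supports the set with atoms `X`. -/
def SuppCarrier (S : Finset A) (X : AtomSet r) : Prop :=
  ∀ π : r ≃r r, Fixes π S → ∀ x ∈ X.carrier, π • x ∈ X.carrier

theorem exists_suppCarrier (X : AtomSet r) : ∃ E : Finset A, ∀ S, E ⊆ S → SuppCarrier S X := by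
  obtain ⟨E, hE⟩ := X.finSupp_carrier
  refine ⟨E, fun S hS π hπ x hx => ?_⟩
  rw [← hE π fun a ha => hπ a (hS ha)]
  exact ⟨x, hx, rfl⟩

/-- The action on a set with atoms of the automorphisms fixing a support. -/
@[reducible]
def carrierAction {X : AtomSet r} (hX : SuppCarrier S X) : MulAction (Fix (r ≃r r) S) X where
  smul g x := ⟨(g : r ≃r r) • (x : X.Ambient), hX g (fixes_iff.2 g.2) x x.2⟩
  one_smul x := Subtype.ext (one_smul (r ≃r r) (x : X.Ambient))
  mul_smul g h x := Subtype.ext (mul_smul (g : r ≃r r) (h : r ≃r r) (x : X.Ambient))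

theorem moves_smul {X : AtomSet r} (hX : SuppCarrier S X) (g : Fix (r ≃r r) S) (x : X) :
    X.Moves (g : r ≃r r) x (letI := carrierAction hX; g • x) := rfl

theorem eq_smul_of_moves {X : AtomSet r} (hX : SuppCarrier S X) {π : r ≃r r} (hπ : Fixes π S)
    {x y : X} (h : X.Moves π x y) :
    y = (letI := carrierAction hX; (⟨π, fixes_iff.1 hπ⟩ : Fix (r ≃r r) S) • x) := Subtype.ext h

theorem carrier_supports {X : AtomSet r} (hX : SuppCarrier S X) (x : X) :
    letI := carrierAction hX
    ∃ E : Finset A, Supports (Fix (r ≃r r) S) E x := by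
  obtain ⟨E, hE⟩ := X.finSupp_mem x x.2
  exact ⟨E, fun g hg => Subtype.ext (hE g (mem_Fix_coe.1 hg))⟩

variable [PartialOrder A] (tm : ∀ S : Finset A, Tame (Fix (r ≃r r) S) S)
include tm

/-- Orbit-finiteness does not depend on the chosen constants: each orbit splits into finitely many
when further atoms are fixed. -/
theorem exists_orbit_reps {X : Type*} [MulAction (r ≃r r) X] {Y : Set X} (hY : OrbitFinite r Y)
    (hf : ∀ y ∈ Y, FinSupp r y) (S : Finset A) : ∃ R : Set X, R.Finite ∧ R ⊆ Y ∧
      ∀ y ∈ Y, ∃ z ∈ R, ∃ π : Fix (r ≃r r) S, y = (π : r ≃r r) • z := by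
  obtain ⟨E, T, hT, rfl⟩ := hY
  have hTY : ∀ t ∈ T, t ∈ ⋃ t ∈ T, {y | ∃ π : r ≃r r, Fixes π E ∧ y = π • t} := fun t ht => by
    simp only [Set.mem_iUnion]
    exact ⟨t, ht, 1, fun a _ => rfl, (one_smul _ _).symm⟩
  obtain ⟨R, hR, h⟩ := (tm E).exists_finite_reps_of_finite (X := X) S hT fun x hx => by
    obtain ⟨K, hK⟩ := hf x (hTY x hx)
    exact ⟨K, fun g hg => hK g (mem_Fix_coe.1 hg)⟩
  refine ⟨R ∩ ⋃ t ∈ T, {y | ∃ π : r ≃r r, Fixes π E ∧ y = π • t},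
    hR.subset Set.inter_subset_left, Set.inter_subset_right, fun y hy => ?_⟩
  simp only [Set.mem_iUnion] at hy
  obtain ⟨t, ht, π, hπ, rfl⟩ := hy
  obtain ⟨z, hz, k, hk, e⟩ := h t ht ⟨π, fixes_iff.1 hπ⟩
  refine ⟨z, ⟨hz, ?_⟩, ⟨k, fixes_iff.1 (mem_Fix_coe.1 hk)⟩, e⟩
  simp only [Set.mem_iUnion]
  refine ⟨t, ht, ((k⁻¹ * ⟨π, fixes_iff.1 hπ⟩ : Fix (r ≃r r) E) : r ≃r r), fixes_iff.2 (Subtype.prop _), ?_⟩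
  change z = (k⁻¹ * ⟨π, fixes_iff.1 hπ⟩ : Fix (r ≃r r) E) • t
  rw [mul_smul, e, inv_smul_smul]

end Restriction

end TameAction
namespace TameAction

open scoped Pointwise Classical
open Atoms

/-! ### The three implications. -/

section Implications

variable {A : Type} {r : A → A → Prop}

theorem finsum_comp_injective {F Q X : Type*} [Field F] {j : Q → X} (hj : Function.Injective j)
    (l : X →₀ F) (hl : ∀ x ∈ l.support, x ∈ Set.range j) (g : X → F) :
    ∑ᶠ q, l (j q) * g (j q) = l.sum fun x b => b * g x := by
  have hsub : (Function.support fun x => l x * g x) ⊆ l.support := fun x hx =>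
    Finsupp.mem_support_iff.2 (left_ne_zero_of_mul hx)
  rw [← finsum_mem_range (f := fun x => l x * g x) hj, Finsupp.sum,
    ← finsum_eq_sum_of_support_subset _ hsub, ← finsum_mem_univ fun x => l x * g x]
  exact finsum_mem_inter_support_eq' _ _ Set.univ fun x hx => iff_of_true (hl x (hsub hx)) trivial

theorem apply_eq_finsum {F Q : Type*} [Field F] (ψ : (Q →₀ F) →ₗ[F] F) (l : Q →₀ F) :
    ψ l = ∑ᶠ p, l p * ψ (Finsupp.single p 1) := by
  refine Eq.trans ?_ (finsum_comp_injective Function.injective_id l (fun x _ => ⟨x, rfl⟩)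
    fun p => ψ (Finsupp.single p 1)).symm
  conv_lhs => rw [← Finsupp.sum_single l]
  rw [map_finsuppSum]
  refine Finsupp.sum_congr fun p _ => ?_
  rw [← smul_eq_mul, ← map_smul, Finsupp.smul_single, smul_eq_mul, mul_one]

theorem exists_automaton_of_monoid {F : Type*} [Field F] {Al : AtomSet r} {L : List Al → F}
    (M : OFSMonoid r F) (hM : M.Recognizes L) : ∃ B : OFSAutomaton F Al, ∀ w, B.output w = L w := by
  obtain ⟨h, f, ⟨S, hS⟩, hf, hL⟩ := hM
  obtain ⟨S', hS'⟩ := M.mul_finSupp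
  let B : OFSAutomaton F Al :=
    { M.toOFSSpace with
      trans := fun a =>
        { toFun := fun x => x * h (FreeMonoid.of a)
          map_add' := fun x y => M.add_mul x y _
          map_smul' := fun c x => M.smul_mul c x _ }
      trans_finSupp := ⟨S ∪ S', fun π hπ x x' a a' hx ha =>
        hS' π (fun b hb => hπ b (Finset.mem_union_right _ hb)) _ _ _ _ hx
          (hS π (fun b hb => hπ b (Finset.mem_union_left _ hb)) _ _
            (List.Forall₂.cons ha List.Forall₂.nil))⟩
      init := (1 : M.V)
      final := f
      final_finSupp := hf }
  refine ⟨B, fun w => ?_⟩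
  have key : ∀ (w : List Al) (x : M.V),
      w.foldl (fun (x : M.V) a => x * h (FreeMonoid.of a)) x = x * h (FreeMonoid.ofList w) := by
    intro w
    induction w with
    | nil => exact fun x => ((congrArg (x * ·) (map_one h)).trans (mul_one x)).symm
    | cons a w ih =>
      intro x
      rw [List.foldl_cons, ih, mul_assoc, ← map_mul]
      rfl
  rw [hL]
  change f (w.foldl (fun (x : M.V) a => x * h (FreeMonoid.of a)) 1) = _
  rw [key, one_mul]

variable [PartialOrder A] (tm : ∀ S : Finset A, Tame (Fix (r ≃r r) S) S)
include tm

theorem exists_weighted_of_automaton {F : Type*} [Field F] {Al : AtomSet r}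
    (B : OFSAutomaton F Al) : ∃ W : WeightedAutomaton F Al, ∀ w, W.weight w = B.output w := by
  obtain ⟨E₁, hE₁⟩ := exists_suppCarrier Al
  obtain ⟨E₂, hE₂⟩ := exists_suppCarrier B.V
  obtain ⟨E₃, hE₃⟩ := B.add_finSupp
  obtain ⟨E₄, hE₄⟩ := B.smul_finSupp
  obtain ⟨E₅, hE₅⟩ := B.trans_finSupp
  obtain ⟨E₆, hE₆⟩ := B.final_finSupp
  obtain ⟨E₇, hE₇⟩ := B.V.finSupp_mem B.init B.init.2
  -- One set of constants supports all the data, so everything becomes equivariant for its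
  -- stabilizer.
  obtain ⟨S, h₁, h₂, h₃, h₄, h₅, h₆, h₇⟩ : ∃ S : Finset A, E₁ ⊆ S ∧ E₂ ⊆ S ∧ E₃ ⊆ S ∧ E₄ ⊆ S ∧
      E₅ ⊆ S ∧ E₆ ⊆ S ∧ E₇ ⊆ S := by
    refine ⟨E₁ ∪ (E₂ ∪ (E₃ ∪ (E₄ ∪ (E₅ ∪ (E₆ ∪ E₇))))), ?_, ?_, ?_, ?_, ?_, ?_, ?_⟩ <;>
      intro a ha <;> simp [ha]
  have hAl := hE₁ S h₁
  have hV := hE₂ S h₂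
  have hfix : ∀ (g : Fix (r ≃r r) S) {E : Finset A}, E ⊆ S → Fixes (g : r ≃r r) E :=
    fun g E hE a ha => fixes_iff.2 g.2 a (hE ha)
  let actAl := carrierAction hAl
  let actV := carrierAction hV
  have hmv : ∀ {g : Fix (r ≃r r) S} {x y : B.V}, B.V.Moves (g : r ≃r r) x y → y = g • x :=
    fun h => Subtype.ext h
  have hadd : ∀ (g : Fix (r ≃r r) S) (x y : B.V), g • (x + y) = g • x + g • y := fun g x y =>
    (hmv (hE₃ g (hfix g h₃) x _ y _ (moves_smul hV g x) (moves_smul hV g y))).symm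
  let : DistribMulAction (Fix (r ≃r r) S) B.V :=
    { actV with
      smul_zero := fun g => by
        have := hadd g 0 0
        rw [add_zero] at this
        exact left_eq_add.1 this
      smul_add := hadd }
  have : SMulCommClass (Fix (r ≃r r) S) F B.V := ⟨fun g c x =>
    (hmv (hE₄ g (hfix g h₄) c x _ (moves_smul hV g x))).symm⟩
  obtain ⟨Bs, hBs, hBspan⟩ := B.spanned
  obtain ⟨R₀, hR₀, hR₀Y, hR₀cov⟩ := exists_orbit_reps tm hBs
    (by rintro _ ⟨y, _, rfl⟩; exact B.V.finSupp_mem y y.2) S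
  have hspan : Submodule.span F {v : B.V | ∃ g : Fix (r ≃r r) S,
      ∃ b ∈ (Subtype.val ⁻¹' R₀ : Set B.V), v = g • b} = ⊤ := by
    rw [eq_top_iff, ← hBspan]
    refine Submodule.span_mono fun b hb => ?_
    obtain ⟨z, hz, π, e⟩ := hR₀cov b ⟨b, hb, rfl⟩
    obtain ⟨z', -, rfl⟩ := hR₀Y hz
    exact ⟨π, z', hz, Subtype.ext e⟩
  obtain ⟨R, init, tr, fin, ν, hR, hRsupp, hinitR, htrR, hinit, htr, hfin, hν0, hν1, hν⟩ :=
    exists_weighted (F := F) (tm S) (carrier_supports hV)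
      (hR₀.preimage Subtype.val_injective.injOn) hspan (carrier_supports hAl)
      (δ := B.trans) (φ := B.final) (v₀ := B.init)
      (fun g a v => hmv
        (hE₅ g (hfix g h₅) v _ a _ (moves_smul hV g v) (moves_smul hAl g a)))
      (fun g v => hE₆ g (hfix g h₆) v _ (moves_smul hV g v))
      (fun g => Subtype.ext (hE₇ g (hfix g h₇)))
  let X : SubMulAction (Fix (r ≃r r) S) (Finset A × Set B.V) :=
    { carrier := {q | ∃ g : Fix (r ≃r r) S, ∃ x ∈ R, q = g • x}
      smul_mem' := by
        rintro g _ ⟨h, x, hx, rfl⟩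
        exact ⟨g * h, x, hx, (mul_smul g h x).symm⟩ }
  have hXsupp : ∀ x : X, ∃ E : Finset A, Supports (Fix (r ≃r r) S) E x := by
    rintro ⟨_, g, x, hx, rfl⟩
    obtain ⟨E, hE⟩ := hRsupp x hx
    exact ⟨g • E, fun k hk => Subtype.ext (hE.smul g k hk)⟩
  let j : realize hXsupp → Finset A × Set B.V := fun q => (realizeEquiv hXsupp q : X)
  have hj : Function.Injective j := Subtype.val_injective.comp (realizeEquiv hXsupp).injective
  have hjX : ∀ q, ∃ g : Fix (r ≃r r) S, ∃ x ∈ R, j q = g • x := fun q => (realizeEquiv hXsupp q).2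
  have hjrange : ∀ x, (∃ g : Fix (r ≃r r) S, ∃ y ∈ R, x = g • y) → x ∈ Set.range j := fun x hx =>
    ⟨(realizeEquiv hXsupp).symm ⟨x, hx⟩, by simp only [j, Equiv.apply_symm_apply]⟩
  have hjmoves : ∀ {π : r ≃r r} (hπ : Fixes π S) {p q : realize hXsupp},
      (realize hXsupp).Moves π p q → j q = (⟨π, fixes_iff.1 hπ⟩ : Fix (r ≃r r) S) • j p :=
    fun hπ p q h => congrArg Subtype.val ((realize_moves hXsupp hπ).1 h)
  let W : WeightedAutomaton F Al :=
    { Q := realize hXsupp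
      orbitFinite := by
        have h := realize_orbitFinite hXsupp (R := Subtype.val ⁻¹' R)
          (hR.preimage Subtype.val_injective.injOn)
        have h' : {x | ∃ g : Fix (r ≃r r) S, ∃ y ∈ (Subtype.val ⁻¹' R : Set X),
            realizeEquiv hXsupp x = g • y} = Set.univ := by
          refine Set.eq_univ_of_forall fun x => ?_
          obtain ⟨g, y, hy, e⟩ := hjX x
          exact ⟨g, ⟨y, 1, y, hy, (one_smul _ _).symm⟩, hy, Subtype.ext e⟩
        rw [h', Set.image_univ, Subtype.range_coe] at h
        exact h
      init := fun q => init (j q)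
      trans := fun q a p => tr (j q) a (j p)
      final := fun q => fin (j q)
      init_finSupp := ⟨S, fun π hπ x x' h => by
        change init (j x') = init (j x)
        rw [hjmoves hπ h]
        conv_lhs => rw [← hinit ⟨π, fixes_iff.1 hπ⟩]
        rw [Finsupp.comapSMul_apply, inv_smul_smul]⟩
      trans_finSupp := ⟨S, fun π hπ p p' a a' q q' hp ha hq => by
        obtain ⟨k, x, hx, e⟩ := hjX p
        rw [hjmoves hπ hp, hjmoves hπ hq, eq_smul_of_moves hAl hπ ha, e, htr k x hx,
          Finsupp.comapSMul_apply, inv_smul_smul]⟩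
      final_finSupp := ⟨S, fun π hπ x x' h => by
        obtain ⟨k, y, hy, e⟩ := hjX x
        change fin (j x') = fin (j x)
        rw [hjmoves hπ h, e, ← mul_smul, hfin _ y hy, hfin _ y hy]⟩
      init_finite := (init.support.finite_toSet.preimage hj.injOn).subset fun q hq =>
        Finsupp.mem_support_iff.2 hq
      trans_finite := fun q a => ((tr (j q) a).support.finite_toSet.preimage hj.injOn).subset
        fun p hp => Finsupp.mem_support_iff.2 hp }
  refine ⟨W, fun w => ?_⟩
  rw [weight_eq W (fun w q => ν w (j q)) (fun q => ?_) (fun a w q => ?_)]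
  · refine (finsum_comp_injective hj init (fun x hx => hjrange x (hinitR x hx)) (ν w)).trans ?_
    rw [← hν, output_eq]
    rfl
  · obtain ⟨k, y, hy, e⟩ := hjX q
    change ν [] (j q) = fin (j q)
    rw [e, hν0 k y hy]
  · obtain ⟨k, y, hy, e⟩ := hjX q
    refine Eq.trans ?_ (finsum_comp_injective hj (tr (j q) a)
      (fun x hx => hjrange x (htrR _ _ x hx)) (ν w)).symm
    rw [e, hν1 k y hy]

theorem exists_monoid_of_weighted {F : Type*} [Field F] {Al : AtomSet r}
    (W : WeightedAutomaton F Al) : ∃ M : OFSMonoid r F, M.Recognizes W.weight := by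
  obtain ⟨E₁, hE₁⟩ := exists_suppCarrier Al
  obtain ⟨E₂, hE₂⟩ := exists_suppCarrier W.Q
  obtain ⟨E₃, hE₃⟩ := W.init_finSupp
  obtain ⟨E₄, hE₄⟩ := W.trans_finSupp
  obtain ⟨E₅, hE₅⟩ := W.final_finSupp
  obtain ⟨S, h₁, h₂, h₃, h₄, h₅⟩ : ∃ S : Finset A, E₁ ⊆ S ∧ E₂ ⊆ S ∧ E₃ ⊆ S ∧ E₄ ⊆ S ∧
      E₅ ⊆ S := by
    refine ⟨E₁ ∪ (E₂ ∪ (E₃ ∪ (E₄ ∪ E₅))), ?_, ?_, ?_, ?_, ?_⟩ <;> intro a ha <;> simp [ha]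
  have hAl := hE₁ S h₁
  have hQ := hE₂ S h₂
  have hfix : ∀ (g : Fix (r ≃r r) S) {E : Finset A}, E ⊆ S → Fixes (g : r ≃r r) E :=
    fun g E hE a ha => fixes_iff.2 g.2 a (hE ha)
  let actAl := carrierAction hAl
  let actQ := carrierAction hQ
  have hinit : ∀ (g : Fix (r ≃r r) S) q, W.init (g • q) = W.init q := fun g q =>
    hE₃ g (hfix g h₃) q _ (moves_smul hQ g q)
  have htrans : ∀ (g : Fix (r ≃r r) S) q a p, W.trans (g • q) (g • a) (g • p) = W.trans q a p :=
    fun g q a p => hE₄ g (hfix g h₄) q _ a _ p _ (moves_smul hQ g q) (moves_smul hAl g a)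
      (moves_smul hQ g p)
  have hfinal : ∀ (g : Fix (r ≃r r) S) q, W.final (g • q) = W.final q := fun g q =>
    hE₅ g (hfix g h₅) q _ (moves_smul hQ g q)
  obtain ⟨R₀, hR₀, hR₀Y, hR₀cov⟩ := exists_orbit_reps tm W.orbitFinite W.Q.finSupp_mem S
  have hcov : ∀ q : W.Q, ∃ g : Fix (r ≃r r) S, ∃ b ∈ (Subtype.val ⁻¹' R₀ : Set W.Q),
      q = g • b := fun q => by
    obtain ⟨z, hz, π, e⟩ := hR₀cov q q.2
    exact ⟨π, ⟨z, hR₀Y hz⟩, hz, Subtype.ext e⟩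
  obtain ⟨R, hR, hRspan⟩ := suppEnd_spanned (F := F) (tm S)
    (hR₀.preimage Subtype.val_injective.injOn) hcov (carrier_supports hQ)
  let e : realize (exists_supports_suppEnd (G := Fix (r ≃r r) S) (A := A) (F := F) (Q := W.Q)) ≃
    suppEnd (Fix (r ≃r r) S) A F W.Q := realizeEquiv _
  let : AddCommGroup (realize (exists_supports_suppEnd (G := Fix (r ≃r r) S) (A := A) (F := F)
    (Q := W.Q))) := e.addCommGroup
  let : Module F (realize (exists_supports_suppEnd (G := Fix (r ≃r r) S) (A := A) (F := F)
    (Q := W.Q))) := e.module F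
  let : Monoid (realize (exists_supports_suppEnd (G := Fix (r ≃r r) S) (A := A) (F := F)
    (Q := W.Q))) := e.monoid
  have e_add : ∀ x y, e (x + y) = e x + e y := fun x y => e.apply_symm_apply _
  have e_smul : ∀ (c : F) x, e (c • x) = c • e x := fun c x => e.apply_symm_apply _
  have e_mul : ∀ x y, e (x * y) = e x * e y := fun x y => e.apply_symm_apply _
  have e_one : e 1 = 1 := e.apply_symm_apply _
  have e_moves : ∀ {π : r ≃r r} (hπ : Fixes π S) {x y}, (realize _).Moves π x y ↔
      e y = (⟨π, fixes_iff.1 hπ⟩ : Fix (r ≃r r) S) • e x := fun {π} hπ {x y} => realize_moves _ hπ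
  let M : OFSMonoid r F :=
    { V := realize (exists_supports_suppEnd (G := Fix (r ≃r r) S) (A := A) (F := F) (Q := W.Q))
      add_finSupp := ⟨S, fun π hπ x x' y y' hx hy => by
        rw [e_moves hπ] at hx hy ⊢
        rw [e_add, e_add, smul_add_suppEnd, hx, hy]⟩
      smul_finSupp := ⟨S, fun π hπ c x x' hx => by
        rw [e_moves hπ] at hx ⊢
        rw [e_smul, e_smul, smul_smul_suppEnd, hx]⟩
      spanned := ⟨_, realize_orbitFinite _ hR, by
        let L : suppEnd (Fix (r ≃r r) S) A F W.Q →ₗ[F]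
            realize (exists_supports_suppEnd (G := Fix (r ≃r r) S) (A := A) (F := F) (Q := W.Q)) :=
          { toFun := e.symm
            map_add' := fun x y => e.injective (by rw [e_add]; simp)
            map_smul' := fun c x => e.injective (by rw [RingHom.id_apply, e_smul]; simp) }
        rw [eq_top_iff]
        intro x _
        have h : e x ∈ Submodule.span F {φ | ∃ g : Fix (r ≃r r) S, ∃ y ∈ R, φ = g • y} := by
          rw [hRspan]
          trivial
        have h' := Submodule.mem_map_of_mem (f := L) h
        rw [Submodule.map_span] at h'
        have hx : L (e x) = x := e.symm_apply_apply x
        rw [hx] at h'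
        refine Submodule.span_mono ?_ h'
        rintro _ ⟨_, ⟨g, y, hy, rfl⟩, rfl⟩
        exact ⟨g, y, hy, e.apply_symm_apply _⟩⟩
      mul_finSupp := ⟨S, fun π hπ x x' y y' hx hy => by
        rw [e_moves hπ] at hx hy ⊢
        rw [e_mul, e_mul, smul_mul_suppEnd, hx, hy]⟩
      add_mul := fun x y z => e.injective (by simp only [e_add, e_mul, add_mul])
      mul_add := fun x y z => e.injective (by simp only [e_add, e_mul, mul_add])
      smul_mul := fun c x y => e.injective (by simp only [e_smul, e_mul, smul_mul_assoc])
      mul_smul := fun c x y => e.injective (by simp only [e_smul, e_mul, mul_smul_comm]) }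
  let δ : Al → Module.End F (W.Q →₀ F) := fun a => Finsupp.linearCombination F fun q =>
    Finsupp.ofSupportFinite (W.trans q a) (W.trans_finite q a)
  have hδ : ∀ a q p, δ a (Finsupp.single q 1) p = W.trans q a p := fun a q p => by
    simp only [δ, Finsupp.linearCombination_single, one_smul]
    rfl
  have hδg : ∀ (g : Fix (r ≃r r) S) a, conjEnd F W.Q g (δ a) = δ (g • a) := fun g a =>
    end_ext fun q p => by
      rw [conjEnd_single, hδ, hδ, ← htrans g, smul_inv_smul, smul_inv_smul]
  -- Transition operators, in the opposite algebra so that the first letter of a word acts first.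
  let d : Al → suppEnd (Fix (r ≃r r) S) A F W.Q := fun a => ⟨MulOpposite.op (δ a), by
    obtain ⟨E, hE⟩ := carrier_supports hAl a
    exact ⟨E, fun g hg => (hδg g a).trans (congrArg δ (hE g hg))⟩⟩
  have hd : ∀ (g : Fix (r ≃r r) S) a, d (g • a) = g • d a := fun g a =>
    suppEnd_ext (hδg g a).symm
  let I : W.Q →₀ F := Finsupp.ofSupportFinite W.init W.init_finite
  let fin : (W.Q →₀ F) →ₗ[F] F := Finsupp.linearCombination F W.final
  have hfin : ∀ (g : Fix (r ≃r r) S) v, fin (Finsupp.domLCongr (M := F) (R := F)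
      (MulAction.toPerm g : Equiv.Perm W.Q) v) = fin v := fun g v => by
    rw [Finsupp.domLCongr_apply, Finsupp.domCongr_apply, Finsupp.equivMapDomain_eq_mapDomain]
    simp only [fin]
    rw [Finsupp.linearCombination_mapDomain]
    congr 2
    exact funext fun q => hfinal g q
  have hI : ∀ g : Fix (r ≃r r) S, (Finsupp.domLCongr (M := F) (R := F)
      (MulAction.toPerm g : Equiv.Perm W.Q)).symm I = I := fun g =>
    Finsupp.ext fun q => hinit g q
  have hfI : ∀ (g : Fix (r ≃r r) S) (x : suppEnd (Fix (r ≃r r) S) A F W.Q), fin ((g • x).1.unop I) = fin (x.1.unop I) :=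
    fun g x => by
      rw [unop_smul_suppEnd, conjEnd, LinearEquiv.conjAlgEquiv_apply]
      simp only [LinearMap.comp_apply, LinearEquiv.coe_coe]
      rw [hI, hfin]
  let f : M.V →ₗ[F] F :=
    { toFun := fun x => fin ((e x).1.unop I)
      map_add' := fun x y => by
        rw [e_add]
        exact map_add fin _ _
      map_smul' := fun c x => by
        rw [e_smul]
        exact map_smul fin _ _ }
  let h : FreeMonoid Al →* M.V := FreeMonoid.lift fun a => e.symm (d a)
  have h_nil : e (h (FreeMonoid.ofList [])) = 1 := (congrArg e (map_one h)).trans e_one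
  have h_cons : ∀ a w, e (h (FreeMonoid.ofList (a :: w))) = d a * e (h (FreeMonoid.ofList w)) := by
    intro a w
    have h1 : h (FreeMonoid.ofList (a :: w)) = h (FreeMonoid.of a) * h (FreeMonoid.ofList w) :=
      map_mul h (FreeMonoid.of a) (FreeMonoid.ofList w)
    rw [h1]
    refine (e_mul _ _).trans (congrArg (· * _) ?_)
    rw [show h (FreeMonoid.of a) = e.symm (d a) from FreeMonoid.lift_eval_of _ _]
    exact e.apply_symm_apply _
  refine ⟨M, h, f, ⟨S, fun π hπ w w' hw => ?_⟩, ⟨S, fun π hπ x x' hx => ?_⟩, fun w => ?_⟩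
  · refine (e_moves hπ).2 ?_
    have key : ∀ w w' : List Al, List.Forall₂ (Al.Moves π) w w' →
        e (h (FreeMonoid.ofList w')) =
          (⟨π, fixes_iff.1 hπ⟩ : Fix (r ≃r r) S) • e (h (FreeMonoid.ofList w)) := by
      intro w w' hw
      induction hw with
      | nil =>
        rw [h_nil, smul_one_suppEnd]
      | cons ha _ ih => rw [h_cons, h_cons, smul_mul_suppEnd, ih, eq_smul_of_moves hAl hπ ha, hd]
    exact key _ _ hw
  · change fin ((e x').1.unop I) = fin ((e x).1.unop I)
    rw [(e_moves hπ).1 hx, hfI]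
  · change _ = fin ((e (h (FreeMonoid.ofList w))).1.unop I)
    rw [weight_eq W (fun w q => fin ((e (h (FreeMonoid.ofList w))).1.unop (Finsupp.single q 1)))
      (fun q => ?_) (fun a w q => ?_)]
    · exact (apply_eq_finsum (fin ∘ₗ (e (h (FreeMonoid.ofList w))).1.unop) I).symm
    · rw [h_nil]
      change fin (Finsupp.single q 1) = _
      simp [fin]
    · rw [h_cons]
      refine (apply_eq_finsum (fin ∘ₗ (e (h (FreeMonoid.ofList w))).1.unop)
        (δ a (Finsupp.single q 1))).trans ?_
      refine finsum_congr fun p => ?_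
      rw [hδ]
      rfl

end Implications

end TameAction

theorem mainTheorem8 {A : Type} (r : A → A → Prop)
    (hA : Nonempty (r ≃r (fun a b : ℕ => a = b)) ∨ Nonempty (r ≃r (fun a b : ℚ => a < b)))
    {F : Type*} [Field F] (Al : Atoms.AtomSet r) (hAl : Al.IsOrbitFinite) (L : List Al → F) :
    ((∃ M : Atoms.OFSMonoid r F, M.Recognizes L) ↔
      ∃ W : Atoms.WeightedAutomaton F Al, ∀ w, W.weight w = L w) ∧
    ((∃ M : Atoms.OFSMonoid r F, M.Recognizes L) ↔
      ∃ B : Atoms.OFSAutomaton F Al, ∀ w, B.output w = L w) := by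
  obtain ⟨P, tm⟩ := TameAction.exists_tame r hA
  have h13 : (∃ M : Atoms.OFSMonoid r F, M.Recognizes L) →
      ∃ B : Atoms.OFSAutomaton F Al, ∀ w, B.output w = L w := fun ⟨M, hM⟩ =>
    TameAction.exists_automaton_of_monoid M hM
  have h32 : (∃ B : Atoms.OFSAutomaton F Al, ∀ w, B.output w = L w) →
      ∃ W : Atoms.WeightedAutomaton F Al, ∀ w, W.weight w = L w := fun ⟨B, hB⟩ => by
    obtain ⟨W, hW⟩ := TameAction.exists_weighted_of_automaton tm B
    exact ⟨W, fun w => (hW w).trans (hB w)⟩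
  have h21 : (∃ W : Atoms.WeightedAutomaton F Al, ∀ w, W.weight w = L w) →
      ∃ M : Atoms.OFSMonoid r F, M.Recognizes L := fun ⟨W, hW⟩ => by
    obtain ⟨M, hM⟩ := TameAction.exists_monoid_of_weighted tm W
    exact ⟨M, funext hW ▸ hM⟩
  exact ⟨⟨h32 ∘ h13, h21⟩, ⟨h13, h21 ∘ h32⟩⟩
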